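/- Let $d\ge 0$ and consider space-time $\mathbf R^{d+1}\ni z=(t,x)$ with $|z|=|t|^{1/2}+|x|$ and, for multiindices, $|k|=2k_0+\sum_{i\ne0}k_i$. Let $\mathcal F$ be the set of formal expressions built from $X_0,\dots,X_d$ and $\Xi$ by a commutative associative product with unit $\mathbf 1$ and by operations $\mathcal I$, $\mathscr D_i$ ($1\le i\le d$), with the additive homogeneity $|X_0|=2$, $|X_i|=1$, $|\Xi|=\alpha<0$, where $\mathcal I$ adds $2$ and $\mathscr D_i$ adds $-1$. Put $\mathcal T=\{X^k\}$, $\mathcal I(X^k)=0$, $\mathscr D_iX^k=k_iX^{k-e_i}$. For each of the following three equations let $\mathcal U,\mathcal V\subset\mathcal F$ be the smallest sets such that $\mathcal T\subset\mathcal U\cap\mathcal V$, $\mathcal I(\tau)\in\mathcal U$ for $\tau\in\mathcal V\setminus\mathcal T$, and moreover - (dynamical $\Phi^4$, $\partial_t\Phi=\Delta\Phi+C\Phi-\Phi^3+\xi$; assume $\alpha>-3$) $\Xi\in\mathcal V$, and $\tau_1\tau_2\tau_3\in\mathcal V$ for $\tau_i\in\mathcal U$; - (KPZ, $\partial_th=\Delta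 h+|\nabla h|^2-C+\xi$; assume $\alpha>-2$) $\Xi\in\mathcal V$, and $\mathscr D_i\tau_1\cdot\mathscr D_i\tau_2\in\mathcal V$ (up to nonzero scalars) for $\tau_1,\tau_2\in\mathcal U$, $1\le i\le d$; - ($\partial_tu=\Delta u+f(u)+g(u)\xi$; assume $\alpha>-2$) $\Xi\prod_{i\le m}\tau_i\in\mathcal V$ and $\prod_{i\le m}\tau_i\in\mathcal V$ for $m\ge1$, $\tau_i\in\mathcal U$. Fix $\gamma>0$; let $T$ be the space of linear combinations of those $\tau\in\mathcal U\cup\mathcal V$ with $|\tau|<\gamma$, graded by homogeneity, with the $\ell^1$ norm of the coefficients on each $T_\beta$, and let $A$ be the set of the occurring homogeneities. Assume that $\mathbf 1$ is the only such $\tau$ with $|\tau|=0$. Let $T_+$ be the algebra of polynomials in commuting variables $Z_0,\dots,Z_d$ and $\mathcal J_k(\tau)$ ($\tau\in(\mathcal U\cup\mathcal V)\setminus\mathcal T$, $|k|<|\tau|+2$), and set $\mathcal J_k(\tau)=0$ for all other $(k,\tau)$. Let $\Delta$ be given by $\Delta X_i=X_i\otimes1-1\otimes Z_i$, $\Delta\Xi=\Xi\otimes1$,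 $\Delta(\tau\bar\tau)=\Delta\tau\,\Delta\bar\tau$, $\Delta\mathscr D_i\tau=(\mathscr D_i\otimes I)\Delta\tau$ and $$\Delta\mathcal I(\tau)=(\mathcal I\otimes I)\Delta\tau-\sum_{|k|<|\tau|+2}\tfrac1{k!}(X\otimes1-1\otimes Z)^k\,(1\otimes\mathcal J_k(\tau)).$$ Let $\Delta^+:T_+\to T_+\otimes T_+$ be the multiplicative map with $\Delta^+Z_i=Z_i\otimes1+1\otimes Z_i$ and $\Delta^+\mathcal J_k(\tau)=1\otimes\mathcal J_k(\tau)+\sum_m(\mathcal J_{k+m}\otimes\frac{Z^m}{m!})\Delta\tau$, and let $\mathcal A:T_+\to T_+$ be the multiplicative map with $\mathcal A Z_i=-Z_i$ and, with $\mathcal M$ the multiplication of $T_+$, $\mathcal A\mathcal J_k(\tau)=-\sum_m\mathcal M\bigl(\mathcal J_{k+m}\otimes\frac{(-Z)^m}{m!}\mathcal A\bigr)\Delta\tau$. For morphisms (unital algebra homomorphisms) $f,g:T_+\to\mathbf R$ put $\hat\Gamma_f=(I\otimes f)\Delta$, $f\circ g=(f\otimes g)\Delta^+$, $f^{-1}=f\mathcal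 A$, and let $G$ be the set of all $\hat\Gamma_f$, restricted to $T$. Let $K:\mathbf R^{d+1}\to\mathbf R$ be smooth away from $0$, supported in $\{|z|\le1\}$, with $K=\sum_{n\ge0}K_n$ (away from $0$) for smooth $K_n$ supported in $\{|z|\le2^{-n}\}$ such that for each $k$, $\sup_z|D^kK_n(z)|\lesssim2^{(d+|k|)n}$ uniformly in $n$ (a kernel of order $2$); assume $\int K(z)z^k\,dz=0$ whenever $|k|<\gamma$. For $\xi_\varepsilon:\mathbf R^{d+1}\to\mathbf R$ define recursively $(\Pi_zX_i)(z')=z_i'-z_i$, $\Pi_z\Xi=\xi_\varepsilon$, $\Pi_z\mathscr D_i\tau=\partial_i\Pi_z\tau$, $\Pi_z(\tau\bar\tau)=(\Pi_z\tau)(\Pi_z\bar\tau)$ and $$(\Pi_z\mathcal I(\tau))(z')=(K\star\Pi_z\tau)(z')-\sum_{|k|<|\tau|+2}\frac{(z'-z)^k}{k!}(D^{(k)}K\star\Pi_z\tau)(z),$$ where $D^{(k)}K\star g=D^{(k)}(K\star g)$. Let $f_z$ be the morphism with $f_z(Z_i)=z_i$, $f_z(\mathcal J_k(\tau))=(D^{(k)}K\star\Pi_z\tau)(z)$,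 and let $\Gamma_{zz'}=\hat\Gamma_{f_z^{-1}\circ f_{z'}}$. **Lemma.** For every smooth $\xi_\varepsilon$: every $\hat\Gamma_f$ maps $T$ to itself and $(A,T,G)$ is a regularity structure; all $\Pi_z\tau$, $\tau\in T$, are smooth functions, and $(\Pi,\Gamma)$ is a model for $(A,T,G)$. That is, $\Pi_z$ is a continuous linear map from $T$ to distributions, $\Gamma_{zz'}\in G$, $\Pi_z\Gamma_{zz'}=\Pi_{z'}$, $\Gamma_{zz'}\Gamma_{z'z''}=\Gamma_{zz''}$, and for $z,z'$ in any fixed compact set $$|\langle\Pi_z\tau,\varphi_z^\lambda\rangle|\lesssim\lambda^{\beta}\|\tau\|,\qquad\|\Gamma_{zz'}\tau\|_{\bar\beta}\lesssim|z-z'|^{\beta-\bar\beta}\|\tau\|,$$ uniformly over $\beta\in A$, $\tau\in T_\beta$, $\bar\beta\in A$ with $\bar\beta<\beta$, $\lambda\in(0,1]$, and smooth $\varphi$ supported in $\{|z|\le1\}$ with $|D^k\varphi|\le1$ for all $|k|\le1+|\inf A|$, where $\varphi_z^\lambda(s,y)=\lambda^{-d-2}\varphi(\lambda^{-2}(s-t),\lambda^{-1}(y-x))$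 for $z=(t,x)$. -/

import Mathlib

open scoped TensorProduct Distributions ContDiff

noncomputable section

namespace RS

/-! ### Space-time with the parabolic scaling -/

/-- Space-time `ℝ^{d+1}`; the coordinate `0` is time. -/
abbrev Pt (d : ℕ) : Type := Fin (d + 1) → ℝ

/-- Multiindices. -/
abbrev MI (d : ℕ) : Type := Fin (d + 1) → ℕ

/-- Parabolic degree `|k| = 2 k₀ + ∑_{i ≠ 0} k_i` of a multiindex. -/
def sdeg {d : ℕ} (k : MI d) : ℕ := 2 * k 0 + ∑ i : Fin d, k i.succ

/-- `k! = ∏ k_i!`. -/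
def mfact {d : ℕ} (k : MI d) : ℕ := ∏ i, (k i).factorial

/-- `x^k = ∏ x_i ^ k_i` in any commutative monoid. -/
def mpow {M : Type*} [CommMonoid M] {d : ℕ} (x : Fin (d + 1) → M) (k : MI d) : M :=
  ∏ i, x i ^ k i

/-- The finite set of all multiindices `k` with `|k| < r`. -/
def below (d : ℕ) (r : ℝ) : Finset (MI d) :=
  (Fintype.piFinset fun _ => Finset.range ⌈r⌉₊).filter fun k => (sdeg k : ℝ) < r

/-- The parabolic "norm" `|z| = |t|^{1/2} + |x|`, with `|x|` the Euclidean norm. -/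
def pnorm {d : ℕ} (z : Pt d) : ℝ := √|z 0| + √(∑ i : Fin d, z i.succ ^ 2)

/-- The partial derivative `∂_i g`. -/
def pd {d : ℕ} (i : Fin (d + 1)) (g : Pt d → ℝ) : Pt d → ℝ :=
  fun z => fderiv ℝ g z (Pi.single i 1)

/-- The iterated partial derivative `D^k g` (for smooth `g` the order of the derivatives is
irrelevant). -/
def Dk {d : ℕ} (k : MI d) (g : Pt d → ℝ) : Pt d → ℝ :=
  (List.finRange (d + 1)).foldr (fun i h => (pd i)^[k i] h) g

/-! ### Regularity structures -/

/-- The data of a regularity structure: index set `A`, model space `T` with homogeneous components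
`comp α = T_α`, the functions `nrm α x = ‖x‖_α` (norm of the component of `x` in `T_α`), the
distinguished vector `one`, and a set `G` of linear operators on `T`. -/
structure RegData where
  T : Type
  [instAdd : AddCommGroup T]
  [instMod : Module ℝ T]
  A : Set ℝ
  comp : ℝ → Submodule ℝ T
  nrm : ℝ → T → ℝ
  one : T
  G : Set (T →ₗ[ℝ] T)

attribute [instance] RegData.instAdd RegData.instMod

open Classical in
/-- The data form a regularity structure. -/
structure IsRegularityStructure (S : RegData) : Prop where
  zero_mem : (0 : ℝ) ∈ S.A
  bddBelow : BddBelow S.A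
  locallyFinite : ∀ a b : ℝ, (S.A ∩ Set.Icc a b).Finite
  /-- `T = ⨁_{α ∈ A} T_α`. -/
  grading : DirectSum.IsInternal (fun α : S.A => S.comp α)
  /-- `‖·‖_α` is a seminorm on `T` that sees only the component in `T_α`, ... -/
  nrm_add : ∀ α ∈ S.A, ∀ x y : S.T, S.nrm α (x + y) ≤ S.nrm α x + S.nrm α y
  nrm_smul : ∀ α ∈ S.A, ∀ (c : ℝ) (x : S.T), S.nrm α (c • x) = |c| * S.nrm α x
  nrm_other : ∀ α ∈ S.A, ∀ β ∈ S.A, α ≠ β → ∀ x ∈ S.comp β, S.nrm α x = 0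
  /-- ... and `T_α` with it is a Banach space. -/
  nrm_definite : ∀ α ∈ S.A, ∀ x ∈ S.comp α, S.nrm α x = 0 → x = 0
  nrm_complete : ∀ α ∈ S.A, ∀ u : ℕ → S.T, (∀ n, u n ∈ S.comp α) →
    (∀ ε > 0, ∃ N, ∀ m ≥ N, ∀ n ≥ N, S.nrm α (u m - u n) < ε) →
    ∃ x ∈ S.comp α, Filter.Tendsto (fun n => S.nrm α (u n - x)) Filter.atTop (nhds 0)
  /-- `T_0` is one-dimensional with basis vector `one`. -/
  one_ne_zero : S.one ≠ 0
  comp_zero : S.comp 0 = Submodule.span ℝ {S.one}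
  /-- `G` is a group under composition, ... -/
  id_mem : LinearMap.id ∈ S.G
  comp_mem : ∀ g ∈ S.G, ∀ h ∈ S.G, g ∘ₗ h ∈ S.G
  inv_mem : ∀ g ∈ S.G, ∃ h ∈ S.G, g ∘ₗ h = LinearMap.id ∧ h ∘ₗ g = LinearMap.id
  /-- ... its elements are continuous, ... -/
  continuous : ∀ g ∈ S.G, ∀ α ∈ S.A, ∀ β ∈ S.A, ∃ C : ℝ, ∀ x ∈ S.comp α,
    S.nrm β (g x) ≤ C * S.nrm α x
  /-- ... upper triangular, and fix `one`. -/
  triangular : ∀ g ∈ S.G, ∀ α ∈ S.A, ∀ x ∈ S.comp α,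
    g x - x ∈ ⨆ β ∈ {β ∈ S.A | β < α}, S.comp β
  map_one : ∀ g ∈ S.G, g S.one = S.one

/-! ### Models -/

/-- Test functions on space-time. -/
abbrev Test (d : ℕ) : Type := 𝓓((⊤ : TopologicalSpace.Opens (Pt d)), ℝ)

/-- Distributions on space-time. -/
abbrev Distr (d : ℕ) : Type := 𝓓'((⊤ : TopologicalSpace.Opens (Pt d)), ℝ)

/-- The affine change of variables `(s, y) ↦ (λ⁻²(s - t), λ⁻¹(y - x))` for `z = (t, x)`. -/
def zoom {d : ℕ} (z : Pt d) (l : ℝ) (w : Pt d) : Pt d :=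
  fun i => (if i = 0 then (l ^ 2)⁻¹ else l⁻¹) * (w i - z i)

lemma zoom_contDiff {d : ℕ} (z : Pt d) (l : ℝ) : ContDiff ℝ ∞ (zoom z l) := by
  unfold zoom
  fun_prop

lemma zoom_isClosedEmbedding {d : ℕ} (z : Pt d) {l : ℝ} (hl : 0 < l) :
    Topology.IsClosedEmbedding (zoom z l) := by
  have h0 : ∀ i : Fin (d + 1), (if i = 0 then (l ^ 2)⁻¹ else l⁻¹) ≠ 0 := by
    intro i
    split_ifs <;> positivity
  let e : Pt d ≃ₜ Pt d :=
    { toFun := zoom z l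
      invFun := fun v i => (if i = 0 then (l ^ 2)⁻¹ else l⁻¹)⁻¹ * v i + z i
      left_inv := fun w => by
        funext i
        simp only [zoom]
        rw [← mul_assoc, inv_mul_cancel₀ (h0 i)]
        ring
      right_inv := fun v => by
        funext i
        simp only [zoom]
        rw [add_sub_cancel_right, ← mul_assoc, mul_inv_cancel₀ (h0 i), one_mul]
      continuous_toFun := (zoom_contDiff z l).continuous
      continuous_invFun := by fun_prop }
  exact e.isClosedEmbedding

/-- The rescaled test function
`φ_z^λ(s, y) = λ^{-d-2} φ(λ⁻²(s - t), λ⁻¹(y - x))`, `z = (t, x)`. -/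
def rescale {d : ℕ} (φ : Test d) (z : Pt d) (l : ℝ) (hl : 0 < l) : Test d where
  toFun := fun w => (l ^ (d + 2))⁻¹ * φ (zoom z l w)
  contDiff' := contDiff_const.mul (φ.contDiff.comp (zoom_contDiff z l))
  hasCompactSupport' :=
    (φ.hasCompactSupport.comp_isClosedEmbedding (zoom_isClosedEmbedding z hl)).mul_left
  tsupport_subset' := fun _ _ => trivial

/-- The set `B_r` of test functions supported in the (parabolic) unit ball whose derivatives of
order up to `1 + |r|` are bounded by `1`. The order of `D^k` is counted parabolically, which gives
the larger class of test functions. -/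
def testBall (d : ℕ) (r : ℝ) : Set (Test d) :=
  {φ | (∀ w, 1 < pnorm w → φ w = 0) ∧
    ∀ k : MI d, (sdeg k : ℝ) ≤ 1 + |r| → ∀ w, |Dk k φ w| ≤ 1}

/-- `(Π, Γ)` is a model for the regularity structure `S` on `ℝ^{d+1}`. -/
structure IsModel {d : ℕ} (S : RegData) (P : Pt d → S.T →ₗ[ℝ] Distr d)
    (Γ : Pt d → Pt d → S.T →ₗ[ℝ] S.T) : Prop where
  /-- `Π_z` is continuous (on each Banach space `T_α`). -/
  continuous : ∀ z, ∀ α ∈ S.A, ∀ φ : Test d, ∃ C : ℝ, ∀ x ∈ S.comp α,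
    |P z x φ| ≤ C * S.nrm α x
  mem_group : ∀ z z', Γ z z' ∈ S.G
  alg_Pi : ∀ z z', P z ∘ₗ Γ z z' = P z'
  alg_Gamma : ∀ z z' z'', Γ z z' ∘ₗ Γ z' z'' = Γ z z''
  bound_Pi : ∀ Q : Set (Pt d), IsCompact Q → ∃ C : ℝ, ∀ z ∈ Q, ∀ α ∈ S.A, ∀ x ∈ S.comp α,
    ∀ φ ∈ testBall d (sInf S.A), ∀ (l : ℝ) (hl : 0 < l), l ≤ 1 →
      |P z x (rescale φ z l hl)| ≤ C * l ^ α * S.nrm α x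
  bound_Gamma : ∀ Q : Set (Pt d), IsCompact Q → ∃ C : ℝ, ∀ z ∈ Q, ∀ z' ∈ Q,
    ∀ α ∈ S.A, ∀ β ∈ S.A, β < α → ∀ x ∈ S.comp α,
      S.nrm β (Γ z z' x) ≤ C * pnorm (z - z') ^ (α - β) * S.nrm α x

/-! ### Formal expressions -/

/-- Terms built from `1`, `X_i`, `Ξ`, the operations `I`, `𝒟_i` (`i` a spatial direction) and
multiplication. -/
inductive Raw (d : ℕ) : Type
  | one : Raw d
  | X : Fin (d + 1) → Raw d
  | Xi : Raw d
  | I : Raw d → Raw d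
  | D : Fin d → Raw d → Raw d
  | mul : Raw d → Raw d → Raw d

/-- The congruence that makes multiplication commutative and associative with unit `1`. -/
inductive Rel {d : ℕ} : Raw d → Raw d → Prop
  | refl (a : Raw d) : Rel a a
  | symm {a b : Raw d} : Rel a b → Rel b a
  | trans {a b c : Raw d} : Rel a b → Rel b c → Rel a c
  | mul_congr {a a' b b' : Raw d} : Rel a a' → Rel b b' → Rel (a.mul b) (a'.mul b')
  | I_congr {a a' : Raw d} : Rel a a' → Rel a.I a'.I
  | D_congr (i : Fin d) {a a' : Raw d} : Rel a a' → Rel (a.D i) (a'.D i)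
  | one_mul (a : Raw d) : Rel (Raw.one.mul a) a
  | mul_comm (a b : Raw d) : Rel (a.mul b) (b.mul a)
  | mul_assoc (a b c : Raw d) : Rel ((a.mul b).mul c) (a.mul (b.mul c))

instance rawSetoid (d : ℕ) : Setoid (Raw d) := ⟨Rel, Rel.refl, Rel.symm, Rel.trans⟩

/-- The collection `ℱ` of formal expressions. -/
def Formal (d : ℕ) : Type := Quotient (rawSetoid d)

namespace Formal

variable {d : ℕ}

def mk (a : Raw d) : Formal d := Quotient.mk _ a

lemma mk_eq {a b : Raw d} (h : Rel a b) : mk a = mk b := Quotient.sound h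

instance : CommMonoid (Formal d) where
  one := mk Raw.one
  mul := Quotient.map₂ Raw.mul fun _ _ h _ _ h' => Rel.mul_congr h h'
  one_mul := by rintro ⟨a⟩; exact mk_eq (Rel.one_mul a)
  mul_one := by rintro ⟨a⟩; exact mk_eq ((Rel.mul_comm _ _).trans (Rel.one_mul a))
  mul_comm := by rintro ⟨a⟩ ⟨b⟩; exact mk_eq (Rel.mul_comm a b)
  mul_assoc := by rintro ⟨a⟩ ⟨b⟩ ⟨c⟩; exact mk_eq (Rel.mul_assoc a b c)

def X (i : Fin (d + 1)) : Formal d := mk (Raw.X i)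

def Xi : Formal d := mk Raw.Xi

def I : Formal d → Formal d := Quotient.map Raw.I fun _ _ h => Rel.I_congr h

def D (i : Fin d) : Formal d → Formal d := Quotient.map (Raw.D i) fun _ _ h => Rel.D_congr i h

/-- The set `𝒯 = {X^k}` of Taylor monomials. -/
def poly (d : ℕ) : Set (Formal d) := Set.range (mpow X)

end Formal

/-- Homogeneity of a term, with `|Ξ| = α`. -/
def Raw.hom {d : ℕ} (α : ℝ) : Raw d → ℝ
  | one => 0
  | X i => if i = 0 then 2 else 1
  | Xi => α
  | I a => a.hom α + 2
  | D _ a => a.hom α - 1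
  | mul a b => a.hom α + b.hom α

lemma Raw.hom_congr {d : ℕ} (α : ℝ) {a b : Raw d} (h : Rel a b) : a.hom α = b.hom α := by
  induction h <;> simp_all [Raw.hom] <;> ring

/-- Homogeneity `|τ|` of a formal expression, with `|Ξ| = α`. -/
def Formal.hom {d : ℕ} (α : ℝ) : Formal d → ℝ :=
  Quotient.lift (Raw.hom α) fun _ _ h => Raw.hom_congr α h

/-! ### The sets `𝒰` and `𝒱` for the three equations -/

/-- The equations
* `phi4`: `∂_t Φ = ΔΦ + CΦ - Φ³ + ξ`;
* `kpz`: `∂_t h = Δh + |∇h|² - C + ξ`;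
* `mult`: `∂_t u = Δu + f(u) + g(u) ξ`. -/
inductive Equation : Type
  | phi4 | kpz | mult

open Formal in
/-- `IsDeriv i τ σ`: the formal expression `𝒟_i τ`, for `τ` a Taylor monomial or of the form
`I(τ')`, is a nonzero multiple of `σ`, where `𝒟_i X^k = k_i X^{k - e_i}`. -/
inductive IsDeriv {d : ℕ} (i : Fin d) : Formal d → Formal d → Prop
  | poly (k : MI d) : IsDeriv i (mpow X (k + Pi.single i.succ 1)) (mpow X k)
  | int (τ : Formal d) : IsDeriv i (I τ) (D i (I τ))

open Formal in
mutual

/-- The smallest set `𝒰` with the required closure properties. -/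
inductive InU {d : ℕ} : Equation → Formal d → Prop
  | poly (e) (k : MI d) : InU e (mpow X k)
  | int (e) (τ : Formal d) : InV e τ → τ ∉ poly d → InU e (I τ)

/-- The smallest set `𝒱` with the required closure properties. -/
inductive InV {d : ℕ} : Equation → Formal d → Prop
  | poly (e) (k : MI d) : InV e (mpow X k)
  | phi4_noise : InV .phi4 Xi
  | phi4_prod (τ₁ τ₂ τ₃ : Formal d) : InU .phi4 τ₁ → InU .phi4 τ₂ → InU .phi4 τ₃ →
      InV .phi4 (τ₁ * τ₂ * τ₃)
  | kpz_noise : InV .kpz Xi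
  | kpz_prod (i : Fin d) (τ₁ τ₂ σ₁ σ₂ : Formal d) : InU .kpz τ₁ → InU .kpz τ₂ →
      IsDeriv i τ₁ σ₁ → IsDeriv i τ₂ σ₂ → InV .kpz (σ₁ * σ₂)
  | mult_noise (m : ℕ) (τ : Fin m → Formal d) : 1 ≤ m → (∀ j, InU .mult (τ j)) →
      InV .mult (Xi * ∏ j, τ j)
  | mult_prod (m : ℕ) (τ : Fin m → Formal d) : 1 ≤ m → (∀ j, InU .mult (τ j)) →
      InV .mult (∏ j, τ j)

end

/-- The set `𝒰 ∪ 𝒱`. -/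
def UV (d : ℕ) (e : Equation) : Set (Formal d) := {τ | InU e τ ∨ InV e τ}

/-- The (sub)criticality threshold for `|Ξ|`. -/
def Equation.threshold : Equation → ℝ
  | phi4 => -3
  | kpz => -2
  | mult => -2

/-! ### The algebra `T_+`, the coproducts and the structure group -/

/-- Finite linear combinations of formal expressions. -/
abbrev Lin (d : ℕ) : Type := MonoidAlgebra ℝ (Formal d)

/-- The formal expression `τ` as an element of `Lin d`. -/
def basis {d : ℕ} (τ : Formal d) : Lin d := MonoidAlgebra.single τ 1

/-- The linear map on `Lin d` with prescribed values on formal expressions. -/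
def linExt {d : ℕ} {M : Type*} [AddCommGroup M] [Module ℝ M] (g : Formal d → M) :
    Lin d →ₗ[ℝ] M where
  toFun x := x.coeff.sum fun τ c => c • g τ
  map_add' x y := by
    simpa using Finsupp.sum_add_index' (by simp) (by intros; simp [add_smul])
  map_smul' c x := by
    simp [Finsupp.sum_smul_index, Finsupp.smul_sum, mul_smul]

open Classical in
/-- The abstract integration map on `Lin d`, with `I(X^k) = 0`. -/
def intMap (d : ℕ) : Lin d →ₗ[ℝ] Lin d :=
  linExt fun τ => if τ ∈ Formal.poly d then 0 else basis (Formal.I τ)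

open Classical in
/-- The abstract derivative on `Lin d`, with `𝒟_i X^k = k_i X^{k - e_i}`. -/
def derMap {d : ℕ} (i : Fin d) : Lin d →ₗ[ℝ] Lin d :=
  linExt fun τ =>
    if h : ∃ k : MI d, τ = mpow Formal.X k then
      (h.choose i.succ : ℝ) • basis (mpow Formal.X (h.choose - Pi.single i.succ 1))
    else basis (Formal.D i τ)

/-- Admissibility of the index `(k, τ)` for a generator `𝒥_k(τ)` of `T_+`:
`τ ∈ (𝒰 ∪ 𝒱) \ 𝒯` and `|k| < |τ| + 2`. -/
def JOk {d : ℕ} (α : ℝ) (e : Equation) (k : MI d) (τ : Formal d) : Prop :=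
  τ ∈ UV d e ∧ τ ∉ Formal.poly d ∧ (sdeg k : ℝ) < τ.hom α + 2

/-- The algebra `T_+` of polynomials in the variables `Z_i` and `𝒥_k(τ)`. -/
abbrev TPlus (d : ℕ) (α : ℝ) (e : Equation) : Type :=
  MvPolynomial (Fin (d + 1) ⊕ {p : MI d × Formal d // JOk α e p.1 p.2}) ℝ

section Hopf

variable {d : ℕ} (α : ℝ) (e : Equation)

def Zv (i : Fin (d + 1)) : TPlus d α e := MvPolynomial.X (Sum.inl i)

open Classical in
/-- `𝒥_k(τ)` as an element of `T_+`, set to `0` if it is not one of the generators. -/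
def Jv (k : MI d) (τ : Formal d) : TPlus d α e :=
  if h : JOk α e k τ then MvPolynomial.X (Sum.inr ⟨(k, τ), h⟩) else 0

/-- The linear map `𝒥_k : Lin d → T_+`. -/
def Jlin (k : MI d) : Lin d →ₗ[ℝ] TPlus d α e := linExt (Jv α e k)

/-- `Δ` on terms:
`Δ X_i = X_i ⊗ 1 - 1 ⊗ Z_i`, `Δ Ξ = Ξ ⊗ 1`, `Δ(τ τ') = Δτ Δτ'`, `Δ 𝒟_i τ = (𝒟_i ⊗ id) Δτ` and
`Δ I(τ) = (I ⊗ id) Δτ - ∑_{|k| < |τ| + 2} (X ⊗ 1 - 1 ⊗ Z)^k / k! (1 ⊗ 𝒥_k(τ))`. -/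
def Raw.delta : Raw d → Lin d ⊗[ℝ] TPlus d α e
  | one => 1
  | X i => basis (Formal.X i) ⊗ₜ 1 - 1 ⊗ₜ Zv α e i
  | Xi => basis Formal.Xi ⊗ₜ 1
  | I a => TensorProduct.map (intMap d) LinearMap.id a.delta -
      ∑ k ∈ below d (a.hom α + 2), (mfact k : ℝ)⁻¹ •
        (mpow (fun i => basis (Formal.X i) ⊗ₜ[ℝ] (1 : TPlus d α e) - 1 ⊗ₜ Zv α e i) k *
          (1 ⊗ₜ Jv α e k (Formal.mk a)))
  | D i a => TensorProduct.map (derMap i) LinearMap.id a.delta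
  | mul a b => a.delta * b.delta

lemma Raw.delta_congr {a b : Raw d} (h : Rel a b) : a.delta α e = b.delta α e := by
  induction h with
  | refl => rfl
  | symm _ ih => exact ih.symm
  | trans _ _ ih ih' => exact ih.trans ih'
  | mul_congr _ _ ih ih' => simp only [Raw.delta, ih, ih']
  | I_congr h ih => simp only [Raw.delta, ih, Raw.hom_congr α h, Formal.mk_eq h]
  | D_congr i _ ih => simp only [Raw.delta, ih]
  | one_mul a => simp only [Raw.delta, one_mul]
  | mul_comm a b => simp only [Raw.delta, mul_comm]
  | mul_assoc a b c => simp only [Raw.delta, mul_assoc]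

/-- `Δτ` for a formal expression `τ`. -/
def delta : Formal d → Lin d ⊗[ℝ] TPlus d α e :=
  Quotient.lift (Raw.delta α e) fun _ _ h => Raw.delta_congr α e h

variable {α e} in
/-- The operator `Γ̂_f = (id ⊗ f) Δ` associated with a morphism `f : T_+ → ℝ`. -/
def gammaHat (f : TPlus d α e →ₐ[ℝ] ℝ) : Lin d →ₗ[ℝ] Lin d :=
  (TensorProduct.rid ℝ (Lin d)).toLinearMap ∘ₗ
    TensorProduct.map LinearMap.id f.toLinearMap ∘ₗ linExt (delta α e)

/-- The coproduct of `T_+`: the multiplicative map with `Δ⁺ Z_i = Z_i ⊗ 1 + 1 ⊗ Z_i` and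
`Δ⁺ 𝒥_k(τ) = 1 ⊗ 𝒥_k(τ) + ∑_m (𝒥_{k+m} ⊗ Z^m / m!) Δτ`. -/
def deltaPlus : TPlus d α e →ₐ[ℝ] TPlus d α e ⊗[ℝ] TPlus d α e :=
  MvPolynomial.aeval (Sum.elim
    (fun i => Zv α e i ⊗ₜ 1 + 1 ⊗ₜ Zv α e i)
    (fun p => 1 ⊗ₜ Jv α e p.1.1 p.1.2 +
      ∑ m ∈ below d (p.1.2.hom α + 2), (mfact m : ℝ)⁻¹ •
        TensorProduct.map (Jlin α e (p.1.1 + m)) (LinearMap.mulLeft ℝ (mpow (Zv α e) m))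
          (delta α e p.1.2)))

/-- The antipode on `𝒥_k(τ)`,
`𝒜 𝒥_k(τ) = - ∑_m ℳ (𝒥_{k+m} ⊗ (-Z)^m / m! 𝒜) Δτ`, in terms of `x = (id ⊗ 𝒜) Δτ`;
it is set to `0` if `𝒥_k(τ) = 0`. -/
def antiJ (k : MI d) (τ : Formal d) (x : Lin d ⊗[ℝ] TPlus d α e) : TPlus d α e :=
  open Classical in
  if JOk α e k τ then
    - ∑ m ∈ below d (τ.hom α + 2), (mfact m : ℝ)⁻¹ •
      LinearMap.mul' ℝ (TPlus d α e) (TensorProduct.map (Jlin α e (k + m))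
        (LinearMap.mulLeft ℝ (mpow (fun i => - Zv α e i) m)) x)
  else 0

/-- `(id ⊗ 𝒜) Δ` on terms, by recursion. -/
def Raw.antiDelta : Raw d → Lin d ⊗[ℝ] TPlus d α e
  | one => 1
  | X i => basis (Formal.X i) ⊗ₜ 1 + 1 ⊗ₜ Zv α e i
  | Xi => basis Formal.Xi ⊗ₜ 1
  | I a => TensorProduct.map (intMap d) LinearMap.id a.antiDelta -
      ∑ k ∈ below d (a.hom α + 2), (mfact k : ℝ)⁻¹ •
        (mpow (fun i => basis (Formal.X i) ⊗ₜ[ℝ] (1 : TPlus d α e) + 1 ⊗ₜ Zv α e i) k *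
          (1 ⊗ₜ antiJ α e k (Formal.mk a) a.antiDelta))
  | D i a => TensorProduct.map (derMap i) LinearMap.id a.antiDelta
  | mul a b => a.antiDelta * b.antiDelta

lemma Raw.antiDelta_congr {a b : Raw d} (h : Rel a b) : a.antiDelta α e = b.antiDelta α e := by
  induction h with
  | refl => rfl
  | symm _ ih => exact ih.symm
  | trans _ _ ih ih' => exact ih.trans ih'
  | mul_congr _ _ ih ih' => simp only [Raw.antiDelta, ih, ih']
  | I_congr h ih => simp only [Raw.antiDelta, ih, Raw.hom_congr α h, Formal.mk_eq h]
  | D_congr i _ ih => simp only [Raw.antiDelta, ih]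
  | one_mul a => simp only [Raw.antiDelta, one_mul]
  | mul_comm a b => simp only [Raw.antiDelta, mul_comm]
  | mul_assoc a b c => simp only [Raw.antiDelta, mul_assoc]

/-- `(id ⊗ 𝒜) Δτ` for a formal expression `τ`. -/
def antiDelta : Formal d → Lin d ⊗[ℝ] TPlus d α e :=
  Quotient.lift (Raw.antiDelta α e) fun _ _ h => Raw.antiDelta_congr α e h

/-- The antipode `𝒜` of `T_+`, a multiplicative map with `𝒜 Z_i = - Z_i`. -/
def antipode : TPlus d α e →ₐ[ℝ] TPlus d α e :=
  MvPolynomial.aeval (Sum.elim (fun i => - Zv α e i)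
    (fun p => antiJ α e p.1.1 p.1.2 (antiDelta α e p.1.2)))

variable {α e}

/-- The product `f ∘ g = (f ⊗ g) Δ⁺` of morphisms of `T_+`. -/
def charMul (f g : TPlus d α e →ₐ[ℝ] ℝ) : TPlus d α e →ₐ[ℝ] ℝ :=
  (Algebra.TensorProduct.lift f g fun _ _ => Commute.all _ _).comp (deltaPlus α e)

/-- The inverse `f⁻¹ = f 𝒜` of a morphism of `T_+`. -/
def charInv (f : TPlus d α e →ₐ[ℝ] ℝ) : TPlus d α e →ₐ[ℝ] ℝ := f.comp (antipode α e)

end Hopf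

/-! ### The regularity structure of an equation, truncated at homogeneity `γ` -/

/-- The set `{τ ∈ 𝒰 ∪ 𝒱 : |τ| < γ}` of basis vectors. -/
def basisSet (d : ℕ) (α : ℝ) (e : Equation) (γ : ℝ) : Set (Formal d) :=
  {τ | τ ∈ UV d e ∧ τ.hom α < γ}

/-- The model space: linear combinations of elements of `basisSet`. -/
def modelSpace (d : ℕ) (α : ℝ) (e : Equation) (γ : ℝ) : Submodule ℝ (Lin d) :=
  Submodule.span ℝ (basis '' basisSet d α e γ)

/-- The part of homogeneity `β` of `Lin d`. -/
def homPart (d : ℕ) (α β : ℝ) : Submodule ℝ (Lin d) :=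
  Submodule.span ℝ (basis '' {τ : Formal d | τ.hom α = β})

open Classical in
/-- The `ℓ¹` norm of the component of homogeneity `β`. -/
def homNorm {d : ℕ} (α β : ℝ) (x : Lin d) : ℝ :=
  ∑ τ ∈ x.coeff.support with τ.hom α = β, |x.coeff τ|

lemma one_mem_modelSpace (d : ℕ) (α : ℝ) (e : Equation) {γ : ℝ} (hγ : 0 < γ) :
    (1 : Lin d) ∈ modelSpace d α e γ := by
  have h1 : (1 : Formal d) = mpow Formal.X (0 : MI d) := by simp [mpow]
  refine Submodule.subset_span ⟨1, ⟨Or.inl (h1 ▸ InU.poly e 0), ?_⟩, rfl⟩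
  exact hγ

/-- The triple `(A, T, G)` for the equation `e` with noise of homogeneity `α`, where `T` is spanned
by the elements of `𝒰 ∪ 𝒱` of homogeneity less than `γ`, and `G` consists of the restrictions to
`T` of the operators `Γ̂_f`. -/
def regData (d : ℕ) (α : ℝ) (e : Equation) {γ : ℝ} (hγ : 0 < γ) : RegData where
  T := modelSpace d α e γ
  A := Formal.hom α '' basisSet d α e γ
  comp β := (homPart d α β).comap (modelSpace d α e γ).subtype
  nrm β x := homNorm α β (x : Lin d)
  one := ⟨1, one_mem_modelSpace d α e hγ⟩
  G := {g | ∃ f : TPlus d α e →ₐ[ℝ] ℝ, ∀ x, (g x : Lin d) = gammaHat f (x : Lin d)}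

/-! ### The canonical model -/

/-- `K` is a kernel of order `β`: smooth away from the origin, supported in the (parabolic) unit
ball, and `K = ∑ₙ Kₙ` with `Kₙ` smooth and supported in the ball of radius `2⁻ⁿ` such that
`sup |D^k Kₙ| ≲ 2^{(d + 2 + |k| - β) n}`. -/
structure IsKernel {d : ℕ} (β : ℝ) (K : Pt d → ℝ) : Prop where
  smooth : ContDiffOn ℝ ∞ K {0}ᶜ
  supp : ∀ z, 1 < pnorm z → K z = 0
  decomp : ∃ Kn : ℕ → Pt d → ℝ,
    (∀ n, ContDiff ℝ ∞ (Kn n)) ∧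
    (∀ n z, ((2 : ℝ) ^ n)⁻¹ < pnorm z → Kn n z = 0) ∧
    (∀ k : MI d, ∃ C : ℝ, ∀ n z,
      |Dk k (Kn n) z| ≤ C * (2 : ℝ) ^ (((d : ℝ) + 2 + sdeg k - β) * n)) ∧
    ∀ z, z ≠ 0 → HasSum (fun n => Kn n z) (K z)

section Model

variable {d : ℕ} (α : ℝ) (K ξ : Pt d → ℝ)

/-- The convolution `K ⋆ g`. -/
def conv (K g : Pt d → ℝ) : Pt d → ℝ :=
  MeasureTheory.convolution K g (ContinuousLinearMap.mul ℝ ℝ) MeasureTheory.volume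

/-- `Π_z` on terms. For a smooth function `g`, the function `D^k K ⋆ g` is the derivative
`D^k (K ⋆ g)`. -/
def Raw.pi (z : Pt d) : Raw d → Pt d → ℝ
  | one => fun _ => 1
  | X i => fun w => w i - z i
  | Xi => ξ
  | I a => fun w => conv K (a.pi z) w -
      ∑ k ∈ below d (a.hom α + 2), mpow (w - z) k / mfact k * Dk k (conv K (a.pi z)) z
  | D i a => pd i.succ (a.pi z)
  | mul a b => a.pi z * b.pi z

lemma Raw.pi_congr (z : Pt d) {a b : Raw d} (h : Rel a b) : a.pi α K ξ z = b.pi α K ξ z := by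
  induction h with
  | refl => rfl
  | symm _ ih => exact ih.symm
  | trans _ _ ih ih' => exact ih.trans ih'
  | mul_congr _ _ ih ih' => simp only [Raw.pi, ih, ih']
  | I_congr h ih => simp only [Raw.pi, ih, Raw.hom_congr α h]
  | D_congr i _ ih => simp only [Raw.pi, ih]
  | one_mul a => exact one_mul (a.pi α K ξ z)
  | mul_comm a b => simp only [Raw.pi, mul_comm]
  | mul_assoc a b c => simp only [Raw.pi, mul_assoc]

/-- The function `Π_z τ` for a formal expression `τ`. -/
def piFun (z : Pt d) : Formal d → Pt d → ℝ :=
  Quotient.lift (Raw.pi α K ξ z) fun _ _ h => Raw.pi_congr α K ξ z h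

/-- The function `Π_z x` for a linear combination `x` of formal expressions. -/
def piLin (z : Pt d) : Lin d →ₗ[ℝ] (Pt d → ℝ) := linExt (piFun α K ξ z)

/-- The morphism `f_z : T_+ → ℝ` with `f_z(Z_i) = z_i` and
`f_z(𝒥_k(τ)) = (D^k K ⋆ Π_z τ)(z)`. -/
def fChar (e : Equation) (z : Pt d) : TPlus d α e →ₐ[ℝ] ℝ :=
  MvPolynomial.aeval (Sum.elim z fun p => Dk p.1.1 (conv K (piFun α K ξ z p.1.2)) z)

/-- `Γ_{zz'} = Γ̂_{γ_{zz'}}` with `γ_{zz'} = f_z⁻¹ ∘ f_{z'}`. -/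
def gammaLin (e : Equation) (z z' : Pt d) : Lin d →ₗ[ℝ] Lin d :=
  gammaHat (charMul (charInv (fChar α K ξ e z)) (fChar α K ξ e z'))

end Model

end RS

end

-- The algebraic part rests on Γ̂_f being an algebra morphism of `Lin d` that obeys explicit
-- recursions on X_i, Ξ, 𝒟_i and I. Subcriticality enters twice: below every homogeneity there are
-- only finitely many elements of 𝒰 ∪ 𝒱 (`finite_basisSet`), and those of homogeneity less than c
-- are built from I(τ) with |τ| < c only, which gives the truncated induction `UV_induction`. Both 𝒰
-- and 𝒱 are preserved by Γ̂_f, up to terms of lower homogeneity from the same set (`InU.tri`,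
-- `InV.tri`). Comparing recursions gives Γ̂_f Γ̂_g = Γ̂_{f ∘ g} (`gammaHat_charMul`), and the
-- recursion for 𝒜 is the equation for f⁻¹ in solved form (`charMul_charInv`). Hence the operators
-- form a group of triangular maps.
--
-- For the model, let Π be the interpretation without recentering, with I acting as convolution with
-- K (`bareAlg`). Because K annihilates polynomials of degree less than γ, in agreement with I(X^k)
-- = 0, an induction shows Π_z = Π Γ̂_{f_z} on T (`piFun_eq`): the Taylor polynomial subtracted in
-- Π_z I(τ) is the image under Π of the polynomial subtracted in Γ̂_{f_z} I(τ). As Γ_{zz'} is the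
-- inverse of Γ̂_{f_z} followed after Γ̂_{f_{z'}}, the identities relating Π_z, Π_{z'} and the Γ's
-- are then immediate.
--
-- The bounds use smoothness of the noise. K is integrable, so all functions involved are jointly
-- smooth in base point and argument, and Π_z I(τ) is a Taylor remainder of parabolic order |τ| + 2.
-- Such remainders of order r are O(l^r) at distance l, locally uniformly in the base point
-- (`taylorRem_bound`); this gives |Π_z τ| ≲ l^{|τ|} pointwise (`piFun_bound`). For Γ, the relation
-- f_z ∘ γ_{zz'} = f_{z'} expresses γ_{zz'}(𝒥_k(τ)) through the coefficients of Γ_{zz'}τ and Taylor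
-- remainders of D^k K ⋆ Π_z σ (`gammaChar_J`). In the submultiplicative norm that gives τ the
-- weight l^{|τ|}, induction yields a bound l^{|τ|} on Γ_{zz'}τ for |z - z'| ≤ l (`gammaLin_bound`);
-- the choice l = |z - z'| finishes the proof.

open scoped TensorProduct Distributions ContDiff

noncomputable section

namespace RS

variable {d : ℕ}

/-! ### Multiindices -/

/-- The scaling of the coordinate `i`. -/
def wt (i : Fin (d + 1)) : ℕ := if i = 0 then 2 else 1

lemma wt_pos (i : Fin (d + 1)) : 1 ≤ wt i := by unfold wt; split_ifs <;> simp

lemma wt_succ (i : Fin d) : wt i.succ = 1 := by simp [wt]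

lemma sdeg_eq_sum (k : MI d) : sdeg k = ∑ i, wt i * k i := by
  simp [sdeg, Fin.sum_univ_succ, wt]

lemma sdeg_add (k m : MI d) : sdeg (k + m) = sdeg k + sdeg m := by
  simp [sdeg_eq_sum, mul_add, Finset.sum_add_distrib]

@[simp] lemma sdeg_zero : sdeg (0 : MI d) = 0 := by simp [sdeg]

lemma sdeg_single (i : Fin (d + 1)) : sdeg (Pi.single i 1 : MI d) = wt i := by
  simp [sdeg_eq_sum, Pi.single_apply]

lemma le_sdeg (k : MI d) (i : Fin (d + 1)) : k i ≤ sdeg k := by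
  rw [sdeg_eq_sum]
  exact (Nat.le_mul_of_pos_left _ (wt_pos i)).trans
    (Finset.single_le_sum (f := fun i => wt i * k i) (fun _ _ => Nat.zero_le _) (Finset.mem_univ i))

lemma sdeg_mono {k m : MI d} (h : k ≤ m) : sdeg k ≤ sdeg m := by
  simp only [sdeg_eq_sum]
  exact Finset.sum_le_sum fun i _ => Nat.mul_le_mul_left _ (h i)

-- The cut-off at `⌈r⌉₊` in `below` loses nothing, since each entry of a multiindex is at most its
-- parabolic degree.
@[simp] lemma mem_below {k : MI d} {r : ℝ} : k ∈ below d r ↔ (sdeg k : ℝ) < r := by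
  simp only [below, Finset.mem_filter, Fintype.mem_piFinset, Finset.mem_range,
    and_iff_right_iff_imp]
  intro h i
  rw [Nat.lt_ceil]
  exact lt_of_le_of_lt (by exact_mod_cast le_sdeg k i) h

lemma sub_single_add {k : MI d} {i : Fin (d + 1)} (h : k i ≠ 0) :
    k - Pi.single i 1 + Pi.single i 1 = k := by
  funext j
  by_cases hj : j = i
  · subst hj; simp; omega
  · simp [hj]

section Powers

variable {M : Type*} [CommMonoid M]

@[simp] lemma mpow_zero (x : Fin (d + 1) → M) : mpow x (0 : MI d) = 1 := by simp [mpow]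

lemma map_mpow {N F : Type*} [CommMonoid N] [FunLike F M N] [MonoidHomClass F M N] (f : F)
    (x : Fin (d + 1) → M) (k : MI d) : f (mpow x k) = mpow (fun i => f (x i)) k := by
  simp [mpow]

end Powers

-- Divided powers and the binomial formula

section DividedPowers

variable {A : Type*} [CommRing A] [Algebra ℝ A]

/-- The divided power `x^k / k!`. -/
def dpow (x : Fin (d + 1) → A) (k : MI d) : A := (mfact k : ℝ)⁻¹ • mpow x k

lemma mfact_ne_zero (k : MI d) : (mfact k : ℝ) ≠ 0 := by
  simp [mfact, Finset.prod_eq_zero_iff, Nat.factorial_ne_zero]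

lemma mfact_pos (k : MI d) : (0 : ℝ) < mfact k :=
  lt_of_le_of_ne (Nat.cast_nonneg _) (mfact_ne_zero k).symm

@[simp] lemma dpow_zero (x : Fin (d + 1) → A) : dpow x (0 : MI d) = 1 := by simp [dpow, mfact]

lemma dpow_eq_prod (x : Fin (d + 1) → A) (k : MI d) :
    dpow x k = ∏ i, (((k i).factorial : ℝ)⁻¹ • x i ^ k i) := by
  simp only [dpow, mfact, mpow, Algebra.smul_def, Finset.prod_mul_distrib, ← map_prod]
  simp [Finset.prod_inv_distrib]

lemma map_dpow {B : Type*} [CommRing B] [Algebra ℝ B] (f : A →ₐ[ℝ] B)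
    (x : Fin (d + 1) → A) (k : MI d) : f (dpow x k) = dpow (fun i => f (x i)) k := by
  simp [dpow, map_mpow]

lemma dpow_eq_zero_of_zero {k : MI d} (hk : k ≠ 0) : dpow (0 : Fin (d + 1) → A) k = 0 := by
  obtain ⟨i, hi⟩ := Function.ne_iff.1 hk
  rw [dpow_eq_prod]
  exact Finset.prod_eq_zero (Finset.mem_univ i) (by simp [zero_pow hi])

/-- Dividing by factorials absorbs the binomial coefficients, so the reexpansion of Taylor
polynomials carries no combinatorial constants. -/
lemma factorial_inv_smul_add_pow (x y : A) (n : ℕ) :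
    ((n.factorial : ℝ)⁻¹ • (x + y) ^ n) = ∑ j ∈ Finset.range (n + 1),
      (((j.factorial : ℝ)⁻¹ • x ^ j) * (((n - j).factorial : ℝ)⁻¹ • y ^ (n - j))) := by
  rw [add_pow, Finset.smul_sum]
  refine Finset.sum_congr rfl fun j hj => ?_
  have hj' : j ≤ n := Nat.lt_succ_iff.1 (Finset.mem_range.1 hj)
  have h : ((n.choose j : ℕ) : A) = algebraMap ℝ A (n.choose j) := by simp
  rw [h, mul_comm _ (algebraMap ℝ A _), ← Algebra.smul_def, smul_smul, smul_mul_smul_comm]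
  congr 1
  rw [Nat.cast_choose ℝ hj']
  field_simp

lemma dpow_add (x y : Fin (d + 1) → A) (k : MI d) :
    dpow (x + y) k = ∑ j ∈ Fintype.piFinset fun i => Finset.range (k i + 1),
      dpow x j * dpow y (k - j) := by
  simp only [dpow_eq_prod, ← Finset.prod_mul_distrib, Pi.add_apply, factorial_inv_smul_add_pow]
  rw [Finset.prod_univ_sum]
  rfl

/-- Reexpansion of a polynomial around another point. -/
lemma sum_smul_dpow_add (r : ℝ) (a : MI d → ℝ) (ha : ∀ k, r ≤ sdeg k → a k = 0)
    (x : Fin (d + 1) → A) (c : Fin (d + 1) → ℝ) :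
    ∑ k ∈ below d r, a k • dpow (fun i => x i + algebraMap ℝ A (c i)) k =
      ∑ j ∈ below d r, (∑ m ∈ below d r, a (j + m) * dpow c m) • dpow x j := by
  have h1 : ∀ k, dpow (fun i => x i + algebraMap ℝ A (c i)) k =
      ∑ j ∈ Fintype.piFinset fun i => Finset.range (k i + 1), dpow c (k - j) • dpow x j := by
    intro k
    rw [show (fun i => x i + algebraMap ℝ A (c i)) = x + fun i => algebraMap ℝ A (c i) from rfl,
      dpow_add]
    refine Finset.sum_congr rfl fun j _ => ?_
    have h2 : dpow (fun i => algebraMap ℝ A (c i)) (k - j) = algebraMap ℝ A (dpow c (k - j)) :=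
      (map_dpow (Algebra.ofId ℝ A) c (k - j)).symm
    rw [Algebra.smul_def, mul_comm, h2]
  simp only [h1, Finset.smul_sum, Finset.sum_smul, smul_smul]
  rw [Finset.sum_sigma', Finset.sum_sigma']
  -- The pair (k, j) with j ≤ k corresponds to (j, k - j). The right-hand side also contains pairs
  -- with |j + m| ≥ r; these vanish by `ha`, hence a bijection between nonzero terms only.
  refine Finset.sum_bij_ne_zero (fun p _ _ => ⟨p.2, p.1 - p.2⟩) ?_ ?_ ?_ ?_
  · rintro ⟨k, j⟩ h _
    simp only [Finset.mem_sigma, mem_below, Fintype.mem_piFinset, Finset.mem_range,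
      Nat.lt_succ_iff] at h ⊢
    have h3 : sdeg j ≤ sdeg k := sdeg_mono h.2
    have h4 : sdeg (k - j) ≤ sdeg k := sdeg_mono (tsub_le_self)
    exact ⟨lt_of_le_of_lt (by exact_mod_cast h3) h.1, lt_of_le_of_lt (by exact_mod_cast h4) h.1⟩
  · rintro ⟨k, j⟩ h _ ⟨k', j'⟩ h' _ heq
    simp only [Finset.mem_sigma, mem_below, Fintype.mem_piFinset, Finset.mem_range,
      Nat.lt_succ_iff] at h h'
    simp only [Sigma.mk.injEq, heq_eq_eq] at heq
    obtain ⟨rfl, h3⟩ := heq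
    have : k = k' := by
      rw [← tsub_add_cancel_of_le (show j ≤ k from h.2), h3,
        tsub_add_cancel_of_le (show j ≤ k' from h'.2)]
    simp [this]
  · rintro ⟨j, m⟩ h hne
    have hlt : (sdeg (j + m) : ℝ) < r := by
      by_contra! hcon
      exact hne (by simp [ha _ hcon])
    refine ⟨⟨j + m, j⟩, ?_, ?_, ?_⟩
    · simpa [Fintype.mem_piFinset, Nat.lt_succ_iff] using hlt
    · simpa using hne
    · simp
  · rintro ⟨k, j⟩ h _
    simp only [Finset.mem_sigma, mem_below, Fintype.mem_piFinset, Finset.mem_range,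
      Nat.lt_succ_iff] at h
    rw [add_tsub_cancel_of_le (show j ≤ k from h.2)]

end DividedPowers

/-! ### Formal expressions -/

/-- The number of top-level factors other than the `X_i`. -/
def Raw.numSymb : Raw d → ℕ
  | one => 0
  | X _ => 0
  | Xi => 1
  | I _ => 1
  | D _ _ => 1
  | mul a b => a.numSymb + b.numSymb

/-- The multiindex of the top-level factors `X_i`. -/
def Raw.expo : Raw d → MI d
  | one => 0
  | X i => Pi.single i 1
  | Xi => 0
  | I _ => 0
  | D _ _ => 0
  | mul a b => a.expo + b.expo

namespace Formal

/-- This invariant separates the Taylor monomials (value 0) from the I(τ) (value 1) in the quotient.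
-/
def numSymb : Formal d → ℕ := Quotient.lift Raw.numSymb fun a b h => by
  change Rel a b at h
  induction h <;> simp_all [Raw.numSymb] <;> omega

/-- This invariant recovers k from X^k; hence the exponent chosen in `derMap` is the expected one.
-/
def expo : Formal d → MI d := Quotient.lift Raw.expo fun a b h => by
  change Rel a b at h
  induction h <;> simp_all [Raw.expo, add_comm, add_left_comm]

@[simp] lemma numSymb_I (τ : Formal d) : (I τ).numSymb = 1 := by rcases τ with ⟨a⟩; rfl
@[simp] lemma numSymb_mul (τ σ : Formal d) : (τ * σ).numSymb = τ.numSymb + σ.numSymb := by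
  rcases τ with ⟨a⟩; rcases σ with ⟨b⟩; rfl

@[simp] lemma expo_one : (1 : Formal d).expo = 0 := rfl
@[simp] lemma expo_X (i : Fin (d + 1)) : (X i).expo = Pi.single i 1 := rfl
@[simp] lemma expo_mul (τ σ : Formal d) : (τ * σ).expo = τ.expo + σ.expo := by
  rcases τ with ⟨a⟩; rcases σ with ⟨b⟩; rfl

@[simp] lemma hom_one (α : ℝ) : (1 : Formal d).hom α = 0 := rfl
lemma hom_X (α : ℝ) (i : Fin (d + 1)) : (X i).hom α = wt i := by
  change (if i = 0 then (2 : ℝ) else 1) = _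
  unfold wt; split_ifs <;> simp
@[simp] lemma hom_Xi (α : ℝ) : (Xi : Formal d).hom α = α := rfl
@[simp] lemma hom_I (α : ℝ) (τ : Formal d) : (I τ).hom α = τ.hom α + 2 := by
  rcases τ with ⟨a⟩; rfl
@[simp] lemma hom_D (α : ℝ) (i : Fin d) (τ : Formal d) : (D i τ).hom α = τ.hom α - 1 := by
  rcases τ with ⟨a⟩; rfl
@[simp] lemma hom_mul (α : ℝ) (τ σ : Formal d) : (τ * σ).hom α = τ.hom α + σ.hom α := by
  rcases τ with ⟨a⟩; rcases σ with ⟨b⟩; rfl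

lemma hom_prod (α : ℝ) {ι : Type*} (s : Finset ι) (τ : ι → Formal d) :
    (∏ j ∈ s, τ j).hom α = ∑ j ∈ s, (τ j).hom α := by
  classical
  induction s using Finset.induction_on with
  | empty => simp
  | insert a s ha ih => rw [Finset.prod_insert ha, Finset.sum_insert ha, hom_mul, ih]

/-- Multiplicative induction over Taylor monomials. -/
lemma mpow_induction {P : Formal d → Prop} (h1 : P 1) (hX : ∀ i, P (X i))
    (hmul : ∀ a b, P a → P b → P (a * b)) (k : MI d) : P (mpow X k) := by
  refine Finset.prod_induction _ P hmul h1 fun i _ => ?_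
  induction k i with
  | zero => simpa
  | succ n ih => rw [pow_succ]; exact hmul _ _ ih (hX i)

@[simp] lemma numSymb_mpow (k : MI d) : (mpow X k).numSymb = 0 :=
  mpow_induction (P := fun τ => τ.numSymb = 0) rfl (fun _ => rfl)
    (fun a b ha hb => by rw [numSymb_mul, ha, hb]) k

@[simp] lemma expo_mpow (k : MI d) : (mpow X k).expo = k := by
  have h1 : ∀ (i : Fin (d + 1)) (n : ℕ), (X i ^ n).expo = Pi.single i n := by
    intro i n
    induction n with
    | zero => simp
    | succ n ih => rw [pow_succ, expo_mul, ih, expo_X, ← Pi.single_add]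
  have h2 : ∀ s : Finset (Fin (d + 1)),
      (∏ i ∈ s, X i ^ k i).expo = ∑ i ∈ s, Pi.single i (k i) := by
    intro s
    induction s using Finset.induction_on with
    | empty => simp
    | insert a s ha ih => rw [Finset.prod_insert ha, Finset.sum_insert ha, expo_mul, ih, h1]
  rw [mpow, h2, Finset.univ_sum_single]

lemma mpow_injective : Function.Injective (mpow (X : Fin (d + 1) → Formal d)) := fun k m h => by
  rw [← expo_mpow k, h, expo_mpow]

lemma hom_mpow (α : ℝ) (k : MI d) : (mpow X k).hom α = sdeg k := by
  have h1 : ∀ (i : Fin (d + 1)) (n : ℕ), (X i ^ n).hom α = wt i * n := by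
    intro i n
    induction n with
    | zero => simp
    | succ n ih => rw [pow_succ, hom_mul, ih, hom_X]; push_cast; ring
  rw [mpow, hom_prod, sdeg_eq_sum]
  push_cast
  exact Finset.sum_congr rfl fun i _ => h1 i _

lemma mpow_mem_poly (k : MI d) : mpow X k ∈ poly d := ⟨k, rfl⟩

lemma I_notMem_poly (τ : Formal d) : I τ ∉ poly d := by
  rintro ⟨k, h⟩
  simpa using congr_arg numSymb h

end Formal

/-! ### Linear combinations of formal expressions -/

@[simp] lemma basis_one : basis (1 : Formal d) = 1 := rfl

lemma basis_mul (τ σ : Formal d) : basis (τ * σ) = basis τ * basis σ := by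
  simp [basis, MonoidAlgebra.single_mul_single]

lemma basis_mpow (k : MI d) : basis (mpow Formal.X k) = mpow (fun i => basis (Formal.X i)) k :=
  map_mpow (MonoidAlgebra.of ℝ (Formal d)) _ _

@[simp] lemma linExt_basis {M : Type*} [AddCommGroup M] [Module ℝ M] (g : Formal d → M)
    (τ : Formal d) : linExt g (basis τ) = g τ := by
  simp [linExt, basis]

lemma eq_sum_basis (x : Lin d) : x = ∑ τ ∈ x.coeff.support, x.coeff τ • basis τ := by
  conv_lhs => rw [← MonoidAlgebra.sum_coeff_single x]
  refine Finset.sum_congr rfl fun τ _ => ?_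
  simp [basis]

lemma lin_ext {M : Type*} [AddCommGroup M] [Module ℝ M] {f g : Lin d →ₗ[ℝ] M}
    (h : ∀ τ, f (basis τ) = g (basis τ)) : f = g := by
  refine LinearMap.ext fun x => ?_
  rw [eq_sum_basis x]
  simp [h]

lemma coeff_basis (τ σ : Formal d) [Decidable (τ = σ)] :
    (basis τ).coeff σ = if τ = σ then 1 else 0 := by
  simp [basis, Finsupp.single_apply]

/-- The span of a set of formal expressions. -/
def spanOf (S : Set (Formal d)) : Submodule ℝ (Lin d) := Submodule.span ℝ (basis '' S)

lemma basis_mem_spanOf {S : Set (Formal d)} {τ : Formal d} (h : τ ∈ S) : basis τ ∈ spanOf S :=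
  Submodule.subset_span ⟨τ, h, rfl⟩

lemma spanOf_mono {S S' : Set (Formal d)} (h : S ⊆ S') : spanOf S ≤ spanOf S' :=
  Submodule.span_mono (Set.image_mono h)

lemma mem_spanOf {S : Set (Formal d)} {x : Lin d} :
    x ∈ spanOf S ↔ ∀ τ, x.coeff τ ≠ 0 → τ ∈ S := by
  classical
  constructor
  · intro hx
    induction hx using Submodule.span_induction with
    | mem x hx =>
      obtain ⟨τ, hτ, rfl⟩ := hx
      intro σ hσ
      rw [coeff_basis] at hσ
      by_cases h : τ = σ
      · exact h ▸ hτ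
      · simp [h] at hσ
    | zero => simp
    | add x y _ _ hx hy =>
      intro τ hτ
      by_cases h : x.coeff τ = 0
      · exact hy τ fun h' => hτ (by simp [h, h'])
      · exact hx τ h
    | smul c x _ hx =>
      intro τ hτ
      exact hx τ fun h' => hτ (by simp [h'])
  · intro h
    rw [eq_sum_basis x]
    exact Submodule.sum_mem _ fun τ hτ =>
      Submodule.smul_mem _ _ (basis_mem_spanOf (h τ (Finsupp.mem_support_iff.1 hτ)))

lemma spanOf_le {S : Set (Formal d)} {N : Submodule ℝ (Lin d)} (h : ∀ τ ∈ S, basis τ ∈ N) :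
    spanOf S ≤ N := by
  rw [spanOf, Submodule.span_le]
  rintro _ ⟨τ, hτ, rfl⟩
  exact h τ hτ

/-- Linear maps that agree on formal expressions in `S` agree on the span of `S`. -/
lemma eqOn_spanOf {M : Type*} [AddCommGroup M] [Module ℝ M] {f g : Lin d →ₗ[ℝ] M}
    {S : Set (Formal d)} (h : ∀ τ ∈ S, f (basis τ) = g (basis τ)) {x : Lin d} (hx : x ∈ spanOf S) :
    f x = g x :=
  spanOf_le (N := LinearMap.eqLocus f g) h hx

lemma map_mem_spanOf {M : Type*} [AddCommGroup M] [Module ℝ M] {f : Lin d →ₗ[ℝ] M}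
    {S : Set (Formal d)} {N : Submodule ℝ M} (h : ∀ τ ∈ S, f (basis τ) ∈ N) {x : Lin d}
    (hx : x ∈ spanOf S) : f x ∈ N :=
  spanOf_le (N := N.comap f) h hx

lemma mul_mem_spanOf {S S' R : Set (Formal d)} (h : ∀ τ ∈ S, ∀ σ ∈ S', τ * σ ∈ R) {x y : Lin d}
    (hx : x ∈ spanOf S) (hy : y ∈ spanOf S') : x * y ∈ spanOf R := by
  refine map_mem_spanOf (f := LinearMap.mulRight ℝ y) (fun τ hτ => ?_) hx
  refine map_mem_spanOf (f := LinearMap.mulLeft ℝ (basis τ)) (fun σ hσ => ?_) hy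
  rw [LinearMap.mulLeft_apply, ← basis_mul]
  exact basis_mem_spanOf (h τ hτ σ hσ)

lemma intMap_basis {τ : Formal d} (h : τ ∉ Formal.poly d) :
    intMap d (basis τ) = basis (Formal.I τ) := by
  simp [intMap, h]

lemma intMap_poly {τ : Formal d} (h : τ ∈ Formal.poly d) : intMap d (basis τ) = 0 := by
  simp [intMap, h]

lemma derMap_basis (i : Fin d) {τ : Formal d} (h : τ ∉ Formal.poly d) :
    derMap i (basis τ) = basis (Formal.D i τ) := by
  have h' : ¬ ∃ k : MI d, τ = mpow Formal.X k := fun ⟨k, hk⟩ => h ⟨k, hk.symm⟩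
  simp only [derMap, linExt_basis, dif_neg h']

lemma derMap_mpow (i : Fin d) (k : MI d) : derMap i (basis (mpow Formal.X k)) =
    (k i.succ : ℝ) • basis (mpow Formal.X (k - Pi.single i.succ 1)) := by
  have h : ∃ m : MI d, mpow (Formal.X : _ → Formal d) k = mpow Formal.X m := ⟨k, rfl⟩
  simp only [derMap, linExt_basis, dif_pos h]
  rw [← Formal.mpow_injective h.choose_spec]

/-! ### The operators `Γ̂_f` -/

section Gamma

variable {α : ℝ} {e : Equation}

/-- `id ⊗ f` as a morphism of algebras. -/
def idTensor (f : TPlus d α e →ₐ[ℝ] ℝ) : Lin d ⊗[ℝ] TPlus d α e →ₐ[ℝ] Lin d :=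
  Algebra.TensorProduct.lift (AlgHom.id ℝ (Lin d)) ((Algebra.ofId ℝ (Lin d)).comp f)
    fun _ _ => Commute.all _ _

@[simp] lemma idTensor_tmul (f : TPlus d α e →ₐ[ℝ] ℝ) (x : Lin d) (t : TPlus d α e) :
    idTensor f (x ⊗ₜ t) = f t • x := by
  simp only [idTensor, Algebra.TensorProduct.lift_tmul, AlgHom.comp_apply]
  rw [Algebra.smul_def, mul_comm]
  rfl

lemma idTensor_eq (f : TPlus d α e →ₐ[ℝ] ℝ) (u : Lin d ⊗[ℝ] TPlus d α e) :
    TensorProduct.rid ℝ (Lin d) (TensorProduct.map LinearMap.id f.toLinearMap u) =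
      idTensor f u := by
  induction u using TensorProduct.induction_on with
  | zero => simp
  | tmul x t => simp
  | add x y hx hy => simp only [map_add, hx, hy]

lemma idTensor_map (f : TPlus d α e →ₐ[ℝ] ℝ) (L : Lin d →ₗ[ℝ] Lin d)
    (u : Lin d ⊗[ℝ] TPlus d α e) :
    idTensor f (TensorProduct.map L LinearMap.id u) = L (idTensor f u) := by
  induction u using TensorProduct.induction_on with
  | zero => simp
  | tmul x t => simp
  | add x y hx hy => simp only [map_add, hx, hy]

lemma gammaHat_basis' (f : TPlus d α e →ₐ[ℝ] ℝ) (τ : Formal d) :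
    gammaHat f (basis τ) = idTensor f (delta α e τ) := by
  simp only [gammaHat, LinearMap.comp_apply, linExt_basis]
  exact idTensor_eq f _

lemma delta_one : delta α e (1 : Formal d) = 1 := rfl

lemma delta_mul (τ σ : Formal d) : delta α e (τ * σ) = delta α e τ * delta α e σ := by
  rcases τ with ⟨a⟩; rcases σ with ⟨b⟩; rfl

@[simp] lemma gammaHat_one (f : TPlus d α e →ₐ[ℝ] ℝ) : gammaHat f 1 = 1 := by
  rw [← basis_one, gammaHat_basis', delta_one, map_one, basis_one]

lemma gammaHat_mul (f : TPlus d α e →ₐ[ℝ] ℝ) (x y : Lin d) :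
    gammaHat f (x * y) = gammaHat f x * gammaHat f y := by
  have h : (LinearMap.mul ℝ (Lin d)).compr₂ (gammaHat f) =
      (LinearMap.mul ℝ (Lin d)).compl₁₂ (gammaHat f) (gammaHat f) := by
    refine lin_ext fun τ => lin_ext fun σ => ?_
    simp only [LinearMap.compr₂_apply, LinearMap.compl₁₂_apply, LinearMap.mul_apply']
    rw [← basis_mul, gammaHat_basis', gammaHat_basis', gammaHat_basis', delta_mul, map_mul]
  exact congr($h x y)

/-- `Γ̂_f` as a morphism of algebras. -/
def gammaAlg (f : TPlus d α e →ₐ[ℝ] ℝ) : Lin d →ₐ[ℝ] Lin d :=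
  AlgHom.ofLinearMap (gammaHat f) (gammaHat_one f) (gammaHat_mul f)

lemma gammaAlg_apply (f : TPlus d α e →ₐ[ℝ] ℝ) (x : Lin d) : gammaAlg f x = gammaHat f x := rfl

@[simp] lemma gammaHat_Xi (f : TPlus d α e →ₐ[ℝ] ℝ) :
    gammaHat f (basis Formal.Xi) = basis Formal.Xi := by
  rw [gammaHat_basis']
  change idTensor f (basis Formal.Xi ⊗ₜ 1) = _
  simp

lemma gammaHat_X (f : TPlus d α e →ₐ[ℝ] ℝ) (i : Fin (d + 1)) :
    gammaHat f (basis (Formal.X i)) =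
      basis (Formal.X i) + algebraMap ℝ (Lin d) (-f (Zv α e i)) := by
  rw [gammaHat_basis']
  change idTensor f (basis (Formal.X i) ⊗ₜ 1 - 1 ⊗ₜ Zv α e i) = _
  simp [Algebra.algebraMap_eq_smul_one, sub_eq_add_neg]

lemma gammaHat_D (f : TPlus d α e →ₐ[ℝ] ℝ) (i : Fin d) (τ : Formal d) :
    gammaHat f (basis (Formal.D i τ)) = derMap i (gammaHat f (basis τ)) := by
  rw [gammaHat_basis', gammaHat_basis', ← idTensor_map]
  rcases τ with ⟨a⟩
  rfl

/-- The polynomials `(X - f(Z))^k / k!`. -/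
def shiftPow (c : Fin (d + 1) → ℝ) (k : MI d) : Lin d :=
  dpow (fun i => basis (Formal.X i) + algebraMap ℝ (Lin d) (c i)) k

lemma idTensor_mpow (f : TPlus d α e →ₐ[ℝ] ℝ) (u : Fin (d + 1) → Lin d ⊗[ℝ] TPlus d α e)
    (k : MI d) (t : TPlus d α e) :
    idTensor f ((mfact k : ℝ)⁻¹ • (mpow u k * (1 ⊗ₜ t))) =
      f t • dpow (fun i => idTensor f (u i)) k := by
  rw [map_smul, map_mul, map_mpow, idTensor_tmul, mul_smul_comm, mul_one, smul_comm]
  rfl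

lemma gammaHat_I (f : TPlus d α e →ₐ[ℝ] ℝ) (τ : Formal d) :
    gammaHat f (basis (Formal.I τ)) = intMap d (gammaHat f (basis τ)) -
      ∑ k ∈ below d (τ.hom α + 2), f (Jv α e k τ) • shiftPow (fun i => -f (Zv α e i)) k := by
  rw [gammaHat_basis', gammaHat_basis', ← idTensor_map]
  rcases τ with ⟨a⟩
  change idTensor f (TensorProduct.map (intMap d) LinearMap.id (a.delta α e) -
      ∑ k ∈ below d (a.hom α + 2), (mfact k : ℝ)⁻¹ •
        (mpow (fun i => basis (Formal.X i) ⊗ₜ[ℝ] (1 : TPlus d α e) - 1 ⊗ₜ Zv α e i) k *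
          (1 ⊗ₜ Jv α e k (Formal.mk a)))) = _
  rw [map_sub, map_sum]
  congr 1
  refine Finset.sum_congr rfl fun k _ => ?_
  rw [idTensor_mpow]
  congr 2
  funext i
  simp [Algebra.algebraMap_eq_smul_one, sub_eq_add_neg]

lemma gammaHat_shiftPow (f : TPlus d α e →ₐ[ℝ] ℝ) (c : Fin (d + 1) → ℝ) (k : MI d) :
    gammaHat f (shiftPow c k) = shiftPow (fun i => c i - f (Zv α e i)) k := by
  rw [← gammaAlg_apply, shiftPow, map_dpow]
  simp only [map_add, AlgHom.commutes, gammaAlg_apply, gammaHat_X]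
  rw [shiftPow]
  congr 1
  funext i
  simp only [add_assoc, ← map_add]
  congr 2
  ring

lemma gammaHat_mpow (f : TPlus d α e →ₐ[ℝ] ℝ) (k : MI d) :
    gammaHat f (basis (mpow Formal.X k)) =
      (mfact k : ℝ) • shiftPow (fun i => -f (Zv α e i)) k := by
  rw [basis_mpow, ← gammaAlg_apply, map_mpow]
  simp only [gammaAlg_apply, gammaHat_X]
  rw [shiftPow, dpow, smul_smul, mul_inv_cancel₀ (mfact_ne_zero k), one_smul]

lemma shiftPow_zero (k : MI d) :
    shiftPow 0 k = (mfact k : ℝ)⁻¹ • basis (mpow Formal.X k) := by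
  rw [basis_mpow, shiftPow, dpow]
  simp

/-- `(X + c)^k` differs from `X^k` by lower order monomials. -/
lemma shiftPow_eq (c : Fin (d + 1) → ℝ) (k : MI d) :
    shiftPow c k = ∑ j ∈ Fintype.piFinset fun i => Finset.range (k i + 1),
      (dpow c (k - j) * (mfact j : ℝ)⁻¹) • basis (mpow Formal.X j) := by
  rw [shiftPow, show (fun i => basis (Formal.X i) + algebraMap ℝ (Lin d) (c i)) =
    (fun i => basis (Formal.X i)) + fun i => algebraMap ℝ (Lin d) (c i) from rfl, dpow_add]
  refine Finset.sum_congr rfl fun j _ => ?_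
  have h2 : dpow (fun i => algebraMap ℝ (Lin d) (c i)) (k - j) =
      algebraMap ℝ (Lin d) (dpow c (k - j)) := (map_dpow (Algebra.ofId ℝ (Lin d)) c (k - j)).symm
  rw [h2, basis_mpow, mul_comm, ← Algebra.smul_def, mul_smul]
  rfl

lemma shiftPow_sub_mem (c : Fin (d + 1) → ℝ) (k : MI d) :
    shiftPow c k - (mfact k : ℝ)⁻¹ • basis (mpow Formal.X k) ∈
      spanOf (mpow Formal.X '' {j : MI d | sdeg j < sdeg k}) := by
  classical
  have hk : k ∈ Fintype.piFinset fun i => Finset.range (k i + 1) := by simp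
  rw [shiftPow_eq, ← Finset.add_sum_erase _ _ hk]
  simp only [tsub_self, dpow_zero, one_mul, add_sub_cancel_left]
  refine Submodule.sum_mem _ fun j hj => Submodule.smul_mem _ _ (basis_mem_spanOf ⟨j, ?_, rfl⟩)
  simp only [Finset.mem_erase, Fintype.mem_piFinset, Finset.mem_range, Nat.lt_succ_iff] at hj
  obtain ⟨h1, h2⟩ := hj
  have h3 : k - j ≠ 0 := fun h => h1 (le_antisymm h2 (tsub_eq_zero_iff_le.1 h))
  obtain ⟨i, hi⟩ := Function.ne_iff.1 h3
  have h4 : sdeg k = sdeg j + sdeg (k - j) := by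
    rw [← sdeg_add, add_tsub_cancel_of_le (show j ≤ k from h2)]
  have h5 := le_sdeg (k - j) i
  have h6 : (k - j) i ≠ 0 := hi
  change sdeg j < sdeg k
  omega

lemma shiftPow_mem (c : Fin (d + 1) → ℝ) (k : MI d) :
    shiftPow c k ∈ spanOf (mpow Formal.X '' {j : MI d | sdeg j ≤ sdeg k}) := by
  have h := Submodule.add_mem _
    (spanOf_mono (Set.image_mono fun j (hj : sdeg j < sdeg k) => hj.le) (shiftPow_sub_mem c k))
    (Submodule.smul_mem _ (mfact k : ℝ)⁻¹ (basis_mem_spanOf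
      (⟨k, le_refl (sdeg k), rfl⟩ : mpow Formal.X k ∈ mpow Formal.X '' {j | sdeg j ≤ sdeg k})))
  rwa [sub_add_cancel] at h

lemma gammaHat_mpow_mem (f : TPlus d α e →ₐ[ℝ] ℝ) (k : MI d) :
    gammaHat f (basis (mpow Formal.X k)) ∈
      spanOf (mpow Formal.X '' {j : MI d | sdeg j ≤ sdeg k}) := by
  rw [gammaHat_mpow]
  exact Submodule.smul_mem _ _ (shiftPow_mem _ _)

end Gamma

/-! ### Subcriticality -/

section Subcritical

variable {α : ℝ} {e : Equation}

lemma IsDeriv.cases {i : Fin d} {τ σ : Formal d} (h : IsDeriv i τ σ) :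
    (τ ∈ Formal.poly d ∧ σ ∈ Formal.poly d ∧ σ.hom α = τ.hom α - 1) ∨
      ∃ τ', τ = Formal.I τ' ∧ σ = Formal.D i (Formal.I τ') := by
  cases h with
  | poly k =>
    refine Or.inl ⟨⟨_, rfl⟩, ⟨_, rfl⟩, ?_⟩
    rw [Formal.hom_mpow, Formal.hom_mpow, sdeg_add, sdeg_single, wt_succ]
    push_cast; ring
  | int τ' => exact Or.inr ⟨τ', rfl, rfl⟩

lemma IsDeriv.hom_eq {i : Fin d} {τ σ : Formal d} (h : IsDeriv i τ σ) :
    σ.hom α = τ.hom α - 1 := by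
  rcases h.cases (α := α) with h | ⟨τ', rfl, rfl⟩
  · exact h.2.2
  · simp

lemma hom_nonneg_of_poly {τ : Formal d} (h : τ ∈ Formal.poly d) : 0 ≤ τ.hom α := by
  obtain ⟨k, rfl⟩ := h
  rw [Formal.hom_mpow]
  positivity

-- Elements of 𝒰 other than Taylor monomials gain 2 from I. For `phi4`, three of them have at least
-- 3(α + 2) > α because α > -3; for `kpz`, two derivatives have at least 2(α + 1) > α because α >
-- -2; for `mult`, all of 𝒰 is nonnegative. Products with some Taylor monomials are checked
-- likewise.
mutual

theorem InU.lower (hα : α < 0) : ∀ {e : Equation} (_ : e.threshold < α) {τ : Formal d}, InU e τ →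
      τ ∈ Formal.poly d ∨ α + 2 ≤ τ.hom α
  | _, hcrit, _, .poly _ k => Or.inl ⟨k, rfl⟩
  | _, hcrit, _, .int _ τ h _ => Or.inr (by
      have := InV.lower hα hcrit h
      simp only [Formal.hom_I]; linarith)

theorem InV.lower (hα : α < 0) : ∀ {e : Equation} (_ : e.threshold < α) {τ : Formal d}, InV e τ →
      α ≤ τ.hom α
  | _, hcrit, _, .poly _ k => hα.le.trans (hom_nonneg_of_poly ⟨k, rfl⟩)
  | _, hcrit, _, .phi4_noise => le_rfl
  | _, hcrit, _, .phi4_prod τ₁ τ₂ τ₃ h₁ h₂ h₃ => by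
      have hc : (-3 : ℝ) < α := hcrit
      have key : ∀ τ : Formal d, (τ ∈ Formal.poly d ∨ α + 2 ≤ τ.hom α) →
          0 ≤ τ.hom α ∨ α + 2 ≤ τ.hom α := fun τ h => h.imp_left hom_nonneg_of_poly
      simp only [Formal.hom_mul]
      rcases key _ (InU.lower hα hcrit h₁) with h | h <;>
        rcases key _ (InU.lower hα hcrit h₂) with h' | h' <;>
        rcases key _ (InU.lower hα hcrit h₃) with h'' | h'' <;> linarith
  | _, hcrit, _, .kpz_noise => le_rfl
  | _, hcrit, _, .kpz_prod i τ₁ τ₂ σ₁ σ₂ h₁ h₂ d₁ d₂ => by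
      have hc : (-2 : ℝ) < α := hcrit
      have key : ∀ τ σ : Formal d, (τ ∈ Formal.poly d ∨ α + 2 ≤ τ.hom α) → IsDeriv i τ σ →
          0 ≤ σ.hom α ∨ α + 1 ≤ σ.hom α := by
        intro τ σ h hd
        rcases hd.cases (α := α) with h' | ⟨τ', rfl, rfl⟩
        · exact Or.inl (hom_nonneg_of_poly h'.2.1)
        · rcases h with h | h
          · exact absurd h (Formal.I_notMem_poly _)
          · right; rw [Formal.hom_D]; linarith
      simp only [Formal.hom_mul]
      rcases key _ _ (InU.lower hα hcrit h₁) d₁ with h | h <;>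
        rcases key _ _ (InU.lower hα hcrit h₂) d₂ with h' | h' <;> linarith
  | _, hcrit, _, .mult_noise m τ _ h => by
      have hc : (-2 : ℝ) < α := hcrit
      rw [Formal.hom_mul, Formal.hom_prod, Formal.hom_Xi, le_add_iff_nonneg_right]
      refine Finset.sum_nonneg fun j _ => ?_
      rcases InU.lower hα hcrit (h j) with h | h
      · exact hom_nonneg_of_poly h
      · linarith
  | _, hcrit, _, .mult_prod m τ _ h => by
      have hc : (-2 : ℝ) < α := hcrit
      rw [Formal.hom_prod]
      refine hα.le.trans (Finset.sum_nonneg fun j _ => ?_)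
      rcases InU.lower hα hcrit (h j) with h | h
      · exact hom_nonneg_of_poly h
      · linarith

end

lemma InU.lower' (hα : α < 0) (hcrit : e.threshold < α) {τ : Formal d} (h : InU e τ) :
    min 0 (α + 2) ≤ τ.hom α := by
  rcases h.lower hα hcrit with h | h
  · exact (min_le_left _ _).trans (hom_nonneg_of_poly h)
  · exact (min_le_right _ _).trans h

lemma InU.lower_deriv (hα : α < 0) (hcrit : e.threshold < α) {i : Fin d} {τ σ : Formal d}
    (h : InU e τ) (hd : IsDeriv i τ σ) : min 0 (α + 1) ≤ σ.hom α := by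
  rcases hd.cases (α := α) with h' | ⟨τ', rfl, rfl⟩
  · exact (min_le_left _ _).trans (hom_nonneg_of_poly h'.2.1)
  · rcases h.lower hα hcrit with h | h
    · exact absurd h (Formal.I_notMem_poly _)
    · refine (min_le_right _ _).trans ?_
      rw [Formal.hom_D]; linarith

lemma InU.nonneg (hα : α < 0) (hcrit : e.threshold < α) (hα2 : -2 < α) {τ : Formal d}
    (h : InU e τ) : 0 ≤ τ.hom α := by
  have := h.lower' hα hcrit
  rwa [min_eq_left (by linarith)] at this

-- In a product of homogeneity less than c, what surrounds a given factor contributes more than -2: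
-- for `phi4` two factors above -1 each, for `mult` nonnegative factors and possibly α > -2, for
-- `kpz` another derivative above -1 together with the -1 of the factor's own 𝒟_i. So each factor
-- from 𝒰 is below c + 2, and if it is I(τ) then |τ| < c. The 𝒰-part also carries P for derivatives,
-- because `kpz` products are made of these.
mutual

theorem InU.trunc_induction (hα : α < 0) (c : ℝ) {P : Formal d → Prop}
    (h1 : P 1) (hX : ∀ i, P (Formal.X i)) (hXi : P Formal.Xi)
    (hmul : ∀ a b, P a → P b → P (a * b)) :
    ∀ {e : Equation} (_ : e.threshold < α)
      (_ : ∀ τ, InV e τ → τ ∉ Formal.poly d → τ.hom α < c → P τ → P (Formal.I τ))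
      (_ : ∀ i τ, InV e τ → τ ∉ Formal.poly d → τ.hom α < c → P τ → P (Formal.I τ) →
        P (Formal.D i (Formal.I τ))) {τ : Formal d}, InU e τ → τ.hom α < c + 2 →
          P τ ∧ ∀ i σ, IsDeriv i τ σ → P σ
  | _, hcrit, hI, hD, _, .poly _ k, _ => ⟨Formal.mpow_induction h1 hX hmul k, fun i σ hd => by
      rcases hd.cases (α := α) with ⟨_, ⟨m, rfl⟩, _⟩ | ⟨τ', h, _⟩
      · exact Formal.mpow_induction h1 hX hmul m
      · exact absurd (h ▸ Formal.mpow_mem_poly k) (Formal.I_notMem_poly _)⟩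
  | _, hcrit, hI, hD, _, .int _ τ h hp, hc => by
      have hc' : τ.hom α < c := by rw [Formal.hom_I] at hc; linarith
      have h2 := InV.trunc_induction hα c h1 hX hXi hmul hcrit hI hD h hc'
      have h3 := hI τ h hp hc' h2
      refine ⟨h3, fun i σ hd => ?_⟩
      generalize hτ : Formal.I τ = ρ at hd
      rcases hd.cases (α := α) with h' | ⟨τ', h', rfl⟩
      · exact absurd (hτ ▸ h'.1) (Formal.I_notMem_poly _)
      · rw [← h', ← hτ]
        exact hD i τ h hp hc' h2 h3

theorem InV.trunc_induction (hα : α < 0) (c : ℝ) {P : Formal d → Prop}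
    (h1 : P 1) (hX : ∀ i, P (Formal.X i)) (hXi : P Formal.Xi)
    (hmul : ∀ a b, P a → P b → P (a * b)) :
    ∀ {e : Equation} (_ : e.threshold < α)
      (_ : ∀ τ, InV e τ → τ ∉ Formal.poly d → τ.hom α < c → P τ → P (Formal.I τ))
      (_ : ∀ i τ, InV e τ → τ ∉ Formal.poly d → τ.hom α < c → P τ → P (Formal.I τ) →
        P (Formal.D i (Formal.I τ))) {τ : Formal d}, InV e τ → τ.hom α < c → P τ
  | _, hcrit, hI, hD, _, .poly _ k, _ => Formal.mpow_induction h1 hX hmul k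
  | _, hcrit, hI, hD, _, .phi4_noise, _ => hXi
  | _, hcrit, hI, hD, _, .phi4_prod τ₁ τ₂ τ₃ h₁ h₂ h₃, hc => by
      have hc3 : (-3 : ℝ) < α := hcrit
      have l₁ := h₁.lower' hα hcrit
      have l₂ := h₂.lower' hα hcrit
      have l₃ := h₃.lower' hα hcrit
      have hm : -1 < min 0 (α + 2) := lt_min (by norm_num) (by linarith)
      simp only [Formal.hom_mul] at hc
      exact hmul _ _ (hmul _ _
        (InU.trunc_induction hα c h1 hX hXi hmul hcrit hI hD h₁ (by linarith)).1
        (InU.trunc_induction hα c h1 hX hXi hmul hcrit hI hD h₂ (by linarith)).1)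
        (InU.trunc_induction hα c h1 hX hXi hmul hcrit hI hD h₃ (by linarith)).1
  | _, hcrit, hI, hD, _, .kpz_noise, _ => hXi
  | _, hcrit, hI, hD, _, .kpz_prod i τ₁ τ₂ σ₁ σ₂ h₁ h₂ d₁ d₂, hc => by
      have hc3 : (-2 : ℝ) < α := hcrit
      have l₁ := h₁.lower_deriv hα hcrit d₁
      have l₂ := h₂.lower_deriv hα hcrit d₂
      have e₁ := d₁.hom_eq (α := α)
      have e₂ := d₂.hom_eq (α := α)
      have hm : -1 < min 0 (α + 1) := lt_min (by norm_num) (by linarith)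
      simp only [Formal.hom_mul] at hc
      exact hmul _ _
        ((InU.trunc_induction hα c h1 hX hXi hmul hcrit hI hD h₁ (by linarith)).2 i _ d₁)
        ((InU.trunc_induction hα c h1 hX hXi hmul hcrit hI hD h₂ (by linarith)).2 i _ d₂)
  | _, hcrit, hI, hD, _, .mult_noise m τ _ h, hc => by
      have hc3 : (-2 : ℝ) < α := hcrit
      rw [Formal.hom_mul, Formal.hom_prod, Formal.hom_Xi] at hc
      refine hmul _ _ hXi (Finset.prod_induction _ P hmul h1 fun j _ => ?_)
      have := Finset.single_le_sum (f := fun j => (τ j).hom α)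
        (fun j _ => (h j).nonneg hα hcrit hc3) (Finset.mem_univ j)
      exact (InU.trunc_induction hα c h1 hX hXi hmul hcrit hI hD (h j) (by linarith)).1
  | _, hcrit, hI, hD, _, .mult_prod m τ _ h, hc => by
      have hc3 : (-2 : ℝ) < α := hcrit
      rw [Formal.hom_prod] at hc
      refine Finset.prod_induction _ P hmul h1 fun j _ => ?_
      have := Finset.single_le_sum (f := fun j => (τ j).hom α)
        (fun j _ => (h j).nonneg hα hcrit hc3) (Finset.mem_univ j)
      exact (InU.trunc_induction hα c h1 hX hXi hmul hcrit hI hD (h j) (by linarith)).1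

end

/-- Induction over the elements of `𝒰 ∪ 𝒱` of homogeneity less than `c`. By subcriticality, the
arguments of all integration operators occurring in them have homogeneity less than `c`. -/
theorem UV_induction (hα : α < 0) (hcrit : e.threshold < α) (c : ℝ) {P : Formal d → Prop}
    (h1 : P 1) (hX : ∀ i, P (Formal.X i)) (hXi : P Formal.Xi)
    (hmul : ∀ a b, P a → P b → P (a * b))
    (hI : ∀ τ, InV e τ → τ ∉ Formal.poly d → τ.hom α < c → P τ → P (Formal.I τ))
    (hD : ∀ i τ, InV e τ → τ ∉ Formal.poly d → τ.hom α < c → P τ → P (Formal.I τ) →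
      P (Formal.D i (Formal.I τ)))
    {τ : Formal d} (h : τ ∈ UV d e) (hc : τ.hom α < c) : P τ := by
  rcases h with h | h
  · exact (h.trunc_induction hα c h1 hX hXi hmul hcrit hI hD (by linarith)).1
  · exact h.trunc_induction hα c h1 hX hXi hmul hcrit hI hD hc

/-! ### Finiteness -/

lemma finite_poly (c : ℝ) :
    (mpow (Formal.X : _ → Formal d) '' {k : MI d | (sdeg k : ℝ) < c}).Finite := by
  refine Set.Finite.image _ ((below d c).finite_toSet.subset fun k hk => ?_)
  exact mem_below.2 hk

lemma finite_InU {c : ℝ} (h : {τ : Formal d | InV e τ ∧ τ.hom α < c}.Finite) :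
    {τ : Formal d | InU e τ ∧ τ.hom α < c + 2}.Finite := by
  refine ((finite_poly (d := d) (c + 2)).union (h.image Formal.I)).subset ?_
  rintro τ ⟨hτ, hc⟩
  cases hτ with
  | poly _ k => exact Or.inl ⟨k, by rw [Formal.hom_mpow] at hc; exact hc, rfl⟩
  | int _ σ hσ _ => exact Or.inr ⟨σ, ⟨hσ, by rw [Formal.hom_I] at hc; linarith⟩, rfl⟩

/-- A factor other than 1 has homogeneity at least δ, so it occurs at most c / δ times, and a
product is determined by its multiplicities. -/
lemma finite_prods {S : Set (Formal d)} (hS : S.Finite) {δ : ℝ} (hδ : 0 < δ)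
    (h0 : ∀ τ ∈ S, τ = 1 ∨ δ ≤ τ.hom α) (c : ℝ) :
    {σ : Formal d | ∃ (m : ℕ) (τ : Fin m → Formal d), (∀ j, τ j ∈ S) ∧ σ = ∏ j, τ j ∧
      σ.hom α < c}.Finite := by
  classical
  have hnn : ∀ τ ∈ S, 0 ≤ τ.hom α := fun τ hτ => by
    rcases h0 τ hτ with rfl | h
    · simp
    · linarith
  set F := hS.toFinset
  set N := ⌈c / δ⌉₊
  refine ((Fintype.piFinset fun _ : F => Finset.range (N + 1)).finite_toSet.image
    (fun n => ∏ u : F, (u : Formal d) ^ n u)).subset ?_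
  rintro σ ⟨m, τ, hτ, rfl, hc⟩
  -- The multiplicity of 1 is not controlled by the homogeneity and does not affect the product, so
  -- it is set to 0.
  set n : F → ℕ := fun u => if (u : Formal d) = 1 then 0 else
    (Finset.univ.filter fun j => τ j = u).card
  refine ⟨n, ?_, ?_⟩
  · simp only [Finset.mem_coe, Fintype.mem_piFinset, Finset.mem_range, Nat.lt_succ_iff]
    intro u
    simp only [n]
    split_ifs with hu
    · exact Nat.zero_le _
    · have hu' : δ ≤ (u : Formal d).hom α :=
        (h0 u (hS.mem_toFinset.1 u.2)).resolve_left hu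
      rw [Formal.hom_prod] at hc
      have h1 : ((Finset.univ.filter fun j => τ j = u).card : ℝ) * δ ≤ ∑ j, (τ j).hom α := by
        rw [← nsmul_eq_mul]
        refine (Finset.card_nsmul_le_sum _ _ _ fun j hj => ?_).trans
          (Finset.sum_le_sum_of_subset_of_nonneg (Finset.filter_subset (fun j => τ j = u) _)
            fun j _ _ => hnn _ (hτ j))
        rw [(Finset.mem_filter.1 hj).2]
        exact hu'
      have h2 : ((Finset.univ.filter fun j => τ j = u).card : ℝ) ≤ c / δ := by
        rw [le_div_iff₀ hδ]; linarith
      exact_mod_cast h2.trans (Nat.le_ceil _)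
  · change ∏ u : F, (u : Formal d) ^ n u = ∏ j, τ j
    have h1 : ∏ j, τ j = ∏ u ∈ F, u ^ (Finset.univ.filter fun j => τ j = u).card := by
      rw [← Finset.prod_fiberwise_of_maps_to (t := F) (g := τ)
        (fun j _ => hS.mem_toFinset.2 (hτ j))]
      refine Finset.prod_congr rfl fun u _ => ?_
      rw [Finset.prod_congr rfl (fun j hj => (Finset.mem_filter.1 hj).2), Finset.prod_const]
    rw [h1, ← Finset.prod_coe_sort F]
    refine Finset.prod_congr rfl fun u _ => ?_
    simp only [n]
    split_ifs with hu
    · simp [hu]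
    · rfl

/-- δ is chosen so that a product of homogeneity less than c + δ has only factors from 𝒰 below c + 2
(for `kpz`, derivatives below c + 1). Apart from finitely many Taylor monomials, these come through
I from elements of 𝒱 below c. Subcriticality makes δ positive. -/
lemma exists_finite_step (hα : α < 0) (hcrit : e.threshold < α) : ∃ δ > 0, ∀ c : ℝ,
    {τ : Formal d | InV e τ ∧ τ.hom α < c}.Finite →
      {τ : Formal d | InV e τ ∧ τ.hom α < c + δ}.Finite := by
  cases e with
  | phi4 =>
    have hc3 : (-3 : ℝ) < α := hcrit
    have hm : -1 < min 0 (α + 2) := lt_min (by norm_num) (by linarith)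
    refine ⟨2 + 2 * min 0 (α + 2), by linarith, fun c hc => ?_⟩
    have hU := finite_InU hc
    refine ((finite_poly (d := d) (c + (2 + 2 * min 0 (α + 2)))).union
      ((Set.finite_singleton Formal.Xi).union ((hU.mul hU).mul hU))).subset ?_
    rintro τ ⟨hτ, hc⟩
    cases hτ with
    | poly _ k => exact Or.inl ⟨k, by rw [Formal.hom_mpow] at hc; exact hc, rfl⟩
    | phi4_noise => exact Or.inr (Or.inl rfl)
    | phi4_prod τ₁ τ₂ τ₃ h₁ h₂ h₃ =>
      have l₁ := h₁.lower' hα hcrit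
      have l₂ := h₂.lower' hα hcrit
      have l₃ := h₃.lower' hα hcrit
      simp only [Formal.hom_mul] at hc
      exact Or.inr (Or.inr (Set.mul_mem_mul (Set.mul_mem_mul ⟨h₁, by linarith⟩ ⟨h₂, by linarith⟩)
        ⟨h₃, by linarith⟩))
  | kpz =>
    have hc3 : (-2 : ℝ) < α := hcrit
    have hm : -1 < min 0 (α + 1) := lt_min (by norm_num) (by linarith)
    refine ⟨1 + min 0 (α + 1), by linarith, fun c hc => ?_⟩
    set W : Set (Formal d) := mpow Formal.X '' {k : MI d | (sdeg k : ℝ) < c + 1} ∪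
      ⋃ i, (fun τ => Formal.D i (Formal.I τ)) '' {τ : Formal d | InV .kpz τ ∧ τ.hom α < c}
    have hW : W.Finite := (finite_poly _).union (Set.finite_iUnion fun i => hc.image _)
    have key : ∀ (i : Fin d) (τ σ : Formal d), InU .kpz τ → IsDeriv i τ σ → σ.hom α < c + 1 →
        σ ∈ W := by
      intro i τ σ hτ hd hσ
      rcases hd.cases (α := α) with ⟨_, ⟨m, rfl⟩, _⟩ | ⟨τ', rfl, rfl⟩
      · exact Or.inl ⟨m, by rw [Formal.hom_mpow] at hσ; exact hσ, rfl⟩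
      · refine Or.inr (Set.mem_iUnion.2 ⟨i, ?_⟩)
        generalize hρ : Formal.I τ' = ρ at hτ hσ ⊢
        cases hτ with
        | poly _ k => exact absurd (hρ ▸ Formal.mpow_mem_poly k) (Formal.I_notMem_poly _)
        | int _ τ'' h'' _ =>
          refine ⟨τ'', ⟨h'', ?_⟩, rfl⟩
          rw [Formal.hom_D, Formal.hom_I] at hσ
          linarith
    refine ((finite_poly (d := d) (c + (1 + min 0 (α + 1)))).union
      ((Set.finite_singleton Formal.Xi).union (hW.mul hW))).subset ?_
    rintro τ ⟨hτ, hc⟩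
    cases hτ with
    | poly _ k => exact Or.inl ⟨k, by rw [Formal.hom_mpow] at hc; exact hc, rfl⟩
    | kpz_noise => exact Or.inr (Or.inl rfl)
    | kpz_prod i τ₁ τ₂ σ₁ σ₂ h₁ h₂ d₁ d₂ =>
      have l₁ := h₁.lower_deriv hα hcrit d₁
      have l₂ := h₂.lower_deriv hα hcrit d₂
      simp only [Formal.hom_mul] at hc
      exact Or.inr (Or.inr (Set.mul_mem_mul (key i _ _ h₁ d₁ (by linarith))
        (key i _ _ h₂ d₂ (by linarith))))
  | mult =>
    have hc3 : (-2 : ℝ) < α := hcrit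
    refine ⟨2 + α, by linarith, fun c hc => ?_⟩
    have hU := finite_InU hc
    have hδ : 0 < min 1 (α + 2) := lt_min one_pos (by linarith)
    have hprod := finite_prods (α := α) hU hδ (fun τ hτ => by
      rcases hτ with ⟨hτ, _⟩
      rcases hτ.lower hα hcrit with ⟨k, rfl⟩ | h
      · by_cases hk : k = 0
        · left; simp [hk]
        · right
          refine (min_le_left _ _).trans ?_
          rw [Formal.hom_mpow]
          obtain ⟨i, hi⟩ := Function.ne_iff.1 hk
          have := le_sdeg k i
          have hi' : k i ≠ 0 := hi
          have : 1 ≤ sdeg k := by omega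
          exact_mod_cast this
      · exact Or.inr ((min_le_right _ _).trans h)) (c + 2)
    refine ((finite_poly (d := d) (c + (2 + α))).union (hprod.union
      (hprod.image (Formal.Xi * ·)))).subset ?_
    rintro τ ⟨hτ, hc⟩
    cases hτ with
    | poly _ k => exact Or.inl ⟨k, by rw [Formal.hom_mpow] at hc; exact hc, rfl⟩
    | mult_noise m τ _ h =>
      rw [Formal.hom_mul, Formal.hom_Xi] at hc
      refine Or.inr (Or.inr ⟨_, ⟨m, τ, fun j => ⟨h j, ?_⟩, rfl, by linarith⟩, rfl⟩)
      rw [Formal.hom_prod] at hc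
      have := Finset.single_le_sum (f := fun j => (τ j).hom α)
        (fun j _ => (h j).nonneg hα hcrit hc3) (Finset.mem_univ j)
      linarith
    | mult_prod m τ _ h =>
      refine Or.inr (Or.inl ⟨m, τ, fun j => ⟨h j, ?_⟩, rfl, by linarith⟩)
      rw [Formal.hom_prod] at hc
      have := Finset.single_le_sum (f := fun j => (τ j).hom α)
        (fun j _ => (h j).nonneg hα hcrit hc3) (Finset.mem_univ j)
      linarith

/-- 𝒱 is empty below α, and each step of size δ preserves finiteness; finitely many steps pass c. -/
theorem finite_basisSet (hα : α < 0) (hcrit : e.threshold < α) (c : ℝ) :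
    (basisSet d α e c).Finite := by
  obtain ⟨δ, hδ, hstep⟩ := exists_finite_step (d := d) hα hcrit
  have h1 : ∀ n : ℕ, {τ : Formal d | InV e τ ∧ τ.hom α < α + n * δ}.Finite := by
    intro n
    induction n with
    | zero =>
      refine Set.Finite.subset Set.finite_empty ?_
      rintro τ ⟨hτ, h⟩
      have := hτ.lower hα hcrit
      simp only [Nat.cast_zero, zero_mul, add_zero] at h
      linarith
    | succ n ih =>
      have := hstep _ ih
      convert this using 5
      push_cast; ring
  obtain ⟨n, hn⟩ := exists_nat_gt ((c - α) / δ)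
  rw [div_lt_iff₀ hδ] at hn
  have hV : {τ : Formal d | InV e τ ∧ τ.hom α < c}.Finite :=
    (h1 n).subset fun τ hτ => ⟨hτ.1, by have := hτ.2; linarith⟩
  refine ((finite_InU hV).union hV).subset ?_
  rintro τ ⟨h | h, hc⟩
  · exact Or.inl ⟨h, by linarith⟩
  · exact Or.inr ⟨h, hc⟩

end Subcritical

/-! ### Triangularity -/

section Triangular

variable {α : ℝ} {e : Equation}

/-- `Γ̂_f τ - τ` is a combination of elements of `S` of lower homogeneity. -/
def Tri (f : TPlus d α e →ₐ[ℝ] ℝ) (S : Set (Formal d)) (τ : Formal d) : Prop :=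
  gammaHat f (basis τ) - basis τ ∈ spanOf {σ ∈ S | σ.hom α < τ.hom α}

variable {f : TPlus d α e →ₐ[ℝ] ℝ}

lemma Tri.mono {S S' : Set (Formal d)} (h : S ⊆ S') {τ : Formal d} (hτ : Tri f S τ) :
    Tri f S' τ :=
  spanOf_mono (S := {σ ∈ S | σ.hom α < τ.hom α}) (S' := {σ ∈ S' | σ.hom α < τ.hom α})
    (fun _ hσ => ⟨h hσ.1, hσ.2⟩) hτ

lemma Tri.mem {S : Set (Formal d)} {τ : Formal d} (hτ : Tri f S τ) (h : τ ∈ S) :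
    gammaHat f (basis τ) ∈ spanOf {σ ∈ S | σ.hom α ≤ τ.hom α} := by
  have h0 : τ ∈ {σ ∈ S | σ.hom α ≤ τ.hom α} := ⟨h, le_rfl⟩
  have h1 := Submodule.add_mem _ (spanOf_mono (S' := {σ ∈ S | σ.hom α ≤ τ.hom α})
    (fun σ hσ => ⟨hσ.1, le_of_lt hσ.2⟩) hτ) (basis_mem_spanOf h0)
  rwa [sub_add_cancel] at h1

/-- The three sets are independent because partial products and derivatives of elements of 𝒰 live in
auxiliary sets of their own. -/
lemma Tri.mul {S S' R : Set (Formal d)} (h : ∀ τ ∈ S, ∀ σ ∈ S', τ * σ ∈ R) {τ σ : Formal d}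
    (hτ : τ ∈ S) (hσ : σ ∈ S') (tτ : Tri f S τ) (tσ : Tri f S' σ) : Tri f R (τ * σ) := by
  have h1 : gammaHat f (basis (τ * σ)) - basis (τ * σ) =
      (gammaHat f (basis τ) - basis τ) * gammaHat f (basis σ) +
        basis τ * (gammaHat f (basis σ) - basis σ) := by
    rw [basis_mul, gammaHat_mul]; ring
  rw [Tri, h1]
  refine Submodule.add_mem _ (mul_mem_spanOf ?_ tτ (tσ.mem hσ))
    (mul_mem_spanOf ?_ (basis_mem_spanOf (Set.mem_singleton τ)) tσ)
  · rintro a ⟨ha, ha'⟩ b ⟨hb, hb'⟩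
    refine ⟨h a ha b hb, ?_⟩
    rw [Formal.hom_mul, Formal.hom_mul]; linarith
  · rintro a ha b ⟨hb, hb'⟩
    rw [Set.mem_singleton_iff.1 ha]
    refine ⟨h τ hτ b hb, ?_⟩
    rw [Formal.hom_mul, Formal.hom_mul]; linarith

lemma tri_mpow (k : MI d) : Tri f (Formal.poly d) (mpow Formal.X k) := by
  rw [Tri, gammaHat_mpow]
  have h1 := Submodule.smul_mem _ (mfact k : ℝ) (shiftPow_sub_mem (fun i => -f (Zv α e i)) k)
  rw [smul_sub, smul_smul, mul_inv_cancel₀ (mfact_ne_zero k), one_smul] at h1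
  refine spanOf_mono ?_ h1
  rintro _ ⟨j, hj, rfl⟩
  refine ⟨⟨j, rfl⟩, ?_⟩
  rw [Formal.hom_mpow, Formal.hom_mpow]
  exact_mod_cast hj

lemma tri_Xi (S : Set (Formal d)) : Tri f S Formal.Xi := by
  rw [Tri, gammaHat_Xi, sub_self]
  exact Submodule.zero_mem _

lemma tri_one (S : Set (Formal d)) : Tri f S 1 := by
  rw [Tri, basis_one, gammaHat_one, sub_self]
  exact Submodule.zero_mem _

lemma sum_shiftPow_mem (a : MI d → ℝ) (c : Fin (d + 1) → ℝ) (r : ℝ) :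
    ∑ k ∈ below d r, a k • shiftPow c k ∈
      spanOf (mpow Formal.X '' {k : MI d | (sdeg k : ℝ) < r}) := by
  refine Submodule.sum_mem _ fun k hk => Submodule.smul_mem _ _ (spanOf_mono ?_ (shiftPow_mem c k))
  refine Set.image_mono fun j hj => ?_
  have hj' : sdeg j ≤ sdeg k := hj
  exact lt_of_le_of_lt (by exact_mod_cast hj') (mem_below.1 hk)

/-- The lower-order terms lie in 𝒱, so I sends them to 𝒰 or, for Taylor monomials, to 0; the
subtracted polynomial has degree less than |τ| + 2, the homogeneity of I(τ). -/
lemma tri_I {τ : Formal d} (hp : τ ∉ Formal.poly d) (h : Tri f {σ | InV e σ} τ) :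
    Tri f {σ | InU e σ} (Formal.I τ) := by
  rw [Tri, gammaHat_I, sub_right_comm, ← intMap_basis hp, ← map_sub]
  refine Submodule.sub_mem _ (map_mem_spanOf (fun σ hσ => ?_) h)
    (spanOf_mono ?_ (sum_shiftPow_mem _ _ _))
  · by_cases hσp : σ ∈ Formal.poly d
    · rw [intMap_poly hσp]; exact Submodule.zero_mem _
    · rw [intMap_basis hσp]
      refine basis_mem_spanOf ⟨InU.int _ _ hσ.1 hσp, ?_⟩
      rw [Formal.hom_I, Formal.hom_I]
      linarith [hσ.2]
  · rintro _ ⟨k, hk, rfl⟩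
    refine ⟨InU.poly _ _, ?_⟩
    rw [Formal.hom_I, Formal.hom_mpow]
    exact hk

lemma InU.derMap_mem {τ : Formal d} (h : InU e τ) (i : Fin d) :
    derMap i (basis τ) ∈ spanOf {σ | (∃ τ, InU e τ ∧ IsDeriv i τ σ) ∧ σ.hom α = τ.hom α - 1} := by
  cases h with
  | poly _ k =>
    rw [derMap_mpow]
    by_cases hk : k i.succ = 0
    · rw [hk, Nat.cast_zero, zero_smul]; exact Submodule.zero_mem _
    · have hd : IsDeriv i (mpow Formal.X k) (mpow Formal.X (k - Pi.single i.succ 1)) := by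
        have := IsDeriv.poly (i := i) (k - Pi.single i.succ 1)
        rwa [sub_single_add hk] at this
      exact Submodule.smul_mem _ _ (basis_mem_spanOf ⟨⟨_, InU.poly _ k, hd⟩, hd.hom_eq⟩)
  | int _ σ hσ hp =>
    rw [derMap_basis i (Formal.I_notMem_poly σ)]
    exact basis_mem_spanOf ⟨⟨_, InU.int _ _ hσ hp, IsDeriv.int σ⟩, (IsDeriv.int σ).hom_eq⟩

lemma tri_deriv {i : Fin d} {τ σ : Formal d} (hd : IsDeriv i τ σ) (h : Tri f {σ | InU e σ} τ) :
    Tri f {σ | ∃ τ, InU e τ ∧ IsDeriv i τ σ} σ := by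
  rcases hd.cases (α := α) with ⟨_, ⟨m, rfl⟩, _⟩ | ⟨τ', rfl, rfl⟩
  · refine (tri_mpow m).mono ?_
    rintro _ ⟨k, rfl⟩
    exact ⟨_, InU.poly _ _, IsDeriv.poly k⟩
  · rw [Tri, gammaHat_D, ← derMap_basis i (Formal.I_notMem_poly τ'), ← map_sub]
    refine map_mem_spanOf (fun σ hσ => ?_) h
    refine spanOf_mono ?_ (InU.derMap_mem (α := α) hσ.1 i)
    rintro ρ ⟨hρ, hρ'⟩
    refine ⟨hρ, ?_⟩
    rw [hρ', Formal.hom_D]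
    linarith [hσ.2]

/-- Products of elements of `𝒰`. -/
def prodU (d : ℕ) (e : Equation) : Set (Formal d) :=
  {σ | ∃ (m : ℕ) (τ : Fin m → Formal d), (∀ j, InU e (τ j)) ∧ σ = ∏ j, τ j}

lemma mul_mem_prodU {τ σ : Formal d} (hτ : InU e τ) (hσ : σ ∈ prodU d e) : τ * σ ∈ prodU d e := by
  obtain ⟨m, ρ, hρ, rfl⟩ := hσ
  refine ⟨m + 1, Fin.cons τ ρ, fun j => ?_, by simp [Fin.prod_univ_succ]⟩
  refine Fin.cases ?_ (fun j => ?_) j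
  · simpa
  · simpa using hρ j

lemma InV.of_prodU {σ : Formal d} (h : σ ∈ prodU d .mult) : InV .mult σ := by
  obtain ⟨m, τ, hτ, rfl⟩ := h
  -- The empty product, excluded in `mult_prod`, is the Taylor monomial 1.
  rcases Nat.eq_zero_or_pos m with rfl | hm
  · have := InV.poly (d := d) .mult 0
    simpa using this
  · exact InV.mult_prod m τ hm hτ

lemma InV.of_Xi_mul_prodU {σ : Formal d} (h : σ ∈ prodU d .mult) :
    InV .mult (Formal.Xi * σ) := by
  obtain ⟨m, τ, hτ, rfl⟩ := h
  -- For m = 0 the noise alone is obtained as Ξ · 1, with one factor from 𝒰.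
  rcases Nat.eq_zero_or_pos m with rfl | hm
  · have := InV.mult_noise (d := d) 1 (fun _ => mpow Formal.X 0) le_rfl (fun _ => InU.poly _ _)
    simpa using this
  · exact InV.mult_noise m τ hm hτ

lemma tri_prod : ∀ {m : ℕ} {τ : Fin m → Formal d}, (∀ j, InU e (τ j)) →
    (∀ j, Tri f {σ | InU e σ} (τ j)) → Tri f (prodU d e) (∏ j, τ j)
  | 0, τ, _, _ => by simpa using tri_one _
  | m + 1, τ, h, t => by
    rw [Fin.prod_univ_succ]
    exact Tri.mul (fun a ha b hb => mul_mem_prodU ha hb) (h 0)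
      ⟨m, _, fun j => h j.succ, rfl⟩ (t 0) (tri_prod (fun j => h j.succ) fun j => t j.succ)

-- 𝒰 and 𝒱 are tracked separately, since I leads from 𝒱 to 𝒰 and the rules for 𝒱 take factors from
-- 𝒰. Expanding a product replaces each factor by factors of the same kind, so the same closure rule
-- covers every resulting term.
mutual

theorem InU.tri : ∀ {e : Equation} {f : TPlus d α e →ₐ[ℝ] ℝ} {τ : Formal d}, InU e τ →
      Tri f {σ | InU e σ} τ
  | _, _, _, .poly _ k => (tri_mpow k).mono (by rintro _ ⟨j, rfl⟩; exact InU.poly _ j)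
  | _, _, _, .int _ _ h hp => tri_I hp (InV.tri h)

theorem InV.tri : ∀ {e : Equation} {f : TPlus d α e →ₐ[ℝ] ℝ} {τ : Formal d}, InV e τ →
      Tri f {σ | InV e σ} τ
  | _, _, _, .poly _ k => (tri_mpow k).mono (by rintro _ ⟨j, rfl⟩; exact InV.poly _ j)
  | _, _, _, .phi4_noise => tri_Xi _
  | _, _, _, .phi4_prod τ₁ τ₂ τ₃ h₁ h₂ h₃ =>
      Tri.mul (S := {σ | ∃ a b, InU .phi4 a ∧ InU .phi4 b ∧ σ = a * b}) (S' := {σ | InU .phi4 σ})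
        (by rintro _ ⟨a, b, ha, hb, rfl⟩ c hc; exact InV.phi4_prod _ _ _ ha hb hc)
        ⟨τ₁, τ₂, h₁, h₂, rfl⟩ h₃
        (Tri.mul (S := {σ | InU .phi4 σ}) (S' := {σ | InU .phi4 σ})
          (R := {σ | ∃ a b, InU .phi4 a ∧ InU .phi4 b ∧ σ = a * b})
          (fun a ha b hb => ⟨a, b, ha, hb, rfl⟩) h₁ h₂ (InU.tri h₁) (InU.tri h₂))
        (InU.tri h₃)
  | _, _, _, .kpz_noise => tri_Xi _
  | _, _, _, .kpz_prod i τ₁ τ₂ σ₁ σ₂ h₁ h₂ d₁ d₂ =>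
      Tri.mul (S := {σ | ∃ τ, InU .kpz τ ∧ IsDeriv i τ σ})
        (S' := {σ | ∃ τ, InU .kpz τ ∧ IsDeriv i τ σ})
        (by rintro a ⟨a', ha, ha'⟩ b ⟨b', hb, hb'⟩; exact InV.kpz_prod i _ _ _ _ ha hb ha' hb')
        ⟨τ₁, h₁, d₁⟩ ⟨τ₂, h₂, d₂⟩ (tri_deriv d₁ (InU.tri h₁)) (tri_deriv d₂ (InU.tri h₂))
  | _, _, _, .mult_noise m τ _ h =>
      Tri.mul (S := {Formal.Xi}) (S' := prodU d .mult)
        (by rintro a rfl b hb; exact InV.of_Xi_mul_prodU hb) rfl ⟨m, τ, h, rfl⟩ (tri_Xi _)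
        (tri_prod h fun j => InU.tri (h j))
  | _, _, _, .mult_prod _ _ _ h =>
      (tri_prod h fun j => InU.tri (h j)).mono fun _ hσ => InV.of_prodU hσ

end

/-- The operators `Γ̂_f` are upper triangular. -/
theorem tri_UV {τ : Formal d} (h : τ ∈ UV d e) : Tri f (UV d e) τ := by
  rcases h with h | h
  · exact h.tri.mono fun _ => Or.inl
  · exact h.tri.mono fun _ => Or.inr

lemma gammaHat_UV_mem {τ : Formal d} (h : τ ∈ UV d e) :
    gammaHat f (basis τ) ∈ spanOf {σ ∈ UV d e | σ.hom α ≤ τ.hom α} :=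
  (tri_UV h).mem h

lemma gammaHat_spanOf_UV {x : Lin d} (h : x ∈ spanOf (UV d e)) :
    gammaHat f x ∈ spanOf (UV d e) :=
  map_mem_spanOf (fun _ hτ => spanOf_mono (fun _ hσ => hσ.1) (gammaHat_UV_mem hτ)) h

lemma gammaHat_InV_mem {τ : Formal d} (h : InV e τ) :
    gammaHat f (basis τ) ∈ spanOf {σ | InV e σ ∧ σ.hom α ≤ τ.hom α} :=
  h.tri.mem h

lemma gammaHat_InU_mem {τ : Formal d} (h : InU e τ) :
    gammaHat f (basis τ) ∈ spanOf {σ | InU e σ ∧ σ.hom α ≤ τ.hom α} :=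
  h.tri.mem h

lemma gammaHat_modelSpace (γ : ℝ) {x : Lin d} (h : x ∈ modelSpace d α e γ) :
    gammaHat f x ∈ modelSpace d α e γ :=
  map_mem_spanOf (S := basisSet d α e γ) (fun _ hτ =>
    spanOf_mono (S' := basisSet d α e γ) (fun _ hσ => ⟨hσ.1, hσ.2.trans_lt hτ.2⟩)
      (gammaHat_UV_mem hτ.1)) h

end Triangular

/-! ### The group of morphisms -/

section Group

variable {α : ℝ} {e : Equation}

lemma charMul_Z (f g : TPlus d α e →ₐ[ℝ] ℝ) (i : Fin (d + 1)) :
    charMul f g (Zv α e i) = f (Zv α e i) + g (Zv α e i) := by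
  simp [charMul, deltaPlus, Zv]

lemma Jv_eq_zero {k : MI d} {τ : Formal d} (h : ¬ JOk α e k τ) : Jv α e k τ = 0 := by
  simp [Jv, h]

lemma Jlin_basis (k : MI d) (τ : Formal d) : Jlin α e k (basis τ) = Jv α e k τ := by
  simp [Jlin]

lemma Jlin_eq_zero {r : ℝ} {k : MI d} (hk : r + 2 ≤ sdeg k) {x : Lin d}
    (hx : x ∈ spanOf {σ | σ.hom α ≤ r}) : Jlin α e k x = 0 := by
  refine eqOn_spanOf (g := 0) (fun σ hσ => ?_) hx
  rw [Jlin_basis, Jv_eq_zero, LinearMap.zero_apply]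
  intro h
  have h1 : σ.hom α ≤ r := hσ
  linarith [h.2.2]

lemma Jlin_poly (k : MI d) {x : Lin d} (hx : x ∈ spanOf (Formal.poly d)) :
    Jlin α e k x = 0 := by
  refine eqOn_spanOf (g := 0) (fun σ hσ => ?_) hx
  rw [Jlin_basis, Jv_eq_zero, LinearMap.zero_apply]
  exact fun h => h.2.1 hσ

/-- Applying g first, as id ⊗ g, turns the summands of Δ⁺𝒥_k(τ) into f(𝒥_{k+m}(Γ̂_g τ)) times powers
of g(Z). -/
lemma lift_map_eq (f g : TPlus d α e →ₐ[ℝ] ℝ) (L : Lin d →ₗ[ℝ] TPlus d α e) (t : TPlus d α e)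
    (u : Lin d ⊗[ℝ] TPlus d α e) :
    Algebra.TensorProduct.lift f g (fun _ _ => Commute.all _ _)
      (TensorProduct.map L (LinearMap.mulLeft ℝ t) u) = f (L (idTensor g u)) * g t := by
  induction u using TensorProduct.induction_on with
  | zero => simp
  | tmul x s => simp; ring
  | add x y hx hy => simp only [map_add, hx, hy]; ring

lemma charMul_J (f g : TPlus d α e →ₐ[ℝ] ℝ) {k : MI d} {τ : Formal d} (h : JOk α e k τ) :
    charMul f g (Jv α e k τ) = g (Jv α e k τ) + ∑ m ∈ below d (τ.hom α + 2),
      f (Jlin α e (k + m) (gammaHat g (basis τ))) * dpow (fun i => g (Zv α e i)) m := by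
  have h1 : Jv α e k τ = MvPolynomial.X (Sum.inr ⟨(k, τ), h⟩) := by simp [Jv, h]
  rw [h1, charMul, AlgHom.comp_apply, deltaPlus, MvPolynomial.aeval_X]
  simp only [Sum.elim_inr, map_add, map_sum, map_smul, lift_map_eq]
  congr 1
  · rw [Algebra.TensorProduct.lift_tmul, map_one, one_mul, h1]
  · refine Finset.sum_congr rfl fun m _ => ?_
    rw [gammaHat_basis', map_mpow, dpow, smul_eq_mul, smul_eq_mul]
    ring

/-- The formula for `f ∘ g` on `𝒥_k(τ)` holds also when `𝒥_k(τ) = 0`. -/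
lemma charMul_J' (f g : TPlus d α e →ₐ[ℝ] ℝ) (k : MI d) {τ : Formal d} (h : τ ∈ UV d e) :
    charMul f g (Jv α e k τ) = g (Jv α e k τ) + ∑ m ∈ below d (τ.hom α + 2),
      f (Jlin α e (k + m) (gammaHat g (basis τ))) * dpow (fun i => g (Zv α e i)) m := by
  by_cases hJ : JOk α e k τ
  · exact charMul_J f g hJ
  rw [Jv_eq_zero hJ, map_zero, map_zero, zero_add]
  refine (Finset.sum_eq_zero fun m _ => ?_).symm
  suffices h1 : Jlin α e (k + m) (gammaHat g (basis τ)) = 0 by rw [h1, map_zero, zero_mul]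
  by_cases hp : τ ∈ Formal.poly d
  · obtain ⟨j, rfl⟩ := hp
    exact Jlin_poly _ (spanOf_mono (by rintro _ ⟨i, _, rfl⟩; exact ⟨i, rfl⟩)
      (gammaHat_mpow_mem g j))
  · refine Jlin_eq_zero (r := τ.hom α) ?_ (spanOf_mono (fun _ hσ => hσ.2) (gammaHat_UV_mem h))
    have h2 : τ.hom α + 2 ≤ sdeg k := by
      by_contra! hcon
      exact hJ ⟨h, hp, hcon⟩
    rw [sdeg_add]; push_cast
    have : (0 : ℝ) ≤ sdeg m := by positivity
    linarith

/-- This extends `gammaHat_I` to combinations with one common range of k: 𝒥_k(σ) vanishes for |k| ≥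
|σ| + 2, so enlarging the range only adds zeros, and on Taylor monomials both I and 𝒥_k vanish. -/
lemma gammaHat_intMap (f : TPlus d α e →ₐ[ℝ] ℝ) {r : ℝ} {x : Lin d}
    (hx : x ∈ spanOf {σ | σ.hom α ≤ r}) :
    gammaHat f (intMap d x) = intMap d (gammaHat f x) -
      ∑ k ∈ below d (r + 2), f (Jlin α e k x) • shiftPow (fun i => -f (Zv α e i)) k := by
  set R : Lin d →ₗ[ℝ] Lin d := intMap d ∘ₗ gammaHat f -
    ∑ k ∈ below d (r + 2), (LinearMap.toSpanSingleton ℝ (Lin d)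
      (shiftPow (fun i => -f (Zv α e i)) k)) ∘ₗ f.toLinearMap ∘ₗ Jlin α e k
  have h : (gammaHat f ∘ₗ intMap d) x = R x := by
    refine eqOn_spanOf (fun σ hσ => ?_) hx
    have hR : R (basis σ) = intMap d (gammaHat f (basis σ)) -
      ∑ k ∈ below d (r + 2), f (Jv α e k σ) • shiftPow (fun i => -f (Zv α e i)) k := by
      simp [R, Jlin_basis]
    rw [hR, LinearMap.comp_apply]
    by_cases hp : σ ∈ Formal.poly d
    · obtain ⟨j, rfl⟩ := hp
      rw [intMap_poly ⟨j, rfl⟩, map_zero]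
      rw [Finset.sum_eq_zero fun k _ => by
        rw [Jv_eq_zero fun h => h.2.1 ⟨j, rfl⟩, map_zero, zero_smul], sub_zero]
      refine (eqOn_spanOf (g := 0) ?_ (gammaHat_mpow_mem f j)).symm
      rintro _ ⟨i, _, rfl⟩
      exact intMap_poly ⟨i, rfl⟩
    · rw [intMap_basis hp, gammaHat_I]
      congr 1
      refine Finset.sum_subset (fun k hk => ?_) fun k _ hk => ?_
      · rw [mem_below] at hk ⊢
        have : σ.hom α ≤ r := hσ
        linarith
      · rw [Jv_eq_zero fun h => hk (mem_below.2 h.2.2), map_zero, zero_smul]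
  simpa [R] using h

lemma mfact_add_single (j : MI d) (i : Fin (d + 1)) :
    mfact (j + Pi.single i 1) = (j i + 1) * mfact j := by
  rw [mfact, mfact, ← Finset.mul_prod_erase _ _ (Finset.mem_univ i),
    ← Finset.mul_prod_erase _ (fun i => (j i).factorial) (Finset.mem_univ i), ← mul_assoc]
  congr 1
  · simp [Nat.factorial_succ]
  · refine Finset.prod_congr rfl fun l hl => ?_
    simp [(Finset.mem_erase.1 hl).1]

lemma derMap_shiftPow (c : Fin (d + 1) → ℝ) (i : Fin d) (k : MI d) :
    derMap i (shiftPow c (k + Pi.single i.succ 1)) = shiftPow c k := by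
  rw [shiftPow_eq, shiftPow_eq, map_sum]
  simp only [map_smul, derMap_mpow, smul_smul]
  -- Terms are matched by raising the exponent of the differentiated variable by one; the unmatched
  -- monomials do not contain that variable and are killed by 𝒟_i.
  refine (Finset.sum_of_injOn (· + Pi.single i.succ 1) ((add_left_injective _).injOn) ?_ ?_ ?_).symm
  · intro j hj
    simp only [Finset.mem_coe, Fintype.mem_piFinset, Finset.mem_range, Nat.lt_succ_iff] at hj ⊢
    exact fun l => Nat.add_le_add_right (hj l) _
  · intro j hj hj'
    suffices h : j i.succ = 0 by rw [h, Nat.cast_zero, mul_zero, zero_smul]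
    by_contra hne
    refine hj' ⟨j - Pi.single i.succ 1, ?_, sub_single_add hne⟩
    simp only [Finset.mem_coe, Fintype.mem_piFinset, Finset.mem_range, Nat.lt_succ_iff] at hj ⊢
    intro l
    have := hj l
    simp only [Pi.add_apply, Pi.sub_apply] at this ⊢
    omega
  · intro j _
    simp only [add_tsub_cancel_right, add_tsub_add_eq_tsub_right, mfact_add_single]
    congr 1
    rw [mul_assoc]
    congr 1
    have h1 := mfact_ne_zero j
    have h2 : ((j i.succ : ℝ) + 1) ≠ 0 := by positivity
    simp only [Pi.add_apply, Pi.single_eq_same]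
    push_cast
    field_simp

lemma derMap_shiftPow_of_eq_zero {c : Fin (d + 1) → ℝ} {i : Fin d} {k : MI d}
    (hk : k i.succ = 0) : derMap i (shiftPow c k) = 0 := by
  rw [shiftPow_eq, map_sum]
  refine Finset.sum_eq_zero fun j hj => ?_
  simp only [Fintype.mem_piFinset, Finset.mem_range, Nat.lt_succ_iff] at hj
  have h : j i.succ = 0 := by have := hj i.succ; omega
  rw [map_smul, derMap_mpow, h, Nat.cast_zero, zero_smul, smul_zero]

/-- On I(τ) this is the defining relation of Δ𝒟_i; only Taylor monomials need a computation, since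
there 𝒟_i is the actual derivative and has to commute with translations. -/
lemma gammaHat_derMap (f : TPlus d α e →ₐ[ℝ] ℝ) (i : Fin d) {x : Lin d}
    (hx : x ∈ spanOf {σ : Formal d | InU e σ}) :
    gammaHat f (derMap i x) = derMap i (gammaHat f x) := by
  refine eqOn_spanOf (f := gammaHat f ∘ₗ derMap i) (g := derMap i ∘ₗ gammaHat f) (fun σ hσ => ?_) hx
  simp only [LinearMap.comp_apply]
  have hσ' : InU e σ := hσ
  cases hσ' with
  | int _ τ _ _ =>
    rw [derMap_basis i (Formal.I_notMem_poly τ), gammaHat_D]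
  | poly _ k =>
    by_cases hk : k i.succ = 0
    · rw [derMap_mpow, hk, Nat.cast_zero, zero_smul, map_zero, gammaHat_mpow, map_smul,
        derMap_shiftPow_of_eq_zero hk, smul_zero]
    · rw [← sub_single_add hk, gammaHat_mpow, map_smul, derMap_shiftPow, derMap_mpow,
        add_tsub_cancel_right, map_smul, gammaHat_mpow, smul_smul, mfact_add_single]
      simp

/-- `Γ̂_f Γ̂_g = Γ̂_{f ∘ g}`. -/
theorem gammaHat_charMul (hα : α < 0) (hcrit : e.threshold < α) (f g : TPlus d α e →ₐ[ℝ] ℝ)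
    {x : Lin d} (hx : x ∈ spanOf (UV d e)) :
    gammaHat (charMul f g) x = gammaHat f (gammaHat g x) := by
  refine eqOn_spanOf (f := gammaHat (charMul f g)) (g := gammaHat f ∘ₗ gammaHat g)
    (fun σ hσ => ?_) hx
  have hI : ∀ τ : Formal d, InV e τ →
      gammaHat (charMul f g) (basis τ) = gammaHat f (gammaHat g (basis τ)) →
      gammaHat (charMul f g) (basis (Formal.I τ)) =
        gammaHat f (gammaHat g (basis (Formal.I τ))) := by
    intro τ hτ ih
    rw [gammaHat_I, gammaHat_I, map_sub, gammaHat_intMap f (r := τ.hom α)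
      (spanOf_mono (fun _ hσ => hσ.2) (gammaHat_InV_mem hτ)), ih, sub_sub]
    congr 1
    simp only [map_sum, map_smul, gammaHat_shiftPow, charMul_Z]
    -- Applying Γ̂_f to I(Γ̂_g τ) produces a polynomial centred at f(Z). Reexpanded at f(Z) + g(Z),
    -- its coefficients are the sums over m in the formula for (f ∘ g)(𝒥_k(τ)); the remaining term
    -- g(𝒥_k(τ)) comes from Γ̂_g I(τ).
    have h1 := sum_smul_dpow_add (A := Lin d) (τ.hom α + 2)
      (fun k => f (Jlin α e k (gammaHat g (basis τ)))) (fun k hk => by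
        rw [Jlin_eq_zero hk (spanOf_mono (fun _ hσ => hσ.2) (gammaHat_InV_mem hτ)), map_zero])
      (fun i => basis (Formal.X i) + algebraMap ℝ (Lin d) (-(f (Zv α e i) + g (Zv α e i))))
      (fun i => g (Zv α e i))
    have h2 : (fun i => basis (Formal.X i) +
        algebraMap ℝ (Lin d) (-(f (Zv α e i) + g (Zv α e i))) +
          algebraMap ℝ (Lin d) (g (Zv α e i))) =
        fun i => basis (Formal.X i) + algebraMap ℝ (Lin d) (-f (Zv α e i)) := by
      funext i
      rw [add_assoc, ← map_add]
      congr 2; ring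
    rw [h2] at h1
    simp only [shiftPow] at h1 ⊢
    rw [h1, ← Finset.sum_add_distrib]
    refine Finset.sum_congr rfl fun k hk => ?_
    rw [charMul_J' f g k (Or.inr hτ), add_smul, add_comm]
    congr 3
    funext i
    congr 2
    ring
  -- No truncation is needed here: any bound above |σ| makes the induction applicable.
  refine UV_induction (P := fun τ => gammaHat (charMul f g) (basis τ) =
    (gammaHat f ∘ₗ gammaHat g) (basis τ)) hα hcrit (σ.hom α + 1) ?_ ?_ ?_ ?_ ?_ ?_ hσ (by linarith)
  · simp
  · intro i
    simp only [LinearMap.comp_apply, gammaHat_X, charMul_Z, map_add]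
    rw [← gammaAlg_apply f (algebraMap _ _ _), AlgHom.commutes, add_assoc, ← map_add]
    congr 2; ring
  · simp
  · intro a b ha hb
    simp only [LinearMap.comp_apply] at ha hb ⊢
    simp only [basis_mul, gammaHat_mul, ha, hb]
  · intro τ hτ _ _ ih
    exact hI τ hτ ih
  · intro i τ hτ hp _ _ ih
    simp only [LinearMap.comp_apply] at ih ⊢
    rw [gammaHat_D, gammaHat_D, ih, gammaHat_derMap f i
      (spanOf_mono (fun _ hσ => hσ.1) (gammaHat_InU_mem (InU.int _ _ hτ hp)))]

end Group

/-! ### Inverses -/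

section Inverse

variable {α : ℝ} {e : Equation}

lemma charInv_Z (f : TPlus d α e →ₐ[ℝ] ℝ) (i : Fin (d + 1)) :
    charInv f (Zv α e i) = -f (Zv α e i) := by
  simp [charInv, antipode, Zv]

lemma charInv_J (f : TPlus d α e →ₐ[ℝ] ℝ) (k : MI d) (τ : Formal d) :
    charInv f (Jv α e k τ) = f (antiJ α e k τ (antiDelta α e τ)) := by
  by_cases h : JOk α e k τ
  · have h1 : Jv α e k τ = MvPolynomial.X (Sum.inr ⟨(k, τ), h⟩) := by simp [Jv, h]
    rw [h1, charInv, AlgHom.comp_apply, antipode, MvPolynomial.aeval_X]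
    rfl
  · rw [Jv_eq_zero h, antiJ, if_neg h, map_zero, map_zero]

lemma mul_map_eq (f : TPlus d α e →ₐ[ℝ] ℝ) (L : Lin d →ₗ[ℝ] TPlus d α e) (t : TPlus d α e)
    (u : Lin d ⊗[ℝ] TPlus d α e) :
    f (LinearMap.mul' ℝ (TPlus d α e) (TensorProduct.map L (LinearMap.mulLeft ℝ t) u)) =
      f (L (idTensor f u)) * f t := by
  induction u using TensorProduct.induction_on with
  | zero => simp
  | tmul x s => simp; ring
  | add x y hx hy => simp only [map_add, hx, hy]; ring

lemma antiJ_apply (f : TPlus d α e →ₐ[ℝ] ℝ) {k : MI d} {τ : Formal d} (h : JOk α e k τ)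
    (u : Lin d ⊗[ℝ] TPlus d α e) :
    f (antiJ α e k τ u) = - ∑ m ∈ below d (τ.hom α + 2),
      f (Jlin α e (k + m) (idTensor f u)) * dpow (fun i => -f (Zv α e i)) m := by
  rw [antiJ, if_pos h]
  simp only [map_neg, map_sum, map_smul, mul_map_eq, map_mpow]
  congr 1
  refine Finset.sum_congr rfl fun m _ => ?_
  rw [dpow, smul_eq_mul, smul_eq_mul]
  ring

/-- Both sides obey the same recursion over terms, because `Raw.antiDelta` is the recursion for Δ
with each generator of T_+ replaced by its antipode. -/
lemma idTensor_antiDelta (f : TPlus d α e →ₐ[ℝ] ℝ) (τ : Formal d) :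
    idTensor f (antiDelta α e τ) = gammaHat (charInv f) (basis τ) := by
  rcases τ with ⟨a⟩
  induction a with
  | one => exact (map_one _).trans (gammaHat_one _).symm
  | X i =>
    refine Eq.trans ?_ (gammaHat_X (charInv f) i).symm
    change idTensor f (basis (Formal.X i) ⊗ₜ 1 + 1 ⊗ₜ Zv α e i) = _
    simp [charInv_Z, Algebra.algebraMap_eq_smul_one]
  | Xi =>
    refine Eq.trans ?_ (gammaHat_Xi (charInv f)).symm
    change idTensor f (basis Formal.Xi ⊗ₜ 1) = _
    simp
  | I a ih =>
    refine Eq.trans ?_ (gammaHat_I (charInv f) (Formal.mk a)).symm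
    refine Eq.trans ?_ (congr_arg (fun x => intMap d x - ∑ k ∈ below d ((Formal.mk a).hom α + 2),
      charInv f (Jv α e k (Formal.mk a)) • shiftPow (fun i => -charInv f (Zv α e i)) k) ih)
    change idTensor f (TensorProduct.map (intMap d) LinearMap.id (a.antiDelta α e) -
      ∑ k ∈ below d (a.hom α + 2), (mfact k : ℝ)⁻¹ •
        (mpow (fun i => basis (Formal.X i) ⊗ₜ[ℝ] (1 : TPlus d α e) + 1 ⊗ₜ Zv α e i) k *
          (1 ⊗ₜ antiJ α e k (Formal.mk a) (a.antiDelta α e)))) = _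
    rw [map_sub, map_sum, idTensor_map]
    congr 1
    refine Finset.sum_congr rfl fun k _ => ?_
    rw [idTensor_mpow, charInv_J]
    congr 2
    funext i
    simp [Algebra.algebraMap_eq_smul_one, charInv_Z]
  | D i a ih =>
    refine Eq.trans ?_ (gammaHat_D (charInv f) i (Formal.mk a)).symm
    refine Eq.trans ?_ (congr_arg (derMap i) ih)
    exact idTensor_map f (derMap i) (a.antiDelta α e)
  | mul a b ha hb =>
    refine Eq.trans (map_mul (idTensor f) (a.antiDelta α e) (b.antiDelta α e)) ?_
    refine (congr_arg₂ (· * ·) ha hb).trans ?_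
    exact (gammaHat_mul _ _ _).symm.trans
      (congr_arg (gammaHat (charInv f)) (basis_mul (Formal.mk a) (Formal.mk b)).symm)

/-- The unit of the group of morphisms. -/
def counit (d : ℕ) (α : ℝ) (e : Equation) : TPlus d α e →ₐ[ℝ] ℝ := MvPolynomial.aeval 0

lemma counit_Z (i : Fin (d + 1)) : counit d α e (Zv α e i) = 0 := by simp [counit, Zv]

lemma counit_J (k : MI d) (τ : Formal d) : counit d α e (Jv α e k τ) = 0 := by
  by_cases h : JOk α e k τ
  · simp [Jv, h, counit]
  · rw [Jv_eq_zero h, map_zero]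

/-- The recursion defining 𝒜 on 𝒥_k(τ) is the equation (f ∘ f⁻¹)(𝒥_k(τ)) = 0 solved for f⁻¹(𝒥_k(τ)),
so all terms cancel. -/
lemma charMul_charInv (f : TPlus d α e →ₐ[ℝ] ℝ) : charMul f (charInv f) = counit d α e := by
  refine MvPolynomial.algHom_ext fun j => ?_
  rcases j with i | ⟨⟨k, τ⟩, h⟩
  · refine (charMul_Z f (charInv f) i).trans ?_
    rw [charInv_Z, add_neg_cancel]
    exact (counit_Z i).symm
  · have h1 : (MvPolynomial.X (Sum.inr ⟨(k, τ), h⟩) : TPlus d α e) = Jv α e k τ := by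
      have h' : JOk α e k τ := h
      simp [Jv, h']
    rw [h1, counit_J, charMul_J f _ h, charInv_J, antiJ_apply f h, idTensor_antiDelta]
    simp only [charInv_Z]
    ring

lemma gammaHat_counit (hα : α < 0) (hcrit : e.threshold < α) {x : Lin d}
    (hx : x ∈ spanOf (UV d e)) : gammaHat (counit d α e) x = x := by
  refine eqOn_spanOf (g := LinearMap.id) (fun σ hσ => ?_) hx
  refine UV_induction (P := fun τ => gammaHat (counit d α e) (basis τ) = basis τ) hα hcrit
    (σ.hom α + 1) ?_ ?_ ?_ ?_ ?_ ?_ hσ (by linarith)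
  · simp
  · intro i
    simp [gammaHat_X, counit_Z]
  · simp
  · intro a b ha hb
    rw [basis_mul, gammaHat_mul, ha, hb]
  · intro τ _ hp _ ih
    rw [gammaHat_I, ih, intMap_basis hp]
    simp [counit_J]
  · intro i τ _ _ _ _ ih
    rw [gammaHat_D, ih, derMap_basis i (Formal.I_notMem_poly τ)]

lemma gammaHat_gammaHat_charInv (hα : α < 0) (hcrit : e.threshold < α) (f : TPlus d α e →ₐ[ℝ] ℝ)
    {x : Lin d} (hx : x ∈ spanOf (UV d e)) : gammaHat f (gammaHat (charInv f) x) = x := by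
  rw [← gammaHat_charMul hα hcrit f (charInv f) hx, charMul_charInv, gammaHat_counit hα hcrit hx]

/-- Right inverses suffice: f⁻¹ has the right inverse (f⁻¹)⁻¹, whose operator then coincides with
Γ̂_f on 𝒰 ∪ 𝒱, so the inverse is two-sided. -/
lemma gammaHat_charInv_gammaHat (hα : α < 0) (hcrit : e.threshold < α) (f : TPlus d α e →ₐ[ℝ] ℝ)
    {x : Lin d} (hx : x ∈ spanOf (UV d e)) : gammaHat (charInv f) (gammaHat f x) = x := by
  have h1 := gammaHat_gammaHat_charInv hα hcrit (charInv f) hx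
  have h2 := gammaHat_gammaHat_charInv hα hcrit f
    (gammaHat_spanOf_UV (f := charInv (charInv f)) hx)
  rw [h1] at h2
  rw [h2, h1]

/-- The values of `f` on `𝒥_k(τ)` are determined by `Γ̂_f`. -/
lemma apply_J_eq {f g : TPlus d α e →ₐ[ℝ] ℝ} {τ : Formal d}
    (hX : ∀ i, f (Zv α e i) = g (Zv α e i))
    (hτ : gammaHat f (basis τ) = gammaHat g (basis τ))
    (hI : gammaHat f (basis (Formal.I τ)) = gammaHat g (basis (Formal.I τ))) (k : MI d) :
    f (Jv α e k τ) = g (Jv α e k τ) := by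
  classical
  by_cases hJ : JOk α e k τ
  swap
  · rw [Jv_eq_zero hJ, map_zero, map_zero]
  have hk := mem_below.2 hJ.2.2
  rw [gammaHat_I, gammaHat_I, hτ, sub_right_inj] at hI
  simp only [hX] at hI
  -- An auxiliary translation that recentres the polynomials at 0, where their coefficients can be
  -- read off.
  set h : TPlus d α e →ₐ[ℝ] ℝ := MvPolynomial.aeval (Sum.elim (fun i => -g (Zv α e i)) 0)
  have hh : ∀ i, h (Zv α e i) = -g (Zv α e i) := fun i => by simp [h, Zv]
  have h1 := congr_arg (fun x => (gammaHat h x).coeff (mpow Formal.X k)) hI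
  have h2 : ∀ a : MI d → ℝ, (gammaHat h (∑ k ∈ below d (τ.hom α + 2),
      a k • shiftPow (fun i => -g (Zv α e i)) k)).coeff (mpow Formal.X k) =
        a k * (mfact k : ℝ)⁻¹ := by
    intro a
    simp only [map_sum, map_smul, gammaHat_shiftPow, hh, sub_self]
    change (∑ k ∈ below d (τ.hom α + 2), a k • shiftPow 0 k).coeff (mpow Formal.X k) = _
    simp only [shiftPow_zero, MonoidAlgebra.coeff_sum, MonoidAlgebra.coeff_smul,
      Finsupp.finsetSum_apply, Finsupp.smul_apply, coeff_basis, Formal.mpow_injective.eq_iff,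
      smul_eq_mul, mul_ite, mul_one, mul_zero]
    rw [Finset.sum_ite_eq', if_pos hk]
  simp only [h2] at h1
  exact mul_right_cancel₀ (inv_ne_zero (mfact_ne_zero k)) h1

end Inverse

/-! ### The regularity structure -/

section Norm

variable {α : ℝ}

lemma homNorm_eq_sum {β : ℝ} {x : Lin d} (F : Finset (Formal d)) (hF : ∀ τ ∈ F, τ.hom α = β)
    (h : ∀ τ, τ.hom α = β → x.coeff τ ≠ 0 → τ ∈ F) :
    homNorm α β x = ∑ τ ∈ F, |x.coeff τ| := by
  classical
  rw [homNorm]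
  refine Finset.sum_subset (fun τ hτ => ?_) fun τ hτ hτ' => ?_
  · rw [Finset.mem_filter, Finsupp.mem_support_iff] at hτ
    exact h τ hτ.2 hτ.1
  · by_contra hne
    exact hτ' (Finset.mem_filter.2 ⟨Finsupp.mem_support_iff.2 fun h0 => hne (by simp [h0]),
      hF τ hτ⟩)

lemma homNorm_nonneg (β : ℝ) (x : Lin d) : 0 ≤ homNorm α β x :=
  Finset.sum_nonneg fun _ _ => abs_nonneg _

lemma abs_coeff_le_homNorm (x : Lin d) (τ : Formal d) : |x.coeff τ| ≤ homNorm α (τ.hom α) x := by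
  classical
  by_cases h : x.coeff τ = 0
  · rw [h, abs_zero]; exact homNorm_nonneg _ _
  · exact Finset.single_le_sum (f := fun τ => |x.coeff τ|) (fun _ _ => abs_nonneg _)
      (Finset.mem_filter.2 ⟨Finsupp.mem_support_iff.2 h, rfl⟩)

lemma homNorm_add (β : ℝ) (x y : Lin d) :
    homNorm α β (x + y) ≤ homNorm α β x + homNorm α β y := by
  classical
  set F := (x.coeff.support ∪ y.coeff.support).filter fun τ => τ.hom α = β
  have hF : ∀ τ ∈ F, τ.hom α = β := fun τ hτ => (Finset.mem_filter.1 hτ).2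
  have key : ∀ z : Lin d, (∀ τ, z.coeff τ ≠ 0 → x.coeff τ ≠ 0 ∨ y.coeff τ ≠ 0) →
      homNorm α β z = ∑ τ ∈ F, |z.coeff τ| := fun z hz =>
    homNorm_eq_sum F hF fun τ hτ h => Finset.mem_filter.2 ⟨by simpa using hz τ h, hτ⟩
  rw [key x fun _ => Or.inl, key y fun _ => Or.inr, key (x + y) fun τ hτ => ?_,
    ← Finset.sum_add_distrib]
  · exact Finset.sum_le_sum fun τ _ => abs_add_le _ _
  · by_contra! hcon
    exact hτ (by simp [hcon])

lemma homNorm_smul (β c : ℝ) (x : Lin d) : homNorm α β (c • x) = |c| * homNorm α β x := by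
  classical
  rw [homNorm_eq_sum (x.coeff.support.filter fun τ => τ.hom α = β)
    (fun τ hτ => (Finset.mem_filter.1 hτ).2) fun τ hτ h => Finset.mem_filter.2
      ⟨Finsupp.mem_support_iff.2 fun h0 => h (by simp [h0]), hτ⟩, homNorm, Finset.mul_sum]
  exact Finset.sum_congr rfl fun τ _ => by simp [abs_mul]

lemma homNorm_eq_zero {β : ℝ} {x : Lin d} (h : ∀ τ, τ.hom α = β → x.coeff τ = 0) :
    homNorm α β x = 0 := by
  rw [homNorm_eq_sum ∅ (by simp) fun τ hτ h' => absurd (h τ hτ) h', Finset.sum_empty]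

lemma mem_homPart {β : ℝ} {x : Lin d} :
    x ∈ homPart d α β ↔ ∀ τ, x.coeff τ ≠ 0 → τ.hom α = β :=
  mem_spanOf

end Norm

-- Homogeneous components and the axioms of a regularity structure

section Structure

variable {α : ℝ} {e : Equation} {γ : ℝ}

lemma mem_modelSpace {x : Lin d} :
    x ∈ modelSpace d α e γ ↔ ∀ τ, x.coeff τ ≠ 0 → τ ∈ basisSet d α e γ :=
  mem_spanOf

lemma basis_mem_modelSpace {τ : Formal d} (h : τ ∈ basisSet d α e γ) :
    basis τ ∈ modelSpace d α e γ :=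
  basis_mem_spanOf h

lemma modelSpace_le : modelSpace d α e γ ≤ spanOf (UV d e) := spanOf_mono fun _ h => h.1

/-- The homogeneous components of the model space. -/
def compSub (d : ℕ) (α : ℝ) (e : Equation) (γ β : ℝ) : Submodule ℝ (modelSpace d α e γ) :=
  (homPart d α β).comap (modelSpace d α e γ).subtype

lemma mem_compSub {β : ℝ} {x : modelSpace d α e γ} :
    x ∈ compSub d α e γ β ↔ ∀ τ, (x : Lin d).coeff τ ≠ 0 → τ.hom α = β :=
  mem_homPart

lemma mem_iSup_compSub {B : Set ℝ} {x : modelSpace d α e γ}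
    (h : ∀ τ, (x : Lin d).coeff τ ≠ 0 → τ.hom α ∈ B) : x ∈ ⨆ β ∈ B, compSub d α e γ β := by
  have hx := mem_modelSpace.1 x.2
  have h1 : x = ∑ τ ∈ (x : Lin d).coeff.support.attach, (x : Lin d).coeff τ •
      (⟨basis τ, basis_mem_modelSpace (hx τ (Finsupp.mem_support_iff.1 τ.2))⟩ :
        modelSpace d α e γ) := by
    apply Subtype.ext
    simp only [AddSubmonoidClass.coe_finsetSum, Submodule.coe_smul]
    rw [Finset.sum_attach _ (fun τ => (x : Lin d).coeff τ • basis τ)]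
    exact eq_sum_basis _
  rw [h1]
  refine Submodule.sum_mem _ fun τ _ => Submodule.smul_mem _ _ ?_
  refine Submodule.mem_iSup_of_mem ((τ : Formal d).hom α) (Submodule.mem_iSup_of_mem
    (h τ (Finsupp.mem_support_iff.1 τ.2)) ?_)
  exact basis_mem_spanOf (S := {σ : Formal d | σ.hom α = (τ : Formal d).hom α}) rfl

lemma compSub_internal : open Classical in
    DirectSum.IsInternal fun β : Formal.hom α '' basisSet d α e γ => compSub d α e γ β := by
  classical
  refine DirectSum.isInternal_submodule_of_iSupIndep_of_iSup_eq_top ?_ ?_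
  · rw [iSupIndep_def]
    intro β
    rw [Submodule.disjoint_def]
    intro x hx hx'
    have h1 : ⨆ j, ⨆ (_ : j ≠ β), compSub d α e γ j ≤
        (spanOf {σ : Formal d | σ.hom α ≠ β}).comap (modelSpace d α e γ).subtype := by
      refine iSup₂_le fun j hj y hy => ?_
      refine mem_spanOf.2 fun τ hτ => ?_
      rw [Set.mem_ofPred_eq, mem_compSub.1 hy τ hτ]
      exact fun h => hj (Subtype.ext h)
    have h2 := mem_spanOf.1 (h1 hx')
    apply Subtype.ext
    apply MonoidAlgebra.ext
    ext τ
    by_contra hne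
    exact h2 τ hne (mem_compSub.1 hx τ hne)
  · rw [eq_top_iff]
    intro x _
    have h1 := mem_iSup_compSub (x := x) (B := Formal.hom α '' basisSet d α e γ)
      fun τ hτ => ⟨τ, mem_modelSpace.1 x.2 τ hτ, rfl⟩
    rwa [iSup_subtype'] at h1

/-- Finitely many expressions span T, so the limit can be taken coordinatewise over those of
homogeneity β. -/
lemma compSub_complete (hfin : (basisSet d α e γ).Finite) (β : ℝ)
    (u : ℕ → modelSpace d α e γ)
    (hC : ∀ ε > 0, ∃ N, ∀ m ≥ N, ∀ n ≥ N, homNorm α β (u m - u n : Lin d) < ε) :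
    ∃ x ∈ compSub d α e γ β,
      Filter.Tendsto (fun n => homNorm α β (u n - x : Lin d)) Filter.atTop (nhds 0) := by
  classical
  set F := hfin.toFinset.filter fun τ => τ.hom α = β
  have hF : ∀ τ, τ ∈ F ↔ τ ∈ basisSet d α e γ ∧ τ.hom α = β := by simp [F]
  have h1 : ∀ τ ∈ F, ∃ l, Filter.Tendsto (fun n => (u n : Lin d).coeff τ)
      Filter.atTop (nhds l) := by
    intro τ hτ
    refine cauchySeq_tendsto_of_complete (Metric.cauchySeq_iff.2 fun ε hε => ?_)
    obtain ⟨N, hN⟩ := hC ε hε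
    refine ⟨N, fun m hm n hn => lt_of_le_of_lt ?_ (hN m hm n hn)⟩
    rw [Real.dist_eq, ← ((hF τ).1 hτ).2]
    exact abs_coeff_le_homNorm (u m - u n : Lin d) τ
  choose! l hl using h1
  have hx : ∑ τ ∈ F, l τ • basis τ ∈ spanOf (F : Set (Formal d)) :=
    Submodule.sum_mem _ fun τ hτ => Submodule.smul_mem _ _ (basis_mem_spanOf hτ)
  have hcoeff : ∀ τ ∈ F, (∑ τ ∈ F, l τ • basis τ : Lin d).coeff τ = l τ := by
    intro τ hτ
    simp only [MonoidAlgebra.coeff_sum, MonoidAlgebra.coeff_smul, Finsupp.finsetSum_apply,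
      Finsupp.smul_apply, coeff_basis, smul_eq_mul, mul_ite, mul_one, mul_zero]
    rw [Finset.sum_ite_eq', if_pos hτ]
  have hx1 := mem_spanOf.1 hx
  refine ⟨⟨_, mem_modelSpace.2 fun τ hτ => ((hF τ).1 (hx1 τ hτ)).1⟩,
    mem_compSub.2 fun τ hτ => ((hF τ).1 (hx1 τ hτ)).2, ?_⟩
  have h2 : ∀ n, homNorm α β (u n - ∑ τ ∈ F, l τ • basis τ : Lin d) =
      ∑ τ ∈ F, |(u n : Lin d).coeff τ - l τ| := by
    intro n
    rw [homNorm_eq_sum F (fun τ hτ => ((hF τ).1 hτ).2)]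
    · refine Finset.sum_congr rfl fun τ hτ => ?_
      rw [MonoidAlgebra.coeff_sub, Finsupp.sub_apply, hcoeff τ hτ]
    · intro τ hτ hne
      by_contra hτF
      refine hne ?_
      rw [MonoidAlgebra.coeff_sub, Finsupp.sub_apply]
      have h3 : (u n : Lin d).coeff τ = 0 := by
        by_contra h
        exact hτF ((hF τ).2 ⟨mem_modelSpace.1 (u n).2 τ h, hτ⟩)
      have h4 : (∑ τ ∈ F, l τ • basis τ : Lin d).coeff τ = 0 := by
        by_contra h
        exact hτF (hx1 τ h)
      rw [h3, h4, sub_zero]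
  simp only [h2]
  have h3 := tendsto_finsetSum F fun τ hτ => ((hl τ hτ).sub_const (l τ)).abs
  simpa using h3

/-- Linear maps into seminormed objects are bounded on the homogeneous components. -/
lemma exists_bound (hfin : (basisSet d α e γ).Finite) (β : ℝ) (N : Lin d → ℝ)
    (hadd : ∀ x y, N (x + y) ≤ N x + N y) (hsmul : ∀ (c : ℝ) x, N (c • x) = |c| * N x) :
    ∃ C, ∀ x : modelSpace d α e γ, x ∈ compSub d α e γ β → N x ≤ C * homNorm α β (x : Lin d) := by
  classical
  have hN0 : N 0 = 0 := by simpa using hsmul 0 0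
  have hNn : ∀ x, 0 ≤ N x := by
    intro x
    have h1 := hadd x ((-1 : ℝ) • x)
    rw [hsmul, neg_one_smul, add_neg_cancel, hN0, abs_neg, abs_one, one_mul] at h1
    linarith
  have hsum : ∀ (s : Finset (Formal d)) (x : Formal d → Lin d),
      N (∑ i ∈ s, x i) ≤ ∑ i ∈ s, N (x i) := by
    intro s x
    induction s using Finset.induction_on with
    | empty => simp [hN0]
    | insert a s ha ih =>
      rw [Finset.sum_insert ha, Finset.sum_insert ha]
      exact (hadd _ _).trans (by gcongr)
  refine ⟨∑ τ ∈ hfin.toFinset, N (basis τ), fun x hx => ?_⟩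
  rw [Finset.sum_mul]
  conv_lhs => rw [eq_sum_basis (x : Lin d)]
  refine (hsum _ _).trans ?_
  have hsub : (x : Lin d).coeff.support ⊆ hfin.toFinset := fun τ hτ =>
    hfin.mem_toFinset.2 (mem_modelSpace.1 x.2 τ (Finsupp.mem_support_iff.1 hτ))
  refine (Finset.sum_le_sum fun τ hτ => ?_).trans
    (Finset.sum_le_sum_of_subset_of_nonneg hsub fun τ _ _ =>
      mul_nonneg (hNn _) (homNorm_nonneg _ _))
  rw [hsmul, mul_comm]
  refine mul_le_mul_of_nonneg_left ?_ (hNn _)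
  have h1 := mem_compSub.1 hx τ (Finsupp.mem_support_iff.1 hτ)
  rw [← h1]
  exact abs_coeff_le_homNorm _ _

/-- The restriction of `Γ̂_f` to the model space. -/
def gammaRes (γ : ℝ) (f : TPlus d α e →ₐ[ℝ] ℝ) : modelSpace d α e γ →ₗ[ℝ] modelSpace d α e γ :=
  (gammaHat f).restrict fun _ hx => gammaHat_modelSpace γ hx

lemma one_mem_basisSet (hγ : 0 < γ) : (1 : Formal d) ∈ basisSet d α e γ := by
  refine ⟨Or.inl ?_, by simpa⟩
  have := InU.poly (d := d) e 0
  rwa [mpow_zero] at this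

lemma compSub_definite {β : ℝ} {x : modelSpace d α e γ} (hx : x ∈ compSub d α e γ β)
    (h : homNorm α β (x : Lin d) = 0) : x = 0 := by
  apply Subtype.ext
  apply MonoidAlgebra.ext
  ext τ
  by_contra hne
  have h1 := abs_coeff_le_homNorm (α := α) (x : Lin d) τ
  rw [mem_compSub.1 hx τ hne, h] at h1
  exact hne (abs_eq_zero.1 (le_antisymm h1 (abs_nonneg _)))

lemma compSub_zero (hγ : 0 < γ) (hzero : ∀ τ ∈ basisSet d α e γ, τ.hom α = 0 → τ = 1) :
    compSub d α e γ 0 = Submodule.span ℝ {⟨1, one_mem_modelSpace d α e hγ⟩} := by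
  ext x
  rw [Submodule.mem_span_singleton]
  constructor
  · intro hx
    have hx' : (x : Lin d) ∈ spanOf {(1 : Formal d)} := mem_spanOf.2 fun τ hτ =>
      hzero τ (mem_modelSpace.1 x.2 τ hτ) (mem_compSub.1 hx τ hτ)
    obtain ⟨c, hc⟩ := Submodule.mem_span_singleton.1
      (by simpa [spanOf] using hx' : (x : Lin d) ∈ Submodule.span ℝ {1})
    exact ⟨c, Subtype.ext hc⟩
  · rintro ⟨c, rfl⟩
    refine Submodule.smul_mem _ _ ?_
    exact basis_mem_spanOf (S := {σ : Formal d | σ.hom α = 0}) (Formal.hom_one α)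

lemma triangular_aux {f : TPlus d α e →ₐ[ℝ] ℝ} {β : ℝ} {x y : modelSpace d α e γ}
    (hx : x ∈ compSub d α e γ β) (hy : (y : Lin d) = gammaHat f (x : Lin d)) :
    y - x ∈ ⨆ β' ∈ {β' ∈ Formal.hom α '' basisSet d α e γ | β' < β}, compSub d α e γ β' := by
  have h1 : ((y - x : modelSpace d α e γ) : Lin d) ∈ spanOf {σ ∈ UV d e | σ.hom α < β} := by
    have hx' : (x : Lin d) ∈ spanOf {σ : Formal d | σ ∈ UV d e ∧ σ.hom α = β} :=
      mem_spanOf.2 fun τ hτ => ⟨(mem_modelSpace.1 x.2 τ hτ).1, mem_compSub.1 hx τ hτ⟩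
    rw [Submodule.coe_sub, hy]
    refine map_mem_spanOf (f := gammaHat f - LinearMap.id) (fun τ hτ => ?_) hx'
    have := tri_UV (f := f) hτ.1
    rw [Tri, hτ.2] at this
    exact this
  refine mem_iSup_compSub fun τ hτ => ?_
  exact ⟨⟨τ, mem_modelSpace.1 (y - x).2 τ hτ, rfl⟩, (mem_spanOf.1 h1 τ hτ).2⟩

/-- T is finite-dimensional, which yields completeness, continuity and the conditions on A;
`counit`, `charMul` and `charInv` supply the group axioms. -/
theorem isRegularityStructure (hα : α < 0) (hcrit : e.threshold < α) (hγ : 0 < γ)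
    (hzero : ∀ τ ∈ basisSet d α e γ, τ.hom α = 0 → τ = 1) :
    IsRegularityStructure (regData d α e hγ) := by
  have hfin : (basisSet d α e γ).Finite := finite_basisSet hα hcrit γ
  have hA : (regData d α e hγ).A.Finite := hfin.image _
  refine
    { zero_mem := ⟨1, one_mem_basisSet hγ, rfl⟩
      bddBelow := hA.bddBelow
      locallyFinite := fun a b => hA.inter_of_left _
      grading := compSub_internal
      nrm_add := fun β _ x y => homNorm_add β _ _
      nrm_smul := fun β _ c x => homNorm_smul β c _
      nrm_other := fun β _ β' _ hne x hx => homNorm_eq_zero fun τ hτ => ?_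
      nrm_definite := fun β _ x hx h => ?_
      nrm_complete := fun β _ u _ hC => compSub_complete hfin β u hC
      one_ne_zero := ?_
      comp_zero := ?_
      id_mem := ⟨counit d α e, fun x => (gammaHat_counit hα hcrit (modelSpace_le x.2)).symm⟩
      comp_mem := ?_
      inv_mem := ?_
      continuous := ?_
      triangular := ?_
      map_one := ?_ }
  · by_contra hne'
    exact hne (hτ.symm.trans (mem_compSub.1 hx τ hne'))
  · exact compSub_definite hx h
  · intro h
    have h1 : (1 : Lin d) = 0 := congr_arg Subtype.val h
    exact one_ne_zero h1
  · exact compSub_zero hγ hzero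
  · rintro g ⟨f, hf⟩ h ⟨f', hf'⟩
    refine ⟨charMul f f', fun x => ?_⟩
    rw [gammaHat_charMul hα hcrit f f' (modelSpace_le x.2), ← hf' x, ← hf]
    rfl
  · rintro g ⟨f, hf⟩
    refine ⟨gammaRes γ (charInv f), ⟨charInv f, fun x => rfl⟩, ?_, ?_⟩
    · refine LinearMap.ext fun x => Subtype.ext ?_
      refine (hf _).trans ?_
      exact gammaHat_gammaHat_charInv hα hcrit f (modelSpace_le x.2)
    · refine LinearMap.ext fun x => Subtype.ext ?_
      refine (congr_arg (gammaHat (charInv f)) (hf x)).trans ?_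
      exact gammaHat_charInv_gammaHat hα hcrit f (modelSpace_le x.2)
  · rintro g ⟨f, hf⟩ β _ β' _
    obtain ⟨C, hC⟩ := exists_bound hfin β (fun x => homNorm α β' (gammaHat f x))
      (fun x y => by simp only [map_add]; exact homNorm_add _ _ _)
      (fun c x => by simp only [map_smul]; exact homNorm_smul _ _ _)
    refine ⟨C, fun x hx => ?_⟩
    exact (congr_arg (homNorm α β') (hf x)).trans_le (hC x hx)
  · rintro g ⟨f, hf⟩ β _ x hx
    exact triangular_aux hx (hf x)
  · rintro g ⟨f, hf⟩
    apply Subtype.ext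
    exact (hf _).trans (gammaHat_one f)

end Structure

/-! ### The parabolic norm -/

section PNorm

lemma pnorm_nonneg (v : Pt d) : 0 ≤ pnorm v := add_nonneg (Real.sqrt_nonneg _) (Real.sqrt_nonneg _)

lemma continuous_pnorm : Continuous (pnorm : Pt d → ℝ) := by
  unfold pnorm
  fun_prop

/-- A parabolic ball lies in the box with half-sides l^{wt i}; the anisotropic estimates below all
go through this coordinatewise form. -/
lemma abs_le_pow_wt {v : Pt d} {l : ℝ} (h : pnorm v ≤ l) (i : Fin (d + 1)) :
    |v i| ≤ l ^ wt i := by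
  have h1 := Real.sqrt_nonneg |v 0|
  have h2 := Real.sqrt_nonneg (∑ i : Fin d, v i.succ ^ 2)
  have hl : 0 ≤ l := (pnorm_nonneg v).trans h
  unfold pnorm at h
  refine Fin.cases ?_ (fun j => ?_) i
  · have h3 : √|v 0| ≤ l := by linarith
    rw [Real.sqrt_le_left hl] at h3
    simpa [wt] using h3
  · have h3 : √(∑ i : Fin d, v i.succ ^ 2) ≤ l := by linarith
    rw [wt_succ, pow_one]
    refine le_trans ?_ h3
    rw [← Real.sqrt_sq_eq_abs]
    exact Real.sqrt_le_sqrt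
      (Finset.single_le_sum (f := fun i : Fin d => v i.succ ^ 2) (fun _ _ => sq_nonneg _)
        (Finset.mem_univ j))

lemma pnorm_smul_le {t : ℝ} (h0 : 0 ≤ t) (h1 : t ≤ 1) (v : Pt d) : pnorm (t • v) ≤ pnorm v := by
  unfold pnorm
  refine add_le_add (Real.sqrt_le_sqrt ?_) (Real.sqrt_le_sqrt (Finset.sum_le_sum fun i _ => ?_))
  · rw [Pi.smul_apply, smul_eq_mul, abs_mul, abs_of_nonneg h0]
    exact mul_le_of_le_one_left (abs_nonneg _) h1
  · rw [Pi.smul_apply, smul_eq_mul, mul_pow]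
    exact mul_le_of_le_one_left (sq_nonneg _) (pow_le_one₀ h0 h1)

lemma norm_le_of_pnorm_le {v : Pt d} {l : ℝ} (h : pnorm v ≤ l) : ‖v‖ ≤ l + l ^ 2 := by
  have hl : 0 ≤ l := (pnorm_nonneg v).trans h
  rw [pi_norm_le_iff_of_nonneg (by positivity)]
  intro i
  rw [Real.norm_eq_abs]
  refine (abs_le_pow_wt h i).trans ?_
  unfold wt
  split_ifs
  · linarith
  · rw [pow_one]; nlinarith [sq_nonneg l]

lemma pnorm_sub_comm (z w : Pt d) : pnorm (z - w) = pnorm (w - z) := by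
  unfold pnorm
  simp only [Pi.sub_apply]
  rw [abs_sub_comm]
  congr 2
  exact Finset.sum_congr rfl fun i _ => by ring

lemma pnorm_pos {v : Pt d} (h : v ≠ 0) : 0 < pnorm v := by
  refine lt_of_le_of_ne (pnorm_nonneg v) fun h0 => h ?_
  funext i
  have := abs_le_pow_wt h0.symm.le i
  rw [zero_pow (by have := wt_pos i; omega)] at this
  exact abs_eq_zero.1 (le_antisymm this (abs_nonneg _))

end PNorm

/-! ### Partial derivatives -/

section Derivatives

lemma mi_induction {P : MI d → Prop} (h0 : P 0) (hs : ∀ k i, P k → P (k + Pi.single i 1))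
    (k : MI d) : P k := by
  induction hn : sdeg k using Nat.strong_induction_on generalizing k with
  | _ n ih =>
    by_cases hk : k = 0
    · rwa [hk]
    · obtain ⟨i, hi⟩ := Function.ne_iff.1 hk
      rw [← sub_single_add hi]
      refine hs _ i (ih _ ?_ _ rfl)
      have h1 := congr_arg sdeg (sub_single_add hi)
      rw [sdeg_add, sdeg_single, hn] at h1
      have := wt_pos i
      omega

variable {g h : Pt d → ℝ}

lemma contDiff_pd (hg : ContDiff ℝ ∞ g) (i : Fin (d + 1)) : ContDiff ℝ ∞ (pd i g) :=
  (hg.fderiv_right (m := ∞) (by simp)).clm_apply contDiff_const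

lemma smooth_diff (hg : ContDiff ℝ ∞ g) : Differentiable ℝ g := hg.differentiable (by simp)

lemma contDiff_smul (c : ℝ) (hg : ContDiff ℝ ∞ g) : ContDiff ℝ ∞ (c • g) :=
  contDiff_const.smul hg

lemma pd_comm (hg : ContDiff ℝ ∞ g) (i j : Fin (d + 1)) : pd i (pd j g) = pd j (pd i g) := by
  have h1 : ∀ i j : Fin (d + 1), ∀ z, pd i (pd j g) z =
      fderiv ℝ (fderiv ℝ g) z (Pi.single i 1) (Pi.single j 1) := by
    intro i j z
    have h2 : DifferentiableAt ℝ (fderiv ℝ g) z :=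
      ((hg.fderiv_right (m := ∞) (by simp)).differentiable (by simp)) z
    change fderiv ℝ (fun z => fderiv ℝ g z (Pi.single j 1)) z (Pi.single i 1) = _
    rw [fderiv_clm_apply h2 (differentiableAt_const _)]
    simp
  funext z
  rw [h1, h1]
  exact (hg.contDiffAt.isSymmSndFDerivAt (by simp; exact WithTop.coe_le_coe.2 le_top)).eq _ _

lemma pd_add (hg : ContDiff ℝ ∞ g) (hh : ContDiff ℝ ∞ h) (i : Fin (d + 1)) :
    pd i (g + h) = pd i g + pd i h := by
  funext z
  simp [pd, fderiv_add (smooth_diff hg z) (smooth_diff hh z)]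

lemma pd_smul (c : ℝ) (hg : ContDiff ℝ ∞ g) (i : Fin (d + 1)) :
    pd i (c • g) = c • pd i g := by
  funext z
  simp [pd, fderiv_const_smul (smooth_diff hg z)]

lemma pd_sum {ι : Type*} (s : Finset ι) (G : ι → Pt d → ℝ) (hG : ∀ j, ContDiff ℝ ∞ (G j))
    (i : Fin (d + 1)) : pd i (∑ j ∈ s, G j) = ∑ j ∈ s, pd i (G j) := by
  funext z
  simp only [pd, Finset.sum_apply]
  rw [fderiv_sum fun j _ => smooth_diff (hG j) z]
  simp

lemma iterate_pd_contDiff (hg : ContDiff ℝ ∞ g) (i : Fin (d + 1)) (n : ℕ) :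
    ContDiff ℝ ∞ ((pd i)^[n] g) := by
  induction n with
  | zero => exact hg
  | succ n ih => rw [Function.iterate_succ_apply']; exact contDiff_pd ih i

lemma iterate_pd_comm (hg : ContDiff ℝ ∞ g) (i j : Fin (d + 1)) (n : ℕ) :
    (pd i)^[n] (pd j g) = pd j ((pd i)^[n] g) := by
  induction n with
  | zero => rfl
  | succ n ih =>
    rw [Function.iterate_succ_apply', ih, pd_comm (iterate_pd_contDiff hg i n),
      Function.iterate_succ_apply']

/-- The iterated derivative along a list of coordinates. -/
def DkList (l : List (Fin (d + 1))) (k : MI d) (g : Pt d → ℝ) : Pt d → ℝ :=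
  l.foldr (fun i h => (pd i)^[k i] h) g

lemma DkList_contDiff (hg : ContDiff ℝ ∞ g) (l : List (Fin (d + 1))) (k : MI d) :
    ContDiff ℝ ∞ (DkList l k g) := by
  induction l with
  | nil => exact hg
  | cons i l ih => exact iterate_pd_contDiff ih i (k i)

lemma DkList_pd (hg : ContDiff ℝ ∞ g) (l : List (Fin (d + 1))) (k : MI d) (j : Fin (d + 1)) :
    DkList l k (pd j g) = pd j (DkList l k g) := by
  induction l with
  | nil => rfl
  | cons i l ih =>
    change (pd i)^[k i] (DkList l k (pd j g)) = pd j ((pd i)^[k i] (DkList l k g))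
    rw [ih, iterate_pd_comm (DkList_contDiff hg l k)]

lemma DkList_congr {l : List (Fin (d + 1))} {k m : MI d} (h : ∀ i ∈ l, k i = m i) :
    DkList l k g = DkList l m g := by
  induction l with
  | nil => rfl
  | cons i l ih =>
    change (pd i)^[k i] (DkList l k g) = (pd i)^[m i] (DkList l m g)
    rw [ih fun j hj => h j (List.mem_cons_of_mem _ hj), h i List.mem_cons_self]

/-- `Dk` differentiates in a fixed order. The extra derivative enters at the only occurrence of j
(hence `Nodup`) and is commuted to the outside. -/
lemma DkList_add_single (hg : ContDiff ℝ ∞ g) {l : List (Fin (d + 1))} (hl : l.Nodup) (k : MI d)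
    {j : Fin (d + 1)} (hj : j ∈ l) :
    DkList l (k + Pi.single j 1) g = pd j (DkList l k g) := by
  induction l with
  | nil => simp at hj
  | cons i l ih =>
    change (pd i)^[(k + Pi.single j 1 : MI d) i] (DkList l (k + Pi.single j 1) g) =
      pd j ((pd i)^[k i] (DkList l k g))
    rw [List.nodup_cons] at hl
    by_cases hij : i = j
    · subst hij
      rw [DkList_congr (m := k) fun a ha => by
        have : a ≠ i := fun h => hl.1 (h ▸ ha)
        simp [this]]
      simp only [Pi.add_apply, Pi.single_eq_same, Function.iterate_succ_apply']
    · have hj' : j ∈ l := (List.mem_cons.1 hj).resolve_left fun h => hij h.symm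
      rw [ih hl.2 hj', iterate_pd_comm (DkList_contDiff hg l k)]
      simp [hij]

lemma Dk_contDiff (hg : ContDiff ℝ ∞ g) (k : MI d) : ContDiff ℝ ∞ (Dk k g) :=
  DkList_contDiff hg _ k

lemma Dk_pd (hg : ContDiff ℝ ∞ g) (k : MI d) (j : Fin (d + 1)) :
    Dk k (pd j g) = pd j (Dk k g) :=
  DkList_pd hg _ k j

lemma Dk_add_single (hg : ContDiff ℝ ∞ g) (k : MI d) (j : Fin (d + 1)) :
    Dk (k + Pi.single j 1) g = pd j (Dk k g) :=
  DkList_add_single hg (List.nodup_finRange _) k (List.mem_finRange j)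

@[simp] lemma Dk_zero (g : Pt d → ℝ) : Dk 0 g = g := by
  have : ∀ l : List (Fin (d + 1)), DkList l 0 g = g := by
    intro l
    induction l with
    | nil => rfl
    | cons i l ih => exact ih
  exact this _

lemma Dk_Dk (hg : ContDiff ℝ ∞ g) (k m : MI d) : Dk m (Dk k g) = Dk (k + m) g := by
  induction m using mi_induction with
  | h0 => simp
  | hs m i ih =>
    rw [Dk_add_single (Dk_contDiff hg k), ih, ← add_assoc, Dk_add_single hg]

lemma Dk_sum_smul {ι : Type*} (s : Finset ι) (c : ι → ℝ) (G : ι → Pt d → ℝ)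
    (hG : ∀ j, ContDiff ℝ ∞ (G j)) (k : MI d) :
    Dk k (∑ j ∈ s, c j • G j) = ∑ j ∈ s, c j • Dk k (G j) := by
  have h1 : ContDiff ℝ ∞ (∑ j ∈ s, c j • G j) := by
    have := ContDiff.sum (s := s) (n := ∞) (𝕜 := ℝ) fun j _ => (hG j).const_smul (c j)
    convert this using 1
    ext; simp
  induction k using mi_induction with
  | h0 => simp
  | hs k i ih =>
    rw [Dk_add_single h1, ih, pd_sum _ _ fun j => contDiff_smul (c j) (Dk_contDiff (hG j) k)]
    refine Finset.sum_congr rfl fun j _ => ?_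
    rw [pd_smul _ (Dk_contDiff (hG j) k), Dk_add_single (hG j)]

lemma fderiv_apply_eq_sum (g : Pt d → ℝ) (z v : Pt d) :
    fderiv ℝ g z v = ∑ i, v i * pd i g z := by
  conv_lhs => rw [← Finset.univ_sum_single v]
  rw [map_sum]
  refine Finset.sum_congr rfl fun i _ => ?_
  rw [pd, ← smul_eq_mul, ← map_smul]
  congr 1
  rw [← Pi.single_smul, smul_eq_mul, mul_one]

lemma dpow_contDiff {E : Type*} [NormedAddCommGroup E] [NormedSpace ℝ E]
    {x : E → Pt d} (hx : ContDiff ℝ ∞ x) (k : MI d) : ContDiff ℝ ∞ fun w => dpow (x w) k := by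
  unfold dpow mpow
  have h1 : ContDiff ℝ ∞ fun w => ∏ i, x w i ^ k i :=
    contDiff_prod fun i _ => ContDiff.pow (contDiff_pi.1 hx i) _
  exact h1.const_smul _

lemma pd_dpow (z : Pt d) (k : MI d) (i : Fin (d + 1)) (w : Pt d) :
    pd i (fun w => dpow (w - z) k) w = if k i = 0 then 0 else dpow (w - z) (k - Pi.single i 1) := by
  have h1 : ContDiff ℝ ∞ fun w : Pt d => dpow (w - z) k := dpow_contDiff (by fun_prop) k
  have hsplit : ∀ (x : Pt d) (m : MI d), dpow x m = ((m i).factorial : ℝ)⁻¹ * x i ^ m i *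
      ∏ j ∈ Finset.univ.erase i, (((m j).factorial : ℝ)⁻¹ * x j ^ m j) := by
    intro x m
    rw [dpow_eq_prod, ← Finset.mul_prod_erase _ _ (Finset.mem_univ i)]
    rfl
  -- Along the direction i only one factor of the product varies, so a one-variable derivative is
  -- enough.
  rw [pd, ← (smooth_diff h1 w).lineDeriv_eq_fderiv, lineDeriv]
  have h2 : (fun t : ℝ => dpow (w + t • Pi.single i 1 - z) k) = fun t =>
      ((k i).factorial : ℝ)⁻¹ * (t + (w - z) i) ^ k i *
        ∏ j ∈ Finset.univ.erase i, (((k j).factorial : ℝ)⁻¹ * (w - z) j ^ k j) := by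
    funext t
    rw [hsplit]
    congr 1
    · congr 2
      simp; ring
    · refine Finset.prod_congr rfl fun j hj => ?_
      simp [(Finset.mem_erase.1 hj).1]
  rw [h2]
  have h3 : HasDerivAt (fun t : ℝ => (t + (w - z) i) ^ k i)
      ((k i : ℝ) * (0 + (w - z) i) ^ (k i - 1) * 1) 0 :=
    ((hasDerivAt_id (0 : ℝ)).add_const _).pow (k i)
  rw [((h3.const_mul _).mul_const _).deriv]
  split_ifs with hk
  · simp [hk]
  · rw [hsplit]
    have h4 : ∏ j ∈ Finset.univ.erase i, (((k j).factorial : ℝ)⁻¹ * (w - z) j ^ k j) =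
        ∏ j ∈ Finset.univ.erase i, ((((k - Pi.single i 1 : MI d) j).factorial : ℝ)⁻¹ *
          (w - z) j ^ (k - Pi.single i 1 : MI d) j) := by
      refine Finset.prod_congr rfl fun j hj => ?_
      simp [(Finset.mem_erase.1 hj).1]
    rw [h4]
    congr 1
    obtain ⟨n, hn⟩ := Nat.exists_eq_succ_of_ne_zero hk
    simp only [Pi.sub_apply, Pi.single_eq_same, hn, Nat.succ_sub_one, zero_add, mul_one,
      Nat.factorial_succ]
    push_cast
    have h5 : ((n : ℝ) + 1) ≠ 0 := by positivity
    have h6 : (n.factorial : ℝ) ≠ 0 := by positivity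
    field_simp

end Derivatives

/-! ### Parabolic Taylor expansion -/

section Taylor

/-- The remainder of the parabolic Taylor expansion of `g` at `z` up to degree less than `r`. -/
def taylorRem (r : ℝ) (g : Pt d → ℝ) (z w : Pt d) : ℝ :=
  g w - ∑ k ∈ below d r, dpow (w - z) k * Dk k g z

lemma taylorRem_contDiff {g : Pt d → ℝ} (hg : ContDiff ℝ ∞ g) (r : ℝ) (z : Pt d) :
    ContDiff ℝ ∞ (taylorRem r g z) := by
  unfold taylorRem
  exact hg.sub (ContDiff.sum fun k _ => (dpow_contDiff (by fun_prop) k).mul contDiff_const)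

lemma taylorRem_self {r : ℝ} (hr : 0 < r) (g : Pt d → ℝ) (z : Pt d) : taylorRem r g z z = 0 := by
  rw [taylorRem, Finset.sum_eq_single 0, dpow_zero, Dk_zero, one_mul, sub_self]
  · intro k _ hk
    rw [sub_self, dpow_eq_zero_of_zero hk, zero_mul]
  · intro h
    exact absurd (mem_below.2 (by simpa using hr)) h

lemma taylorRem_nonpos {r : ℝ} (hr : r ≤ 0) (g : Pt d → ℝ) (z w : Pt d) :
    taylorRem r g z w = g w := by
  rw [taylorRem, Finset.sum_eq_zero, sub_zero]
  intro k hk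
  have := mem_below.1 hk
  have h0 : (0 : ℝ) ≤ sdeg k := by positivity
  linarith

/-- Differentiation shifts the Taylor polynomial by one multiindex, at the cost of the weight of the
coordinate. This drives the induction in `taylorRem_bound` and also treats 𝒟_i I(τ). -/
lemma pd_taylorRem {g : Pt d → ℝ} (hg : ContDiff ℝ ∞ g) (r : ℝ) (z : Pt d) (i : Fin (d + 1)) :
    pd i (taylorRem r g z) = taylorRem (r - wt i) (pd i g) z := by
  have hd : ∀ k, ContDiff ℝ ∞ fun w : Pt d => dpow (w - z) k := fun k =>
    dpow_contDiff (by fun_prop) k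
  have h0 : taylorRem r g z = g + (-1 : ℝ) • ∑ k ∈ below d r,
      (Dk k g z) • fun w : Pt d => dpow (w - z) k := by
    funext w
    simp [taylorRem, sub_eq_add_neg, mul_comm]
  have hs : ContDiff ℝ ∞ (∑ k ∈ below d r, (Dk k g z) • fun w : Pt d => dpow (w - z) k) := by
    have := ContDiff.sum (s := below d r) (n := ∞) (𝕜 := ℝ)
      fun k _ => (hd k).const_smul (Dk k g z)
    convert this using 1
    ext; simp
  rw [h0, pd_add hg (contDiff_smul _ hs), pd_smul _ hs,
    pd_sum _ _ fun k => contDiff_smul (Dk k g z) (hd k)]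
  funext w
  simp only [pd_smul _ (hd _), Pi.add_apply, Pi.smul_apply, Finset.sum_apply, smul_eq_mul,
    pd_dpow, taylorRem, neg_one_mul, ← sub_eq_add_neg]
  congr 1
  refine (Finset.sum_of_injOn (· + Pi.single i 1) ((add_left_injective _).injOn) ?_ ?_ ?_).symm
  · intro k hk
    have := mem_below.1 (Finset.mem_coe.1 hk)
    refine Finset.mem_coe.2 (mem_below.2 ?_)
    rw [sdeg_add, sdeg_single]; push_cast; linarith
  · intro k hk hk'
    by_cases hki : k i = 0
    · simp [hki]
    · refine absurd ⟨k - Pi.single i 1, ?_, sub_single_add hki⟩ hk'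
      have h1 := congr_arg sdeg (sub_single_add hki)
      rw [sdeg_add, sdeg_single] at h1
      have h2 : (sdeg (k - Pi.single i 1) : ℝ) + wt i = sdeg k := by exact_mod_cast h1
      refine Finset.mem_coe.2 (mem_below.2 ?_)
      have := mem_below.1 hk
      linarith
  · intro k _
    simp only [add_tsub_cancel_right, Pi.add_apply, Pi.single_eq_same, Nat.add_eq_zero_iff,
      one_ne_zero, and_false, if_false]
    rw [Dk_add_single hg, Dk_pd hg, mul_comm]

/-- Families of functions that are jointly smooth in the parameter and the variable. -/
def JointlySmooth (G : Pt d → Pt d → ℝ) : Prop :=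
  ContDiff ℝ ∞ fun p : Pt d × Pt d => G p.1 p.2

variable {G H : Pt d → Pt d → ℝ}

lemma JointlySmooth.section (hG : JointlySmooth G) (z : Pt d) : ContDiff ℝ ∞ (G z) :=
  ContDiff.comp (g := fun p : Pt d × Pt d => G p.1 p.2) hG (contDiff_prodMk_right z)

lemma JointlySmooth.pd (hG : JointlySmooth G) (i : Fin (d + 1)) :
    JointlySmooth fun z => pd i (G z) := by
  have h1 : ContDiff ℝ ∞ fun p : Pt d × Pt d => fderiv ℝ (G p.1) p.2 := by
    refine ContDiff.fderiv (n := ∞) (f := fun (p : Pt d × Pt d) w => G p.1 w) ?_ contDiff_snd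
      (m := ∞) (by simp)
    exact ContDiff.comp (g := fun p : Pt d × Pt d => G p.1 p.2) hG
      (by fun_prop : ContDiff ℝ ∞ fun q : (Pt d × Pt d) × Pt d => (q.1.1, q.2))
  exact h1.clm_apply contDiff_const

lemma JointlySmooth.Dk (hG : JointlySmooth G) (k : MI d) : JointlySmooth fun z => Dk k (G z) := by
  induction k using mi_induction with
  | h0 => simpa using hG
  | hs k i ih =>
    have := ih.pd i
    convert this using 2 with z
    exact Dk_add_single (hG.section z) k i

lemma JointlySmooth.bounded (hG : JointlySmooth G) {Q : Set (Pt d)} (hQ : IsCompact Q) (L : ℝ) :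
    ∃ C, 0 ≤ C ∧ ∀ z ∈ Q, ∀ w, pnorm (w - z) ≤ L → |G z w| ≤ C := by
  have hK : IsCompact (Q ×ˢ Metric.closedBall (0 : Pt d) (L + L ^ 2)) :=
    hQ.prod (isCompact_closedBall _ _)
  have hc : Continuous fun p : Pt d × Pt d => G p.1 (p.1 + p.2) :=
    (ContDiff.continuous hG).comp (by fun_prop : Continuous fun p : Pt d × Pt d => (p.1, p.1 + p.2))
  obtain ⟨C, hC⟩ := hK.exists_bound_of_continuousOn hc.continuousOn
  refine ⟨max C 0, le_max_right _ _, fun z hz w hw => le_max_of_le_left ?_⟩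
  have := hC (z, w - z) ⟨hz, by simpa using norm_le_of_pnorm_le hw⟩
  simpa using this

/-- Induction on an integer above r. For r ≤ 0 the remainder is the function itself, which is
bounded on compacts. For r > 0 it vanishes at z, and its i-th partial derivative is a remainder of
order r - wt i; integrating along the segment from z to w, the factor |w_i - z_i| ≤ l^{wt i}
restores the power l^r. Weights are at least 1, so the integer drops, and joint smoothness makes the
constants uniform on Q. -/
theorem taylorRem_bound {Q : Set (Pt d)} (hQ : IsCompact Q) (L : ℝ) (hG : JointlySmooth G)
    (r : ℝ) : ∃ C, 0 ≤ C ∧ ∀ z ∈ Q, ∀ l, 0 < l → l ≤ L → ∀ w, pnorm (w - z) ≤ l →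
      |taylorRem r (G z) z w| ≤ C * l ^ r := by
  obtain ⟨n, hn⟩ := exists_nat_ge r
  induction n generalizing G r with
  | zero =>
    rw [Nat.cast_zero] at hn
    obtain ⟨C, hC0, hC⟩ := hG.bounded hQ L
    -- For r ≤ 0 and l ≤ L one has l ^ r ≥ L ^ r, so the factor (L ^ r)⁻¹ makes room for l ^ r. The
    -- maximum with 0 keeps the constant nonnegative also for L ≤ 0, where no l exists.
    refine ⟨C * (L ^ r)⁻¹ ⊔ 0, le_max_right _ _, fun z hz l hl hlL w hw => ?_⟩
    have hL : 0 < L ^ r := Real.rpow_pos_of_pos (hl.trans_le hlL) r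
    rw [taylorRem_nonpos hn]
    refine (hC z hz w (hw.trans hlL)).trans ?_
    refine le_trans ?_ (mul_le_mul_of_nonneg_right (le_max_left _ _) (Real.rpow_nonneg hl.le r))
    rw [mul_assoc]
    refine le_mul_of_one_le_right hC0 ?_
    rw [inv_mul_eq_div, one_le_div hL]
    exact Real.rpow_le_rpow_of_nonpos hl hlL hn
  | succ n ih =>
    by_cases hr : r ≤ 0
    · by_cases hn' : r ≤ n
      · exact ih hG r hn'
      · exact absurd (hr.trans (Nat.cast_nonneg n)) hn'
    push Not at hr
    have hi : ∀ i : Fin (d + 1), ∃ C, 0 ≤ C ∧ ∀ z ∈ Q, ∀ l, 0 < l → l ≤ L → ∀ w,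
        pnorm (w - z) ≤ l → |taylorRem (r - wt i) (pd i (G z)) z w| ≤ C * l ^ (r - wt i) := by
      intro i
      refine ih (hG.pd i) _ ?_
      have : (1 : ℝ) ≤ wt i := by exact_mod_cast wt_pos i
      push_cast at hn
      linarith
    choose C hC0 hC using hi
    refine ⟨∑ i, C i, Finset.sum_nonneg fun i _ => hC0 i, fun z hz l hl hlL w hw => ?_⟩
    have hsm := taylorRem_contDiff (hG.section z) r z
    have hderiv : ∀ t ∈ Set.Icc (0 : ℝ) 1, HasDerivWithinAt
        (fun t : ℝ => taylorRem r (G z) z (z + t • (w - z)))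
        (∑ i, (w - z) i * pd i (taylorRem r (G z) z) (z + t • (w - z))) (Set.Icc 0 1) t := by
      intro t _
      rw [← fderiv_apply_eq_sum]
      have h1 : HasDerivAt (fun t : ℝ => z + t • (w - z)) (w - z) t := by
        simpa using ((hasDerivAt_id t).smul_const (w - z)).const_add z
      exact ((smooth_diff hsm _).hasFDerivAt.comp_hasDerivAt t h1).hasDerivWithinAt
    have hb := norm_image_sub_le_of_norm_deriv_le_segment_01' hderiv
      (C := (∑ i, C i) * l ^ r) (fun t ht => ?_)
    · simpa [taylorRem_self hr] using hb
    · rw [Finset.sum_mul]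
      refine (norm_sum_le _ _).trans (Finset.sum_le_sum fun i _ => ?_)
      rw [pd_taylorRem (hG.section z), norm_mul, Real.norm_eq_abs, Real.norm_eq_abs]
      have h1 := hC i z hz l hl hlL (z + t • (w - z)) (by
        rw [add_sub_cancel_left]
        exact (pnorm_smul_le ht.1 ht.2.le _).trans hw)
      have h2 := abs_le_pow_wt hw i
      refine (mul_le_mul h2 h1 (abs_nonneg _) (by positivity)).trans (le_of_eq ?_)
      rw [← Real.rpow_natCast, mul_left_comm, ← Real.rpow_add hl]
      congr 2
      ring

end Taylor

/-! ### Parameter integrals and convolution -/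

section Kernel

open MeasureTheory

lemma sum_wt : ∑ i : Fin (d + 1), wt i = d + 2 := by
  rw [Fin.sum_univ_succ]
  simp only [wt_succ]
  simp [wt, add_comm]

/-- Integral bound for functions supported in a parabolic ball. -/
lemma lintegral_enorm_le_of_pnorm {f : Pt d → ℝ} {M r : ℝ} (z : Pt d) (hM : 0 ≤ M) (hr : 0 ≤ r)
    (hf : ∀ w, |f w| ≤ M) (hs : ∀ w, r < pnorm (w - z) → f w = 0) :
    ∫⁻ w, ‖f w‖ₑ ≤ ENNReal.ofReal (M * (2 ^ (d + 1) * r ^ (d + 2))) := by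
  set B : Set (Pt d) := Set.Icc (fun i => z i - r ^ wt i) (fun i => z i + r ^ wt i)
  have h1 : ∀ w, ‖f w‖ₑ ≤ B.indicator (fun _ => ENNReal.ofReal M) w := by
    intro w
    by_cases hw : w ∈ B
    · rw [Set.indicator_of_mem hw, ← ofReal_norm]
      exact ENNReal.ofReal_le_ofReal (hf w)
    · have : f w = 0 := by
        refine hs w ?_
        by_contra! hcon
        refine hw ⟨fun i => ?_, fun i => ?_⟩ <;>
          have h2 := abs_le.1 (abs_le_pow_wt hcon i) <;> simp only [Pi.sub_apply] at h2 <;> linarith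
      simp [this]
  refine (lintegral_mono h1).trans ?_
  rw [lintegral_indicator measurableSet_Icc, setLIntegral_const, Real.volume_Icc_pi,
    ENNReal.ofReal_mul hM]
  refine mul_le_mul_right ?_ _
  rw [← ENNReal.ofReal_prod_of_nonneg fun i _ => ?_]
  · refine ENNReal.ofReal_le_ofReal (le_of_eq ?_)
    have h3 : ∀ i : Fin (d + 1), z i + r ^ wt i - (z i - r ^ wt i) = 2 * r ^ wt i :=
      fun i => by ring
    simp only [h3, Finset.prod_mul_distrib, Finset.prod_pow_eq_pow_sum, sum_wt]
    simp
  · have : 0 ≤ r ^ wt i := by positivity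
    linarith

/-- K_n has height of order 2^{dn} on a set of volume of order 2^{-(d+2)n}, so its L¹ norm is of
order 4^{-n}, which is summable. Later arguments take nothing else from the decomposition, as
derivatives always fall on the smooth factor of a convolution. -/
lemma isKernel_integrable {K : Pt d → ℝ} (hK : IsKernel 2 K) : Integrable K := by
  obtain ⟨Kn, hsm, hsupp, hbd, hsum⟩ := hK.decomp
  obtain ⟨C, hC⟩ := hbd 0
  have hC' : ∀ n w, |Kn n w| ≤ max C 0 * (2 : ℝ) ^ (d * n) := by
    intro n w
    have h1 := hC n w
    rw [Dk_zero] at h1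
    have h2 : ((d : ℝ) + 2 + sdeg (0 : MI d) - 2) * n = ((d * n : ℕ) : ℝ) := by
      simp
    rw [h2, Real.rpow_natCast] at h1
    exact h1.trans (mul_le_mul_of_nonneg_right (le_max_left _ _) (by positivity))
  -- The decomposition and the smoothness of K hold off the origin, which is a null set.
  have hae : ∀ᵐ w : Pt d, w ∈ ({0}ᶜ : Set (Pt d)) := by
    rw [ae_iff]
    simp
  have hmeas : AEStronglyMeasurable K := by
    have h1 : AEStronglyMeasurable K (volume.restrict ({0}ᶜ : Set (Pt d))) :=
      hK.smooth.continuousOn.aestronglyMeasurable (measurableSet_singleton 0).compl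
    rwa [Measure.restrict_eq_self_of_ae_mem hae] at h1
  refine ⟨hmeas, ?_⟩
  have h1 : ∫⁻ w, ‖K w‖ₑ ≤ ∫⁻ w, ∑' n, ‖Kn n w‖ₑ := by
    refine lintegral_mono_ae ?_
    filter_upwards [hae] with w hw
    rw [← (hsum w hw).tsum_eq]
    exact enorm_tsum_le_tsum_enorm
  have h2 : ∫⁻ w, ∑' n, ‖Kn n w‖ₑ = ∑' n, ∫⁻ w, ‖Kn n w‖ₑ :=
    lintegral_tsum fun n => (hsm n).continuous.enorm.aemeasurable
  have h3 : ∀ n, ∫⁻ w, ‖Kn n w‖ₑ ≤ ENNReal.ofReal (max C 0 * 2 ^ (d + 1) * (1 / 4) ^ n) := by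
    intro n
    refine (lintegral_enorm_le_of_pnorm 0 (by positivity)
      (by positivity : (0 : ℝ) ≤ ((2 : ℝ) ^ n)⁻¹) (hC' n)
      fun w hw => hsupp n w (by simpa using hw)).trans (ENNReal.ofReal_le_ofReal (le_of_eq ?_))
    have h4 : (2 : ℝ) ^ (d * n) * (((2 : ℝ) ^ n)⁻¹) ^ (d + 2) = (1 / 4) ^ n := by
      rw [pow_add, mul_comm d n, pow_mul, ← mul_assoc, ← mul_pow, mul_inv_cancel₀ (by positivity),
        one_pow, one_mul, inv_pow, ← pow_mul, mul_comm n 2, pow_mul, one_div, inv_pow]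
      norm_num
    rw [← h4]; ring
  have hs : Summable fun n : ℕ => max C 0 * 2 ^ (d + 1) * (1 / 4 : ℝ) ^ n :=
    (summable_geometric_of_lt_one (by norm_num) (by norm_num)).mul_left _
  refine lt_of_le_of_lt (h1.trans (h2.le.trans (ENNReal.tsum_le_tsum h3))) ?_
  rw [← ENNReal.ofReal_tsum_of_nonneg (fun n => by positivity) hs]
  exact ENNReal.ofReal_lt_top

/-- Integrable functions that vanish outside a bounded set. -/
structure CompactKernel (K : Pt d → ℝ) : Prop where
  integrable : Integrable K
  supp : ∀ y, 2 < ‖y‖ → K y = 0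

/-- The radius 2 is l + l² at l = 1, from `norm_le_of_pnorm_le`. -/
lemma IsKernel.compactKernel {K : Pt d → ℝ} (hK : IsKernel 2 K) : CompactKernel K :=
  ⟨isKernel_integrable hK, fun y hy => hK.supp y (by
    by_contra! hcon
    have := norm_le_of_pnorm_le hcon
    norm_num at this
    linarith)⟩

variable {K : Pt d → ℝ}

lemma CompactKernel.integrable_smul (hK : CompactKernel K) {E : Type} [NormedAddCommGroup E]
    [NormedSpace ℝ E] {g : Pt d → E} (hg : Continuous g) : Integrable fun y => K y • g y := by
  obtain ⟨C, hC⟩ := (isCompact_closedBall (0 : Pt d) 2).exists_bound_of_continuousOn hg.continuousOn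
  refine (hK.integrable.norm.const_mul C).mono'
    (hK.integrable.aestronglyMeasurable.smul hg.aestronglyMeasurable) (ae_of_all _ fun y => ?_)
  rw [norm_smul, mul_comm]
  by_cases hy : ‖y‖ ≤ 2
  · exact mul_le_mul_of_nonneg_right (hC y (by simpa using hy)) (norm_nonneg _)
  · simp [hK.supp y (not_le.1 hy)]

/-- Differentiation under the integral sign: K lives in a fixed ball, on which the derivative of G
is bounded for parameters near p, so a multiple of |K| dominates. -/
lemma CompactKernel.hasFDerivAt (hK : CompactKernel K) {P E : Type} [NormedAddCommGroup P]
    [NormedSpace ℝ P] [ProperSpace P] [NormedAddCommGroup E] [NormedSpace ℝ E]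
    {G : P → Pt d → E} (hG : ContDiff ℝ ∞ fun q : P × Pt d => G q.1 q.2) (p : P) :
    HasFDerivAt (fun p => ∫ y, K y • G p y)
      (∫ y, K y • fderiv ℝ (fun p => G p y) p) p := by
  have hG' : ContDiff ℝ ∞ fun q : P × Pt d => fderiv ℝ (fun p => G p q.2) q.1 := by
    refine ContDiff.fderiv (n := ∞) (m := ∞) (f := fun (q : P × Pt d) p => G p q.2) ?_ contDiff_fst
      (by simp)
    exact ContDiff.comp (g := fun q : P × Pt d => G q.1 q.2) hG
      (by fun_prop : ContDiff ℝ ∞ fun q : (P × Pt d) × P => (q.2, q.1.2))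
  have hsec : ∀ p, Continuous (G p) := fun p =>
    (ContDiff.continuous hG).comp (Continuous.prodMk_right p)
  have hsec' : ∀ p, Continuous fun y => fderiv ℝ (fun p => G p y) p := fun p =>
    (ContDiff.continuous hG').comp (Continuous.prodMk_right p)
  obtain ⟨C, hC⟩ := ((isCompact_closedBall p 1).prod
    (isCompact_closedBall (0 : Pt d) 2)).exists_bound_of_continuousOn hG'.continuous.continuousOn
  refine hasFDerivAt_integral_of_dominated_of_fderiv_le
    (F' := fun p y => K y • fderiv ℝ (fun p => G p y) p) (bound := fun y => C * ‖K y‖)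
    (Metric.closedBall_mem_nhds p one_pos)
    (Filter.Eventually.of_forall fun q => (hK.integrable_smul (hsec q)).aestronglyMeasurable)
    (hK.integrable_smul (hsec p)) (hK.integrable_smul (hsec' p)).aestronglyMeasurable
    (ae_of_all _ fun y q hq => ?_) (hK.integrable.norm.const_mul C) (ae_of_all _ fun y q _ => ?_)
  · rw [norm_smul, mul_comm]
    by_cases hy : ‖y‖ ≤ 2
    · exact mul_le_mul_of_nonneg_right (hC (q, y) ⟨hq, by simpa using hy⟩) (norm_nonneg _)
    · simp [hK.supp y (not_le.1 hy)]
  · have h1 : ContDiff ℝ ∞ fun p => G p y :=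
      ContDiff.comp (g := fun q : P × Pt d => G q.1 q.2) hG (contDiff_prodMk_left y)
    exact ((h1.differentiable (by simp) q).hasFDerivAt).const_smul (K y)

/-- The codomain E varies in the induction because the derivative is an integral of the same form
with values in `P →L[ℝ] E`. -/
lemma CompactKernel.contDiff_nat (hK : CompactKernel K) {P : Type} [NormedAddCommGroup P]
    [NormedSpace ℝ P] [ProperSpace P] (n : ℕ) : ∀ (E : Type) [NormedAddCommGroup E]
    [NormedSpace ℝ E] (G : P → Pt d → E), ContDiff ℝ ∞ (fun q : P × Pt d => G q.1 q.2) →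
      ContDiff ℝ n fun p => ∫ y, K y • G p y := by
  induction n with
  | zero =>
    intro E _ _ G hG
    refine contDiff_zero.2 (continuous_iff_continuousAt.2 fun p => ?_)
    exact (hK.hasFDerivAt hG p).continuousAt
  | succ n ih =>
    intro E _ _ G hG
    have h1 : ContDiff ℝ (n + 1 : ℕ) fun p => ∫ y, K y • G p y := by
      push_cast
      rw [contDiff_succ_iff_fderiv]
      refine ⟨fun p => (hK.hasFDerivAt hG p).differentiableAt, by simp, ?_⟩
      have h2 : fderiv ℝ (fun p => ∫ y, K y • G p y) =
          fun p => ∫ y, K y • fderiv ℝ (fun p => G p y) p :=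
        funext fun p => (hK.hasFDerivAt hG p).fderiv
      rw [h2]
      refine ih (P →L[ℝ] E) (fun p y => fderiv ℝ (fun p => G p y) p) ?_
      refine ContDiff.fderiv (n := ∞) (m := ∞) (f := fun (q : P × Pt d) p => G p q.2) ?_
        contDiff_fst (by simp)
      exact ContDiff.comp (g := fun q : P × Pt d => G q.1 q.2) hG
        (by fun_prop : ContDiff ℝ ∞ fun q : (P × Pt d) × P => (q.2, q.1.2))
    exact h1

lemma conv_apply (K g : Pt d → ℝ) (w : Pt d) : conv K g w = ∫ y, K y * g (w - y) := rfl

lemma JointlySmooth.conv (hK : CompactKernel K) {G : Pt d → Pt d → ℝ} (hG : JointlySmooth G) :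
    JointlySmooth fun z => conv K (G z) := by
  refine contDiff_infty.2 fun n => ?_
  refine hK.contDiff_nat (P := Pt d × Pt d) n ℝ (fun p y => G p.1 (p.2 - y)) ?_
  exact ContDiff.comp (g := fun p : Pt d × Pt d => G p.1 p.2) hG
    (by fun_prop : ContDiff ℝ ∞ fun q : (Pt d × Pt d) × Pt d => (q.1.1, q.1.2 - q.2))

lemma jointlySmooth_const {g : Pt d → ℝ} (hg : ContDiff ℝ ∞ g) :
    JointlySmooth fun _ : Pt d => g :=
  hg.comp contDiff_snd

lemma conv_contDiff (hK : CompactKernel K) {g : Pt d → ℝ} (hg : ContDiff ℝ ∞ g) :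
    ContDiff ℝ ∞ (conv K g) :=
  ((jointlySmooth_const hg).conv hK).section 0

lemma CompactKernel.integrable_conv (hK : CompactKernel K) {g : Pt d → ℝ} (hg : Continuous g)
    (w : Pt d) : Integrable fun y => K y * g (w - y) :=
  hK.integrable_smul (g := fun y => g (w - y)) (by fun_prop)

lemma conv_add (hK : CompactKernel K) {g h : Pt d → ℝ} (hg : Continuous g) (hh : Continuous h) :
    conv K (g + h) = conv K g + conv K h := by
  funext w
  simp only [conv_apply, Pi.add_apply, mul_add]
  exact integral_add (hK.integrable_conv hg w) (hK.integrable_conv hh w)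

lemma conv_smul (c : ℝ) (g : Pt d → ℝ) : conv K (c • g) = c • conv K g := by
  funext w
  simp only [conv_apply, Pi.smul_apply, smul_eq_mul, mul_left_comm _ c]
  exact integral_const_mul c _

/-- A kernel with vanishing moments annihilates polynomials of low degree. -/
lemma conv_mpow_eq_zero (hK : CompactKernel K) {k : MI d}
    (hpoly : ∀ m : MI d, m ≤ k → ∫ z, K z * mpow z m = 0) :
    conv K (fun w => mpow w k) = 0 := by
  funext w
  -- The binomial expansion of (w - y)^k in y reduces the convolution to moments of K with exponent
  -- at most k.
  have h1 : ∀ y : Pt d, K y * mpow (w - y) k =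
      ∑ j ∈ Fintype.piFinset fun i => Finset.range (k i + 1),
        (mfact k * dpow w j * (mfact (k - j) : ℝ)⁻¹ * mpow (-1 : Pt d) (k - j)) *
          (K y * mpow y (k - j)) := by
    intro y
    have h2 : mpow (w - y) k = mfact k * dpow (w + -y) k := by
      rw [dpow, smul_eq_mul, ← mul_assoc, mul_inv_cancel₀ (mfact_ne_zero k), one_mul,
        sub_eq_add_neg]
    rw [h2, dpow_add, Finset.mul_sum, Finset.mul_sum]
    refine Finset.sum_congr rfl fun j _ => ?_
    have h3 : mpow (-y) (k - j) = mpow (-1 : Pt d) (k - j) * mpow y (k - j) := by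
      simp only [mpow, ← Finset.prod_mul_distrib, ← mul_pow]
      simp
    rw [dpow.eq_1 (-y), h3, smul_eq_mul]
    ring
  have h4 : ∀ m : MI d, Continuous fun y : Pt d => mpow y m := fun m => by
    unfold mpow; fun_prop
  rw [conv_apply, Pi.zero_apply]
  simp only [h1]
  rw [integral_finsetSum]
  · refine Finset.sum_eq_zero fun j _ => ?_
    rw [integral_const_mul, hpoly _ tsub_le_self, mul_zero]
  · intro j _
    exact (hK.integrable_smul (h4 (k - j))).const_mul _

end Kernel

/-! ### The canonical model -/

section Canonical

variable {α : ℝ} {K ξ : Pt d → ℝ}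

lemma piFun_one (z : Pt d) : piFun α K ξ z 1 = 1 := rfl

lemma piFun_X (z : Pt d) (i : Fin (d + 1)) : piFun α K ξ z (Formal.X i) = fun w => w i - z i := rfl

lemma piFun_Xi (z : Pt d) : piFun α K ξ z Formal.Xi = ξ := rfl

lemma piFun_mul (z : Pt d) (τ σ : Formal d) :
    piFun α K ξ z (τ * σ) = piFun α K ξ z τ * piFun α K ξ z σ := by
  rcases τ with ⟨a⟩; rcases σ with ⟨b⟩; rfl

lemma piFun_D (z : Pt d) (i : Fin d) (τ : Formal d) :
    piFun α K ξ z (Formal.D i τ) = pd i.succ (piFun α K ξ z τ) := by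
  rcases τ with ⟨a⟩; rfl

lemma piFun_I (z : Pt d) (τ : Formal d) : piFun α K ξ z (Formal.I τ) =
    taylorRem (τ.hom α + 2) (conv K (piFun α K ξ z τ)) z := by
  rcases τ with ⟨a⟩
  funext w
  change conv K (a.pi α K ξ z) w - ∑ k ∈ below d (a.hom α + 2),
    mpow (w - z) k / mfact k * Dk k (conv K (a.pi α K ξ z)) z = _
  unfold taylorRem
  congr 1
  refine Finset.sum_congr rfl fun k _ => ?_
  rw [dpow, smul_eq_mul, div_eq_inv_mul]
  rfl

lemma jointlySmooth_mul {G H : Pt d → Pt d → ℝ} (hG : JointlySmooth G) (hH : JointlySmooth H) :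
    JointlySmooth fun z => G z * H z :=
  ContDiff.mul (f := fun p : Pt d × Pt d => G p.1 p.2) (g := fun p : Pt d × Pt d => H p.1 p.2) hG hH

lemma jointlySmooth_taylorRem {G : Pt d → Pt d → ℝ} (hG : JointlySmooth G) (r : ℝ) :
    JointlySmooth fun z => taylorRem r (G z) z := by
  refine ContDiff.sub hG (ContDiff.sum fun k _ => ContDiff.mul ?_ ?_)
  · exact dpow_contDiff (x := fun p : Pt d × Pt d => p.2 - p.1) (by fun_prop) k
  · exact ContDiff.comp (g := fun p : Pt d × Pt d => Dk k (G p.1) p.2) (hG.Dk k)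
      (by fun_prop : ContDiff ℝ ∞ fun p : Pt d × Pt d => (p.1, p.1))

lemma jointlySmooth_piFun (hK : CompactKernel K) (hξ : ContDiff ℝ ∞ ξ) (τ : Formal d) :
    JointlySmooth fun z => piFun α K ξ z τ := by
  rcases τ with ⟨a⟩
  induction a with
  | one => exact contDiff_const
  | X i =>
    change ContDiff ℝ ∞ fun p : Pt d × Pt d => p.2 i - p.1 i
    fun_prop
  | Xi => exact jointlySmooth_const hξ
  | I a ih =>
    have h1 : (fun z => piFun α K ξ z (Formal.I (Formal.mk a))) = _ := funext fun z => piFun_I z _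
    change JointlySmooth fun z => piFun α K ξ z (Formal.I (Formal.mk a))
    rw [h1]
    exact jointlySmooth_taylorRem (JointlySmooth.conv hK ih) _
  | D i a ih => exact JointlySmooth.pd ih i.succ
  | mul a b ha hb => exact jointlySmooth_mul ha hb

lemma piLin_basis (z : Pt d) (τ : Formal d) : piLin α K ξ z (basis τ) = piFun α K ξ z τ :=
  linExt_basis _ _

lemma contDiff_linear {L : Lin d →ₗ[ℝ] (Pt d → ℝ)} (h : ∀ τ, ContDiff ℝ ∞ (L (basis τ)))
    (x : Lin d) : ContDiff ℝ ∞ (L x) := by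
  rw [eq_sum_basis x, map_sum]
  have h1 := ContDiff.sum (s := x.coeff.support) (n := ∞) (𝕜 := ℝ)
    fun τ _ => contDiff_smul (x.coeff τ) (h τ)
  convert h1 using 1
  ext; simp

lemma contDiff_piLin (hK : CompactKernel K) (hξ : ContDiff ℝ ∞ ξ) (z : Pt d) (x : Lin d) :
    ContDiff ℝ ∞ (piLin α K ξ z x) :=
  contDiff_linear (fun τ => by
    rw [piLin_basis]
    exact (jointlySmooth_piFun hK hξ τ).section z) x

/-- The interpretation of terms without recentering. -/
def Raw.barePi (K ξ : Pt d → ℝ) : Raw d → Pt d → ℝ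
  | one => 1
  | X i => fun w => w i
  | Xi => ξ
  | I a => conv K (a.barePi K ξ)
  | D i a => pd i.succ (a.barePi K ξ)
  | mul a b => a.barePi K ξ * b.barePi K ξ

/-- The interpretation of formal expressions without recentering. -/
def barePi (K ξ : Pt d → ℝ) : Formal d →* (Pt d → ℝ) where
  toFun := Quotient.lift (Raw.barePi K ξ) fun a b h => by
    change Rel a b at h
    induction h <;> simp_all [Raw.barePi, mul_comm, mul_left_comm]
  map_one' := rfl
  map_mul' := by rintro ⟨a⟩ ⟨b⟩; rfl

variable (K ξ) in
/-- The linear extension of `barePi`. -/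
def bareAlg : Lin d →ₐ[ℝ] (Pt d → ℝ) := MonoidAlgebra.lift ℝ (Pt d → ℝ) (Formal d) (barePi K ξ)

lemma bareAlg_basis (τ : Formal d) : bareAlg K ξ (basis τ) = barePi K ξ τ := by
  simp [bareAlg, basis]

lemma barePi_X (i : Fin (d + 1)) : barePi K ξ (Formal.X i) = fun w => w i := rfl

lemma barePi_I (τ : Formal d) : barePi K ξ (Formal.I τ) = conv K (barePi K ξ τ) := by
  rcases τ with ⟨a⟩; rfl

lemma barePi_D (i : Fin d) (τ : Formal d) :
    barePi K ξ (Formal.D i τ) = pd i.succ (barePi K ξ τ) := by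
  rcases τ with ⟨a⟩; rfl

lemma barePi_mpow (k : MI d) : barePi K ξ (mpow Formal.X k) = fun w => mpow w k := by
  rw [map_mpow]
  funext w
  simp [mpow, barePi_X]

lemma contDiff_barePi (hK : CompactKernel K) (hξ : ContDiff ℝ ∞ ξ) (τ : Formal d) :
    ContDiff ℝ ∞ (barePi K ξ τ) := by
  rcases τ with ⟨a⟩
  induction a with
  | one => exact contDiff_const
  | X i =>
    change ContDiff ℝ ∞ fun w : Pt d => w i
    fun_prop
  | Xi => exact hξ
  | I a ih => exact conv_contDiff hK ih
  | D i a ih => exact contDiff_pd ih i.succ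
  | mul a b ha hb => exact ContDiff.mul ha hb

lemma contDiff_bareAlg (hK : CompactKernel K) (hξ : ContDiff ℝ ∞ ξ) (x : Lin d) :
    ContDiff ℝ ∞ (bareAlg K ξ x) :=
  contDiff_linear (L := (bareAlg K ξ).toLinearMap) (fun τ => by
    change ContDiff ℝ ∞ (bareAlg K ξ (basis τ))
    rw [bareAlg_basis]
    exact contDiff_barePi hK hξ τ) x

lemma bareAlg_shiftPow (c : Pt d) (k : MI d) :
    bareAlg K ξ (shiftPow c k) = fun w => dpow (w + c) k := by
  funext w
  have h1 := map_dpow ((Pi.evalAlgHom ℝ (fun _ : Pt d => ℝ) w).comp (bareAlg K ξ))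
    (fun i => basis (Formal.X i) + algebraMap ℝ (Lin d) (c i)) k
  refine h1.trans ?_
  congr 1
  funext i
  simp only [AlgHom.comp_apply, map_add, AlgHom.commutes, bareAlg_basis, barePi_X]
  rfl

-- Factorization of Π_z through Γ̂ and the algebraic identities of the model

variable {e : Equation} {γ : ℝ}

/-- The kernel is integrable and annihilates polynomials of degree less than `γ`. -/
structure Admissible (γ : ℝ) (K ξ : Pt d → ℝ) : Prop where
  kernel : CompactKernel K
  noise : ContDiff ℝ ∞ ξ
  moments : ∀ k : MI d, (sdeg k : ℝ) < γ → ∫ z, K z * mpow z k = 0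

/-- The convention I(X^k) = 0 agrees with convolution because K annihilates polynomials of degree
less than γ; hence the restriction to the truncated space. -/
lemma bareAlg_intMap (h : Admissible γ K ξ) {x : Lin d} (hx : x ∈ modelSpace d α e γ) :
    bareAlg K ξ (intMap d x) = conv K (bareAlg K ξ x) := by
  induction hx using Submodule.span_induction with
  | mem x hx =>
    obtain ⟨τ, hτ, rfl⟩ := hx
    by_cases hp : τ ∈ Formal.poly d
    · rw [intMap_poly hp, map_zero, bareAlg_basis]
      obtain ⟨k, rfl⟩ := hp
      rw [barePi_mpow, conv_mpow_eq_zero h.kernel]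
      intro m hm
      refine h.moments m ?_
      have h1 := hτ.2
      rw [Formal.hom_mpow] at h1
      exact lt_of_le_of_lt (by exact_mod_cast sdeg_mono hm) h1
    · rw [intMap_basis hp, bareAlg_basis, bareAlg_basis, barePi_I]
  | zero =>
    have := conv_smul (K := K) 0 0
    simpa using this.symm
  | add x y _ _ hx hy =>
    rw [map_add, map_add, map_add, hx, hy,
      conv_add h.kernel (contDiff_bareAlg h.kernel h.noise x).continuous
        (contDiff_bareAlg h.kernel h.noise y).continuous]
  | smul c x _ hx =>
    rw [map_smul, map_smul, map_smul, hx, conv_smul]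

lemma pd_mpow (i : Fin (d + 1)) (k : MI d) : pd i (fun w : Pt d => mpow w k) =
    (k i : ℝ) • fun w => mpow w (k - Pi.single i 1) := by
  have h1 : (fun w : Pt d => mpow w k) = (mfact k : ℝ) • fun w : Pt d => dpow (w - 0) k := by
    funext w
    simp [dpow, mul_inv_cancel_left₀ (mfact_ne_zero k)]
  rw [h1, pd_smul _ (dpow_contDiff (by fun_prop) k)]
  funext w
  rw [Pi.smul_apply, pd_dpow]
  split_ifs with hk
  · simp [hk]
  · have h2 := mfact_add_single (k - Pi.single i 1) i
    rw [sub_single_add hk] at h2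
    have h3 : (k - Pi.single i 1 : MI d) i + 1 = k i := by simp; omega
    rw [h3] at h2
    rw [h2]
    simp [dpow, mul_assoc, mul_inv_cancel_left₀ (mfact_ne_zero _)]

lemma bareAlg_derMap (h : Admissible γ K ξ) (i : Fin d) {x : Lin d}
    (hx : x ∈ spanOf {σ : Formal d | InU e σ}) :
    bareAlg K ξ (derMap i x) = pd i.succ (bareAlg K ξ x) := by
  have hsm := contDiff_bareAlg h.kernel h.noise
  induction hx using Submodule.span_induction with
  | mem x hx =>
    obtain ⟨τ, hτ, rfl⟩ := hx
    have hτ' : InU e τ := hτ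
    cases hτ' with
    | poly _ k =>
      rw [derMap_mpow, map_smul, bareAlg_basis, bareAlg_basis, barePi_mpow, barePi_mpow, pd_mpow]
    | int _ σ _ _ =>
      rw [derMap_basis i (Formal.I_notMem_poly σ), bareAlg_basis, bareAlg_basis, barePi_D]
  | zero =>
    have := pd_smul 0 (hsm 0) i.succ
    simpa using this.symm
  | add x y _ _ hx hy =>
    rw [map_add, map_add, map_add, hx, hy, pd_add (hsm x) (hsm y)]
  | smul c x _ hx =>
    rw [map_smul, map_smul, map_smul, hx, pd_smul c (hsm x)]

lemma fChar_Z (z : Pt d) (i : Fin (d + 1)) : fChar α K ξ e z (Zv α e i) = z i := by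
  simp [fChar, Zv]

lemma fChar_J (z : Pt d) {k : MI d} {τ : Formal d} (h : JOk α e k τ) :
    fChar α K ξ e z (Jv α e k τ) = Dk k (conv K (piFun α K ξ z τ)) z := by
  simp [fChar, Jv, h]

/-- This reduces the algebraic identities for Π_z to those for Γ̂. For I(τ), the values f_z(𝒥_k(τ))
in `gammaHat_I` are the Taylor coefficients subtracted in Π_z I(τ). The induction is truncated at γ
so that Γ̂τ stays where the moment condition applies. -/
lemma piFun_eq (hα : α < 0) (hcrit : e.threshold < α) (h : Admissible γ K ξ) (z : Pt d)
    {τ : Formal d} (hτ : τ ∈ basisSet d α e γ) :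
    piFun α K ξ z τ = bareAlg K ξ (gammaHat (fChar α K ξ e z) (basis τ)) := by
  refine UV_induction (P := fun τ => piFun α K ξ z τ =
    bareAlg K ξ (gammaHat (fChar α K ξ e z) (basis τ))) hα hcrit γ ?_ ?_ ?_ ?_ ?_ ?_ hτ.1 hτ.2
  · simp [piFun_one]
  · intro i
    rw [gammaHat_X, map_add, bareAlg_basis, AlgHom.commutes, fChar_Z, piFun_X, barePi_X]
    funext w
    simp [sub_eq_add_neg]
  · rw [gammaHat_Xi, bareAlg_basis, piFun_Xi]
    rfl
  · intro a b ha hb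
    rw [piFun_mul, basis_mul, gammaHat_mul, map_mul, ha, hb]
  · intro τ hτ hp hγ ih
    rw [gammaHat_I, map_sub, bareAlg_intMap h (gammaHat_modelSpace γ
      (basis_mem_modelSpace ⟨Or.inr hτ, hγ⟩)), ← ih, piFun_I, map_sum]
    funext w
    rw [taylorRem, Pi.sub_apply, Finset.sum_apply]
    congr 1
    refine Finset.sum_congr rfl fun k hk => ?_
    rw [map_smul, fChar_J z ⟨Or.inr hτ, hp, mem_below.1 hk⟩, Pi.smul_apply, smul_eq_mul, mul_comm]
    simp only [fChar_Z]
    rw [bareAlg_shiftPow (fun i => -z i)]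
    rfl
  · intro i τ hτ hp hγ _ ih
    rw [piFun_D, ih, gammaHat_D, bareAlg_derMap (e := e) h]
    exact spanOf_mono (fun _ hσ => hσ.1) (gammaHat_InU_mem (InU.int _ _ hτ hp))

lemma piLin_eq (hα : α < 0) (hcrit : e.threshold < α) (h : Admissible γ K ξ) (z : Pt d)
    {x : Lin d} (hx : x ∈ modelSpace d α e γ) :
    piLin α K ξ z x = bareAlg K ξ (gammaHat (fChar α K ξ e z) x) :=
  eqOn_spanOf (g := (bareAlg K ξ).toLinearMap ∘ₗ gammaHat (fChar α K ξ e z))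
    (fun τ hτ => (piLin_basis z τ).trans (piFun_eq hα hcrit h z hτ)) hx

lemma gammaLin_eq (hα : α < 0) (hcrit : e.threshold < α) (z z' : Pt d) {x : Lin d}
    (hx : x ∈ spanOf (UV d e)) : gammaLin α K ξ e z z' x =
      gammaHat (charInv (fChar α K ξ e z)) (gammaHat (fChar α K ξ e z') x) :=
  gammaHat_charMul hα hcrit _ _ hx

lemma gammaHat_gammaLin (hα : α < 0) (hcrit : e.threshold < α) (z z' : Pt d) {x : Lin d}
    (hx : x ∈ spanOf (UV d e)) : gammaHat (fChar α K ξ e z) (gammaLin α K ξ e z z' x) =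
      gammaHat (fChar α K ξ e z') x := by
  rw [gammaLin_eq hα hcrit z z' hx, gammaHat_gammaHat_charInv hα hcrit _ (gammaHat_spanOf_UV hx)]

lemma gammaLin_mem_UV (z z' : Pt d) {x : Lin d} (hx : x ∈ spanOf (UV d e)) :
    gammaLin α K ξ e z z' x ∈ spanOf (UV d e) :=
  gammaHat_spanOf_UV hx

lemma gammaLin_mem (z z' : Pt d) {x : Lin d} (hx : x ∈ modelSpace d α e γ) :
    gammaLin α K ξ e z z' x ∈ modelSpace d α e γ :=
  gammaHat_modelSpace γ hx

lemma gammaLin_self (hα : α < 0) (hcrit : e.threshold < α) (z : Pt d) {x : Lin d}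
    (hx : x ∈ spanOf (UV d e)) : gammaLin α K ξ e z z x = x := by
  rw [gammaLin_eq hα hcrit z z hx, gammaHat_charInv_gammaHat hα hcrit _ hx]

lemma gammaLin_gammaLin (hα : α < 0) (hcrit : e.threshold < α) (z z' z'' : Pt d) {x : Lin d}
    (hx : x ∈ spanOf (UV d e)) :
    gammaLin α K ξ e z z' (gammaLin α K ξ e z' z'' x) = gammaLin α K ξ e z z'' x := by
  rw [gammaLin_eq hα hcrit z z' (gammaLin_mem_UV z' z'' hx), gammaHat_gammaLin hα hcrit z' z'' hx,
    gammaLin_eq hα hcrit z z'' hx]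

lemma piLin_gammaLin (hα : α < 0) (hcrit : e.threshold < α) (h : Admissible γ K ξ) (z z' : Pt d)
    {x : Lin d} (hx : x ∈ modelSpace d α e γ) :
    piLin α K ξ z (gammaLin α K ξ e z z' x) = piLin α K ξ z' x := by
  rw [piLin_eq (e := e) hα hcrit h z (gammaLin_mem z z' hx), piLin_eq hα hcrit h z' hx,
    gammaHat_gammaLin hα hcrit z z' (modelSpace_le hx)]

/-- A recentred monomial is still a polynomial of degree less than γ. In `gammaChar_J` this matches
the absence of generators 𝒥_k(X^j). -/
lemma conv_piFun_poly (hα : α < 0) (hcrit : e.threshold < α) (h : Admissible γ K ξ) (z : Pt d)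
    {τ : Formal d} (hτ : τ ∈ basisSet d α e γ) (hp : τ ∈ Formal.poly d) :
    conv K (piFun α K ξ z τ) = 0 := by
  rw [piFun_eq hα hcrit h z hτ, ← bareAlg_intMap h (gammaHat_modelSpace γ
    (basis_mem_modelSpace hτ))]
  obtain ⟨k, rfl⟩ := hp
  rw [eqOn_spanOf (f := intMap d) (g := 0) ?_ (gammaHat_mpow_mem _ k), LinearMap.zero_apply,
    map_zero]
  rintro _ ⟨i, _, rfl⟩
  exact intMap_poly ⟨i, rfl⟩

end Canonical

/-! ### Analytic bounds -/

section PiBound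

variable {α : ℝ} {K ξ : Pt d → ℝ} {e : Equation}

/-- For Ξ local boundedness suffices, as α < 0; exponents add under products; I(τ) and 𝒟_i I(τ) give
Taylor remainders of smooth functions, of orders |τ| + 2 and |τ| + 1, whatever the size of Π_z τ. -/
theorem piFun_bound (hα : α < 0) (hcrit : e.threshold < α) (hK : CompactKernel K)
    (hξ : ContDiff ℝ ∞ ξ) {Q : Set (Pt d)} (hQ : IsCompact Q) (L : ℝ) {τ : Formal d}
    (hτ : τ ∈ UV d e) : ∃ C, 0 ≤ C ∧ ∀ z ∈ Q, ∀ l, 0 < l → l ≤ L → ∀ w, pnorm (w - z) ≤ l →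
      |piFun α K ξ z τ w| ≤ C * l ^ τ.hom α := by
  refine UV_induction (P := fun τ => ∃ C, 0 ≤ C ∧ ∀ z ∈ Q, ∀ l, 0 < l → l ≤ L → ∀ w,
    pnorm (w - z) ≤ l → |piFun α K ξ z τ w| ≤ C * l ^ τ.hom α) hα hcrit (τ.hom α + 1)
    ?_ ?_ ?_ ?_ ?_ ?_ hτ (by linarith)
  · exact ⟨1, zero_le_one, fun z _ l _ _ w _ => by simp [piFun_one]⟩
  · refine fun i => ⟨1, zero_le_one, fun z _ l _ _ w hw => ?_⟩
    rw [piFun_X, Formal.hom_X, Real.rpow_natCast, one_mul]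
    exact abs_le_pow_wt hw i
  · obtain ⟨C, hC0, hC⟩ := taylorRem_bound hQ L (jointlySmooth_const hξ) α
    refine ⟨C, hC0, fun z hz l hl hlL w hw => ?_⟩
    have := hC z hz l hl hlL w hw
    rwa [taylorRem_nonpos hα.le] at this
  · rintro a b ⟨C, hC0, hC⟩ ⟨C', hC0', hC'⟩
    refine ⟨C * C', mul_nonneg hC0 hC0', fun z hz l hl hlL w hw => ?_⟩
    rw [piFun_mul, Pi.mul_apply, abs_mul, Formal.hom_mul, Real.rpow_add hl]
    refine (mul_le_mul (hC z hz l hl hlL w hw) (hC' z hz l hl hlL w hw) (abs_nonneg _)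
      (mul_nonneg hC0 (Real.rpow_nonneg hl.le _))).trans (le_of_eq (by ring))
  · intro τ _ _ _ _
    obtain ⟨C, hC0, hC⟩ := taylorRem_bound hQ L ((jointlySmooth_piFun hK hξ τ).conv hK)
      (τ.hom α + 2)
    refine ⟨C, hC0, fun z hz l hl hlL w hw => ?_⟩
    rw [piFun_I, Formal.hom_I]
    exact hC z hz l hl hlL w hw
  · intro i τ _ _ _ _ _
    have hsm := (jointlySmooth_piFun (α := α) hK hξ τ).conv hK
    obtain ⟨C, hC0, hC⟩ := taylorRem_bound hQ L (hsm.pd i.succ) (τ.hom α + 2 - 1)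
    refine ⟨C, hC0, fun z hz l hl hlL w hw => ?_⟩
    rw [piFun_D, piFun_I, Formal.hom_D, Formal.hom_I, pd_taylorRem (hsm.section z), wt_succ,
      Nat.cast_one]
    exact hC z hz l hl hlL w hw

end PiBound

-- A submultiplicative norm that encodes homogeneity

section WeightedNorm

variable {α : ℝ}

/-- The norm on `Lin d` in which `τ` has weight `l ^ |τ|`. -/
def wNorm (α l : ℝ) (x : Lin d) : ℝ := ∑ τ ∈ x.coeff.support, |x.coeff τ| * l ^ τ.hom α

variable {l : ℝ}

lemma wNorm_eq_sum {x : Lin d} (F : Finset (Formal d)) (h : x.coeff.support ⊆ F) :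
    wNorm α l x = ∑ τ ∈ F, |x.coeff τ| * l ^ τ.hom α := by
  refine Finset.sum_subset h fun τ _ hτ => ?_
  rw [Finsupp.notMem_support_iff.1 hτ, abs_zero, zero_mul]

lemma wNorm_nonneg (hl : 0 ≤ l) (x : Lin d) : 0 ≤ wNorm α l x :=
  Finset.sum_nonneg fun _ _ => mul_nonneg (abs_nonneg _) (Real.rpow_nonneg hl _)

@[simp] lemma wNorm_zero : wNorm α l (0 : Lin d) = 0 := by simp [wNorm]

lemma wNorm_basis (τ : Formal d) : wNorm α l (basis τ) = l ^ τ.hom α := by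
  classical
  rw [wNorm_eq_sum {τ} fun σ hσ => ?_]
  · simp [coeff_basis]
  · rw [Finsupp.mem_support_iff, coeff_basis] at hσ
    by_contra h
    exact hσ (if_neg fun h' => h (by simp [h']))

lemma wNorm_add (hl : 0 ≤ l) (x y : Lin d) :
    wNorm α l (x + y) ≤ wNorm α l x + wNorm α l y := by
  classical
  rw [wNorm_eq_sum (x := x) (x.coeff.support ∪ y.coeff.support) Finset.subset_union_left,
    wNorm_eq_sum (x := y) (x.coeff.support ∪ y.coeff.support) Finset.subset_union_right,
    wNorm_eq_sum (x := x + y) (x.coeff.support ∪ y.coeff.support) Finsupp.support_add,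
    ← Finset.sum_add_distrib]
  refine Finset.sum_le_sum fun τ _ => ?_
  rw [← add_mul]
  exact mul_le_mul_of_nonneg_right (abs_add_le _ _) (Real.rpow_nonneg hl _)

lemma wNorm_smul (c : ℝ) (x : Lin d) : wNorm α l (c • x) = |c| * wNorm α l x := by
  rw [wNorm_eq_sum (x := c • x) x.coeff.support Finsupp.support_smul, wNorm, Finset.mul_sum]
  exact Finset.sum_congr rfl fun τ _ => by simp [abs_mul, mul_assoc]

lemma wNorm_sum_le (hl : 0 ≤ l) {ι : Type*} (s : Finset ι) (x : ι → Lin d) :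
    wNorm α l (∑ i ∈ s, x i) ≤ ∑ i ∈ s, wNorm α l (x i) := by
  classical
  induction s using Finset.induction_on with
  | empty => simp
  | insert a s ha ih =>
    rw [Finset.sum_insert ha, Finset.sum_insert ha]
    exact (wNorm_add hl _ _).trans (by gcongr)

lemma wNorm_sub (hl : 0 ≤ l) (x y : Lin d) :
    wNorm α l (x - y) ≤ wNorm α l x + wNorm α l y := by
  have h1 := wNorm_add (α := α) hl x ((-1 : ℝ) • y)
  rwa [wNorm_smul, abs_neg, abs_one, one_mul, neg_one_smul, ← sub_eq_add_neg] at h1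

/-- Bound for a linear map from bounds on formal expressions. -/
lemma wNorm_map_le (hl : 0 < l) {T : Lin d →ₗ[ℝ] Lin d} {S : Set (Formal d)} {C s : ℝ}
    (h : ∀ τ ∈ S, wNorm α l (T (basis τ)) ≤ C * l ^ (τ.hom α + s)) {x : Lin d}
    (hx : x ∈ spanOf S) : wNorm α l (T x) ≤ C * l ^ s * wNorm α l x := by
  have hx' := mem_spanOf.1 hx
  conv_lhs => rw [eq_sum_basis x]
  rw [map_sum, wNorm.eq_1 α l x, Finset.mul_sum]
  refine (wNorm_sum_le hl.le _ _).trans (Finset.sum_le_sum fun τ hτ => ?_)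
  rw [map_smul, wNorm_smul]
  refine (mul_le_mul_of_nonneg_left (h τ (hx' τ (Finsupp.mem_support_iff.1 hτ)))
    (abs_nonneg _)).trans (le_of_eq ?_)
  rw [Real.rpow_add hl]; ring

/-- Additivity of the homogeneity makes the weights multiplicative; this settles products in the
bound for Γ_{zz'}. -/
lemma wNorm_mul (hl : 0 < l) (x y : Lin d) :
    wNorm α l (x * y) ≤ wNorm α l x * wNorm α l y := by
  have h1 : ∀ τ : Formal d, wNorm α l (basis τ * y) ≤ l ^ τ.hom α * wNorm α l y := by
    intro τ
    have := wNorm_map_le (α := α) hl (T := LinearMap.mulLeft ℝ (basis τ)) (S := Set.univ) (C := 1)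
      (s := τ.hom α) (fun σ _ => by
        rw [LinearMap.mulLeft_apply, ← basis_mul, wNorm_basis, Formal.hom_mul, one_mul, add_comm])
      (x := y) (mem_spanOf.2 fun _ _ => Set.mem_univ _)
    rwa [one_mul] at this
  have h2 := wNorm_map_le (α := α) hl (T := LinearMap.mulRight ℝ y) (S := Set.univ)
    (C := wNorm α l y) (s := 0) (fun τ _ => by
      rw [LinearMap.mulRight_apply, add_zero, mul_comm (wNorm α l y)]
      exact h1 τ) (x := x) (mem_spanOf.2 fun _ _ => Set.mem_univ _)
  rw [Real.rpow_zero, mul_one, mul_comm] at h2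
  exact h2

lemma wNorm_one : wNorm α l (1 : Lin d) = 1 := by
  rw [← basis_one, wNorm_basis, Formal.hom_one, Real.rpow_zero]

lemma wNorm_pow_le (hl : 0 < l) (x : Lin d) (n : ℕ) : wNorm α l (x ^ n) ≤ wNorm α l x ^ n := by
  induction n with
  | zero => rw [pow_zero, pow_zero, wNorm_one]
  | succ n ih =>
    rw [pow_succ, pow_succ]
    exact (wNorm_mul hl _ _).trans (mul_le_mul_of_nonneg_right ih (wNorm_nonneg hl.le _))

lemma wNorm_prod_le (hl : 0 < l) {ι : Type*} (s : Finset ι) (x : ι → Lin d) :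
    wNorm α l (∏ i ∈ s, x i) ≤ ∏ i ∈ s, wNorm α l (x i) := by
  classical
  induction s using Finset.induction_on with
  | empty => simp [wNorm_one]
  | insert a s ha ih =>
    rw [Finset.prod_insert ha, Finset.prod_insert ha]
    exact (wNorm_mul hl _ _).trans (mul_le_mul_of_nonneg_left ih (wNorm_nonneg hl.le _))

lemma wNorm_algebraMap (c : ℝ) : wNorm α l (algebraMap ℝ (Lin d) c) = |c| := by
  rw [Algebra.algebraMap_eq_smul_one, wNorm_smul, wNorm_one, mul_one]

lemma wNorm_X_add_le (hl : 0 < l) {c : ℝ} {i : Fin (d + 1)} (hc : |c| ≤ l ^ wt i) :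
    wNorm α l (basis (Formal.X i) + algebraMap ℝ (Lin d) c) ≤ 2 * l ^ wt i := by
  refine (wNorm_add hl.le _ _).trans ?_
  rw [wNorm_basis, wNorm_algebraMap, Formal.hom_X, Real.rpow_natCast]
  linarith

/-- X_i itself has weight l^{wt i}, so a translation of at most that size costs a factor 2 for each
power of X_i. -/
lemma wNorm_shiftPow_le (hl : 0 < l) {c : Fin (d + 1) → ℝ} (hc : ∀ i, |c i| ≤ l ^ wt i) (k : MI d) :
    wNorm α l (shiftPow c k) ≤ (mfact k : ℝ)⁻¹ * (∏ i, (2 : ℝ) ^ k i) * l ^ sdeg k := by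
  rw [shiftPow, dpow, wNorm_smul, abs_of_pos (inv_pos.2 (mfact_pos k)), mul_assoc]
  refine mul_le_mul_of_nonneg_left ?_ (inv_pos.2 (mfact_pos k)).le
  rw [mpow, sdeg_eq_sum, ← Finset.prod_pow_eq_pow_sum, ← Finset.prod_mul_distrib]
  refine (wNorm_prod_le hl _ _).trans (Finset.prod_le_prod (fun i _ => wNorm_nonneg hl.le _)
    fun i _ => (wNorm_pow_le hl _ _).trans ?_)
  refine (pow_le_pow_left₀ (wNorm_nonneg hl.le _) (wNorm_X_add_le hl (hc i)) _).trans
    (le_of_eq ?_)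
  rw [mul_pow, ← pow_mul]

lemma wNorm_intMap_le (hl : 0 < l) (x : Lin d) :
    wNorm α l (intMap d x) ≤ l ^ (2 : ℝ) * wNorm α l x := by
  have h := wNorm_map_le (α := α) hl (T := intMap d) (S := Set.univ) (C := 1) (s := 2)
    (fun τ _ => ?_) (x := x) (mem_spanOf.2 fun _ _ => Set.mem_univ _)
  · rwa [one_mul] at h
  · rw [one_mul]
    by_cases hp : τ ∈ Formal.poly d
    · rw [intMap_poly hp, wNorm_zero]; exact Real.rpow_nonneg hl.le _
    · rw [intMap_basis hp, wNorm_basis, Formal.hom_I]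

/-- Differentiating X^k produces the factor k_i ≤ |k| ≤ r, while on I(σ) the factor is 1; hence `max
1 r`. -/
lemma wNorm_derMap_le (hl : 0 < l) {e : Equation} (i : Fin d) {r : ℝ} {x : Lin d}
    (hx : x ∈ spanOf {σ : Formal d | InU e σ ∧ σ.hom α ≤ r}) :
    wNorm α l (derMap i x) ≤ max 1 r * l ^ (-1 : ℝ) * wNorm α l x := by
  refine wNorm_map_le hl (fun τ hτ => ?_) hx
  obtain ⟨hτ, hr⟩ := hτ
  cases hτ with
  | int _ σ _ _ =>
    rw [derMap_basis i (Formal.I_notMem_poly σ), wNorm_basis, Formal.hom_D, ← sub_eq_add_neg]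
    exact le_mul_of_one_le_left (Real.rpow_nonneg hl.le _) (le_max_left _ _)
  | poly _ k =>
    rw [Formal.hom_mpow] at hr ⊢
    rw [derMap_mpow]
    by_cases hk : k i.succ = 0
    · rw [hk, Nat.cast_zero, zero_smul, wNorm_zero]
      positivity
    · have h1 := congr_arg sdeg (sub_single_add hk)
      rw [sdeg_add, sdeg_single, wt_succ] at h1
      have h2 : (sdeg k : ℝ) + -1 = sdeg (k - Pi.single i.succ 1) := by
        rw [← h1]; push_cast; ring
      rw [wNorm_smul, wNorm_basis, Formal.hom_mpow, h2, Nat.abs_cast]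
      refine mul_le_mul_of_nonneg_right ?_ (Real.rpow_nonneg hl.le _)
      refine le_trans ?_ (hr.trans (le_max_right _ _))
      exact_mod_cast le_sdeg k i.succ

/-- Together with `wNorm_eq_of_hom`, this turns one weighted bound at l = |z - z'| into the bounds
l^{β - β'} on all components. -/
lemma homNorm_le_wNorm (hl : 0 < l) (β : ℝ) (x : Lin d) :
    homNorm α β x ≤ l ^ (-β) * wNorm α l x := by
  classical
  rw [homNorm, wNorm, Finset.mul_sum]
  refine (Finset.sum_le_sum fun τ hτ => ?_).trans
    (Finset.sum_le_sum_of_subset_of_nonneg (Finset.filter_subset _ _) fun τ _ _ => ?_)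
  · rw [(Finset.mem_filter.1 hτ).2, mul_left_comm, ← Real.rpow_add hl, neg_add_cancel,
      Real.rpow_zero, mul_one]
  · positivity

lemma wNorm_eq_of_hom {β : ℝ} {x : Lin d} (hx : ∀ τ, x.coeff τ ≠ 0 → τ.hom α = β) :
    wNorm α l x = homNorm α β x * l ^ β := by
  classical
  rw [homNorm_eq_sum x.coeff.support (fun τ hτ => hx τ (Finsupp.mem_support_iff.1 hτ))
    fun τ _ h => Finsupp.mem_support_iff.2 h, Finset.sum_mul, wNorm]
  exact Finset.sum_congr rfl fun τ hτ => by rw [hx τ (Finsupp.mem_support_iff.1 hτ)]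

end WeightedNorm

-- Bounds on Γ_{zz'}

section GammaBound

variable {α γ : ℝ} {K ξ : Pt d → ℝ} {e : Equation}

variable (α K ξ e) in
/-- The morphism `γ_{zz'} = f_z⁻¹ ∘ f_{z'}`. -/
def gammaChar (z z' : Pt d) : TPlus d α e →ₐ[ℝ] ℝ :=
  charMul (charInv (fChar α K ξ e z)) (fChar α K ξ e z')

lemma gammaHat_gammaChar (z z' : Pt d) :
    gammaHat (gammaChar α K ξ e z z') = gammaLin α K ξ e z z' := rfl

lemma gammaChar_Z (z z' : Pt d) (i : Fin (d + 1)) :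
    gammaChar α K ξ e z z' (Zv α e i) = z' i - z i := by
  rw [gammaChar, charMul_Z, charInv_Z, fChar_Z, fChar_Z]
  ring

lemma conv_sum_smul (hK : CompactKernel K) {ι : Type*} (s : Finset ι) (c : ι → ℝ)
    (g : ι → Pt d → ℝ) (hg : ∀ j, Continuous (g j)) :
    conv K (∑ j ∈ s, c j • g j) = ∑ j ∈ s, c j • conv K (g j) := by
  classical
  induction s using Finset.induction_on with
  | empty => simpa using conv_smul (K := K) 0 0
  | insert a s ha ih =>
    rw [Finset.sum_insert ha, Finset.sum_insert ha, conv_add hK ((hg a).const_smul (c a)) ?_, ih,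
      conv_smul]
    exact Finset.sum_induction _ Continuous (fun _ _ => Continuous.add) continuous_zero
      fun j _ => (hg j).const_smul (c j)

/-- The coefficients `γ_{zz'}(𝒥_k(τ))` in terms of Taylor remainders. -/
lemma gammaChar_J (hα : α < 0) (hcrit : e.threshold < α) (h : Admissible γ K ξ) (z z' : Pt d)
    {k : MI d} {τ : Formal d} (hτ : InV e τ) (hp : τ ∉ Formal.poly d) (hγ : τ.hom α < γ)
    (hk : (sdeg k : ℝ) < τ.hom α + 2) :
    gammaChar α K ξ e z z' (Jv α e k τ) =
      ∑ σ ∈ (gammaLin α K ξ e z z' (basis τ)).coeff.support,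
        (gammaLin α K ξ e z z' (basis τ)).coeff σ *
          taylorRem (σ.hom α + 2 - sdeg k) (Dk k (conv K (piFun α K ξ z σ))) z z' := by
  have hJ : JOk α e k τ := ⟨Or.inr hτ, hp, hk⟩
  set f := fChar α K ξ e z
  set f' := fChar α K ξ e z'
  set g := gammaChar α K ξ e z z'
  set x := gammaLin α K ξ e z z' (basis τ)
  have hUV : ∀ {y : Lin d}, y ∈ spanOf (UV d e) → gammaHat (charMul f g) y = gammaHat f' y :=
    fun hy => (gammaHat_charMul hα hcrit f g hy).trans (gammaHat_gammaLin hα hcrit z z' hy)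
  -- The relation f_z ∘ γ_{zz'} = f_{z'} on this generator is read off from the operator identity
  -- through `apply_J_eq`, which avoids coassociativity of Δ⁺.
  have h1 : charMul f g (Jv α e k τ) = f' (Jv α e k τ) := by
    refine apply_J_eq (fun i => ?_) (hUV (basis_mem_spanOf (Or.inr hτ)))
      (hUV (basis_mem_spanOf (Or.inl (InU.int _ _ hτ hp)))) k
    rw [charMul_Z, gammaChar_Z, fChar_Z, fChar_Z]
    ring
  have hτb : τ ∈ basisSet d α e γ := ⟨Or.inr hτ, hγ⟩
  have hxV : x ∈ spanOf {σ | InV e σ ∧ σ.hom α ≤ τ.hom α} := gammaHat_InV_mem hτ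
  have hxb : ∀ σ ∈ x.coeff.support, σ ∈ UV d e ∧ σ.hom α ≤ τ.hom α := fun σ hσ => by
    have := mem_spanOf.1 hxV σ (Finsupp.mem_support_iff.1 hσ)
    exact ⟨Or.inr this.1, this.2⟩
  have hsm : ∀ σ, ContDiff ℝ ∞ (piFun α K ξ z σ) := fun σ =>
    (jointlySmooth_piFun h.kernel h.noise σ).section z
  have hsm' : ∀ σ, ContDiff ℝ ∞ (conv K (piFun α K ξ z σ)) := fun σ =>
    conv_contDiff h.kernel (hsm σ)
  have h2 : f' (Jv α e k τ) =
      ∑ σ ∈ x.coeff.support, x.coeff σ * Dk k (conv K (piFun α K ξ z σ)) z' := by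
    rw [fChar_J z' hJ]
    have h3 : piFun α K ξ z' τ = ∑ σ ∈ x.coeff.support, x.coeff σ • piFun α K ξ z σ := by
      rw [← piLin_basis, ← piLin_gammaLin hα hcrit h z z' (basis_mem_modelSpace hτb)]
      conv_lhs => rw [show gammaLin α K ξ e z z' (basis τ) = x from rfl, eq_sum_basis x]
      simp [piLin_basis]
    rw [h3, conv_sum_smul h.kernel _ _ _ fun σ => (hsm σ).continuous, Dk_sum_smul _ _ _ hsm']
    simp
  have h3 : ∀ m, f (Jlin α e (k + m) x) =
      ∑ σ ∈ x.coeff.support, x.coeff σ * f (Jv α e (k + m) σ) := by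
    intro m
    conv_lhs => rw [eq_sum_basis x]
    simp [Jlin_basis]
  -- This is solved for γ_{zz'}(𝒥_k(τ)): f_{z'} contributes the values of D^k K ⋆ Π_z σ at z', and
  -- f_z their Taylor coefficients at z.
  rw [charMul_J f g hJ, show gammaHat g (basis τ) = x from rfl, h2] at h1
  simp only [h3, Finset.sum_mul] at h1
  rw [Finset.sum_comm] at h1
  rw [← eq_sub_iff_add_eq, ← Finset.sum_sub_distrib] at h1
  rw [h1]
  refine Finset.sum_congr rfl fun σ hσ => ?_
  obtain ⟨hσUV, hσ'⟩ := hxb σ hσ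
  simp only [mul_assoc]
  rw [← Finset.mul_sum, ← mul_sub]
  congr 1
  -- For a Taylor monomial both sides vanish: there is no generator 𝒥_k(σ), and convolution with K
  -- kills Π_z σ.
  by_cases hσp : σ ∈ Formal.poly d
  · have h4 : conv K (piFun α K ξ z σ) = 0 :=
      conv_piFun_poly hα hcrit h z ⟨hσUV, hσ'.trans_lt hγ⟩ hσp
    have h5 : ∀ m : MI d, Dk m (0 : Pt d → ℝ) = 0 := fun m => by
      have := Dk_sum_smul (∅ : Finset ℕ) (fun _ => 0) (fun _ => (0 : Pt d → ℝ))
        (fun _ => contDiff_const) m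
      simpa using this
    rw [h4, taylorRem]
    simp only [h5, Pi.zero_apply, mul_zero, Finset.sum_const_zero, sub_zero, zero_sub,
      neg_eq_zero]
    exact Finset.sum_eq_zero fun m _ => by
      rw [Jv_eq_zero fun hJ => hJ.2.1 hσp, map_zero, zero_mul]
  · rw [taylorRem]
    congr 1
    -- The range of m comes from τ, but 𝒥_{k+m}(σ) is a generator only for |m| < |σ| + 2 - |k|,
    -- which is the order of the remainder for σ.
    rw [← Finset.sum_subset (s₁ := below d (σ.hom α + 2 - sdeg k)) (fun m hm => ?_)
      fun m _ hm => ?_]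
    · refine Finset.sum_congr rfl fun m hm => ?_
      have hm' := mem_below.1 hm
      have hJm : JOk α e (k + m) σ := by
        refine ⟨hσUV, hσp, ?_⟩
        rw [sdeg_add]
        push_cast
        linarith
      have hZ : (fun i => g (Zv α e i)) = z' - z := funext fun i => gammaChar_Z z z' i
      rw [fChar_J z hJm, hZ, Dk_Dk (hsm' σ) k m, mul_comm]
    · rw [mem_below] at hm ⊢
      have : (0 : ℝ) ≤ sdeg k := Nat.cast_nonneg _
      linarith
    · rw [Jv_eq_zero fun hJ => hm (mem_below.2 ?_), map_zero, zero_mul]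
      have := hJ.2.2
      rw [sdeg_add] at this
      push_cast at this
      linarith

/-- Weighted bound on `Γ_{zz'}`. -/
theorem gammaLin_bound (hα : α < 0) (hcrit : e.threshold < α) (h : Admissible γ K ξ)
    {Q : Set (Pt d)} (hQ : IsCompact Q) (L : ℝ) {τ : Formal d} (hτ : τ ∈ basisSet d α e γ) :
    ∃ C, 0 ≤ C ∧ ∀ z ∈ Q, ∀ z', ∀ l, 0 < l → l ≤ L → pnorm (z' - z) ≤ l →
      wNorm α l (gammaLin α K ξ e z z' (basis τ)) ≤ C * l ^ τ.hom α := by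
  have hfin : (basisSet d α e γ).Finite := finite_basisSet hα hcrit γ
  have hI : ∀ τ : Formal d, InV e τ → τ ∉ Formal.poly d → τ.hom α < γ →
      (∃ C, 0 ≤ C ∧ ∀ z ∈ Q, ∀ z', ∀ l, 0 < l → l ≤ L → pnorm (z' - z) ≤ l →
        wNorm α l (gammaLin α K ξ e z z' (basis τ)) ≤ C * l ^ τ.hom α) →
      ∃ C, 0 ≤ C ∧ ∀ z ∈ Q, ∀ z', ∀ l, 0 < l → l ≤ L → pnorm (z' - z) ≤ l →
        wNorm α l (gammaLin α K ξ e z z' (basis (Formal.I τ))) ≤ C * l ^ (Formal.I τ).hom α := by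
    rintro τ hτ hp hγ ⟨C, hC0, hC⟩
    have hR : ∀ (k : MI d) (σ : Formal d), ∃ C, 0 ≤ C ∧ ∀ z ∈ Q, ∀ l, 0 < l → l ≤ L → ∀ w,
        pnorm (w - z) ≤ l →
          |taylorRem (σ.hom α + 2 - sdeg k) (Dk k (conv K (piFun α K ξ z σ))) z w| ≤
            C * l ^ (σ.hom α + 2 - sdeg k) := fun k σ =>
      taylorRem_bound hQ L (((jointlySmooth_piFun h.kernel h.noise σ).conv h.kernel).Dk k) _
    choose R hR0 hR using hR
    -- The remainder for σ has size l^{|σ| + 2 - |k|}. Factoring out l^{2 - |k|} leaves the weighted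
    -- norm of Γ_{zz'}τ, to which the induction hypothesis applies; the sum of `R k` over the finite
    -- basis dominates each `R k σ`.
    have hJ : ∀ k ∈ below d (τ.hom α + 2), ∀ z ∈ Q, ∀ z', ∀ l, 0 < l → l ≤ L → pnorm (z' - z) ≤ l →
        |gammaChar α K ξ e z z' (Jv α e k τ)| ≤
          (∑ σ ∈ hfin.toFinset, R k σ) * C * l ^ (τ.hom α + 2 - sdeg k) := by
      intro k hk z hz z' l hl hlL hzz
      rw [gammaChar_J hα hcrit h z z' hτ hp hγ (mem_below.1 hk)]
      set x := gammaLin α K ξ e z z' (basis τ)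
      have hx : ∀ σ ∈ x.coeff.support, σ ∈ hfin.toFinset := fun σ hσ =>
        hfin.mem_toFinset.2 (mem_modelSpace.1 (gammaLin_mem z z'
          (basis_mem_modelSpace ⟨Or.inr hτ, hγ⟩)) σ (Finsupp.mem_support_iff.1 hσ))
      refine (Finset.abs_sum_le_sum_abs _ _).trans ?_
      have h1 : ∀ σ ∈ x.coeff.support, |x.coeff σ *
          taylorRem (σ.hom α + 2 - sdeg k) (Dk k (conv K (piFun α K ξ z σ))) z z'| ≤
            (∑ σ ∈ hfin.toFinset, R k σ) * l ^ (2 - sdeg k : ℝ) *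
              (|x.coeff σ| * l ^ σ.hom α) := by
        intro σ hσ
        rw [abs_mul]
        refine (mul_le_mul_of_nonneg_left (hR k σ z hz l hl hlL z' hzz) (abs_nonneg _)).trans ?_
        have h2 : R k σ ≤ ∑ σ ∈ hfin.toFinset, R k σ :=
          Finset.single_le_sum (f := R k) (fun σ _ => hR0 k σ) (hx σ hσ)
        have h3 : l ^ (σ.hom α + 2 - sdeg k) = l ^ (2 - sdeg k : ℝ) * l ^ σ.hom α := by
          rw [← Real.rpow_add hl]; congr 1; ring
        rw [h3]
        have h4 : 0 ≤ |x.coeff σ| * (l ^ (2 - sdeg k : ℝ) * l ^ σ.hom α) := by positivity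
        nlinarith [mul_le_mul_of_nonneg_right h2 h4]
      refine (Finset.sum_le_sum h1).trans ?_
      rw [← Finset.mul_sum]
      have h2 : l ^ (τ.hom α + 2 - sdeg k) = l ^ (2 - sdeg k : ℝ) * l ^ τ.hom α := by
        rw [← Real.rpow_add hl]; congr 1; ring
      have h3 := hC z hz z' l hl hlL hzz
      rw [wNorm] at h3
      refine (mul_le_mul_of_nonneg_left h3 ?_).trans (le_of_eq ?_)
      · exact mul_nonneg (Finset.sum_nonneg fun σ _ => hR0 k σ) (Real.rpow_nonneg hl.le _)
      · rw [h2]; ring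
    refine ⟨C + ∑ k ∈ below d (τ.hom α + 2), (∑ σ ∈ hfin.toFinset, R k σ) * C *
      ((mfact k : ℝ)⁻¹ * (∏ i, (2 : ℝ) ^ k i)), ?_, fun z hz z' l hl hlL hzz => ?_⟩
    · refine add_nonneg hC0 (Finset.sum_nonneg fun k _ => ?_)
      have h1 : 0 ≤ ∑ σ ∈ hfin.toFinset, R k σ := Finset.sum_nonneg fun σ _ => hR0 k σ
      have h2 := (inv_pos.2 (mfact_pos k)).le
      positivity
    · rw [← gammaHat_gammaChar, gammaHat_I, Formal.hom_I, add_mul, Finset.sum_mul]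
      -- I gains l²; in the polynomial part l^{|τ| + 2 - |k|} from the coefficient meets l^{|k|}
      -- from `shiftPow`.
      refine (wNorm_sub hl.le _ _).trans (add_le_add ?_ ?_)
      · refine (wNorm_intMap_le hl _).trans ?_
        refine (mul_le_mul_of_nonneg_left (hC z hz z' l hl hlL hzz)
          (Real.rpow_nonneg hl.le _)).trans (le_of_eq ?_)
        rw [Real.rpow_add hl]; ring
      · refine (wNorm_sum_le hl.le _ _).trans (Finset.sum_le_sum fun k hk => ?_)
        rw [wNorm_smul]
        have h1 := wNorm_shiftPow_le (α := α) hl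
          (c := fun i => -gammaChar α K ξ e z z' (Zv α e i)) (fun i => by
            rw [abs_neg, gammaChar_Z]
            exact abs_le_pow_wt hzz i) k
        refine (mul_le_mul (hJ k hk z hz z' l hl hlL hzz) h1 (wNorm_nonneg hl.le _)
          ((abs_nonneg _).trans (hJ k hk z hz z' l hl hlL hzz))).trans (le_of_eq ?_)
        have h2 : l ^ (τ.hom α + 2) = l ^ (τ.hom α + 2 - sdeg k) * l ^ sdeg k := by
          rw [← Real.rpow_natCast, ← Real.rpow_add hl]; congr 1; ring
        rw [h2]; ring
  refine UV_induction (P := fun τ => ∃ C, 0 ≤ C ∧ ∀ z ∈ Q, ∀ z', ∀ l, 0 < l → l ≤ L →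
    pnorm (z' - z) ≤ l → wNorm α l (gammaLin α K ξ e z z' (basis τ)) ≤ C * l ^ τ.hom α)
    hα hcrit γ ?_ ?_ ?_ ?_ ?_ ?_ hτ.1 hτ.2
  · refine ⟨1, zero_le_one, fun z _ z' l _ _ _ => ?_⟩
    rw [← gammaHat_gammaChar, basis_one, gammaHat_one, wNorm_one]
    simp
  · refine fun i => ⟨2, zero_le_two, fun z _ z' l hl _ hzz => ?_⟩
    rw [← gammaHat_gammaChar, gammaHat_X, Formal.hom_X, Real.rpow_natCast]
    refine wNorm_X_add_le hl ?_
    rw [abs_neg, gammaChar_Z]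
    exact abs_le_pow_wt hzz i
  · refine ⟨1, zero_le_one, fun z _ z' l _ _ _ => ?_⟩
    rw [← gammaHat_gammaChar, gammaHat_Xi, wNorm_basis, one_mul]
  · rintro a b ⟨C, hC0, hC⟩ ⟨C', hC0', hC'⟩
    refine ⟨C * C', mul_nonneg hC0 hC0', fun z hz z' l hl hlL hzz => ?_⟩
    rw [← gammaHat_gammaChar, basis_mul, gammaHat_mul, Formal.hom_mul, Real.rpow_add hl]
    refine (wNorm_mul hl _ _).trans ((mul_le_mul (hC z hz z' l hl hlL hzz)
      (hC' z hz z' l hl hlL hzz) (wNorm_nonneg hl.le _)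
      (mul_nonneg hC0 (Real.rpow_nonneg hl.le _))).trans (le_of_eq (by ring)))
  · exact hI
  · rintro i τ hτ hp hγ _ ⟨C, hC0, hC⟩
    refine ⟨max 1 (τ.hom α + 2) * C, mul_nonneg (by positivity) hC0,
      fun z hz z' l hl hlL hzz => ?_⟩
    rw [← gammaHat_gammaChar, gammaHat_D, Formal.hom_D]
    have h1 := gammaHat_InU_mem (f := gammaChar α K ξ e z z') (InU.int _ _ hτ hp)
    rw [Formal.hom_I] at h1
    refine (wNorm_derMap_le hl i h1).trans ?_
    refine (mul_le_mul_of_nonneg_left (hC z hz z' l hl hlL hzz) (by positivity)).trans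
      (le_of_eq ?_)
    rw [sub_eq_add_neg, Real.rpow_add hl]; ring

end GammaBound

/-! ### The canonical model -/

section CanonicalModel

open MeasureTheory

variable {α γ : ℝ} {K ξ : Pt d → ℝ} {e : Equation}

/-- The distribution associated with a continuous function. -/
def toDistr (g : Pt d → ℝ) : Distr d :=
  TestFunction.integralAgainstBilinCLM (ContinuousLinearMap.mul ℝ ℝ) volume g

lemma toDistr_apply {g : Pt d → ℝ} (hg : Continuous g) (φ : Test d) :
    toDistr g φ = ∫ w, g w * φ w := by
  refine (TestFunction.integralAgainstBilinCLM_eq_integral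
    (hg.locallyIntegrable.locallyIntegrableOn _)).trans ?_
  exact integral_congr_ae (Filter.Eventually.of_forall fun w => mul_comm _ _)

lemma integrable_mul_test {g : Pt d → ℝ} (hg : Continuous g) (φ : Test d) :
    Integrable fun w => g w * φ w :=
  (hg.mul φ.contDiff.continuous).integrable_of_hasCompactSupport φ.hasCompactSupport.mul_left

/-- The map `Π_z` of the canonical model. -/
def modelPi (e : Equation) (γ : ℝ) (hK : CompactKernel K) (hξ : ContDiff ℝ ∞ ξ) (z : Pt d) :
    modelSpace d α e γ →ₗ[ℝ] Distr d where
  toFun x := toDistr (piLin α K ξ z x)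
  map_add' x y := by
    have hc := fun x => (contDiff_piLin (α := α) hK hξ z x).continuous
    refine ContinuousLinearMap.ext fun φ => ?_
    refine (toDistr_apply (hc _) φ).trans (Eq.trans ?_ (congr_arg₂ (· + ·)
      (toDistr_apply (hc x) φ) (toDistr_apply (hc y) φ)).symm)
    rw [← integral_add (integrable_mul_test (hc x) φ) (integrable_mul_test (hc y) φ)]
    simp [add_mul]
  map_smul' c x := by
    have hc := fun x => (contDiff_piLin (α := α) hK hξ z x).continuous
    refine ContinuousLinearMap.ext fun φ => ?_
    refine (toDistr_apply (hc _) φ).trans (Eq.trans ?_ (congr_arg (c * ·)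
      (toDistr_apply (hc x) φ)).symm)
    rw [← integral_const_mul]
    simp [mul_assoc]

lemma modelPi_apply (hK : CompactKernel K) (hξ : ContDiff ℝ ∞ ξ) (z : Pt d)
    (x : modelSpace d α e γ) (φ : Test d) :
    modelPi e γ hK hξ z x φ = ∫ w, piLin α K ξ z x w * φ w :=
  toDistr_apply (contDiff_piLin hK hξ z x).continuous φ

lemma modelPi_continuous (hα : α < 0) (hcrit : e.threshold < α) (hK : CompactKernel K)
    (hξ : ContDiff ℝ ∞ ξ) (z : Pt d) (β : ℝ) (φ : Test d) :
    ∃ C : ℝ, ∀ x : modelSpace d α e γ, x ∈ compSub d α e γ β →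
      |modelPi e γ hK hξ z x φ| ≤ C * homNorm α β (x : Lin d) := by
  have hc := fun x => (contDiff_piLin (α := α) hK hξ z x).continuous
  have hadd : ∀ x y : Lin d, |∫ w, piLin α K ξ z (x + y) w * φ w| ≤
      |∫ w, piLin α K ξ z x w * φ w| + |∫ w, piLin α K ξ z y w * φ w| := by
    intro x y
    refine le_trans (le_of_eq ?_) (abs_add_le _ _)
    rw [← integral_add (integrable_mul_test (hc x) φ) (integrable_mul_test (hc y) φ)]
    simp [add_mul]
  have hsmul : ∀ (c : ℝ) (x : Lin d), |∫ w, piLin α K ξ z (c • x) w * φ w| =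
      |c| * |∫ w, piLin α K ξ z x w * φ w| := by
    intro c x
    rw [← abs_mul, ← integral_const_mul]
    simp [mul_assoc]
  obtain ⟨C, hC⟩ := exists_bound (e := e) (finite_basisSet hα hcrit γ) β
    (fun x => |∫ w, piLin α K ξ z x w * φ w|) hadd hsmul
  exact ⟨C, fun x hx => by rw [modelPi_apply]; exact hC x hx⟩

lemma pnorm_zoom (z : Pt d) {l : ℝ} (hl : 0 < l) (w : Pt d) :
    pnorm (zoom z l w) = l⁻¹ * pnorm (w - z) := by
  have hl' : 0 ≤ l⁻¹ := (inv_pos.2 hl).le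
  have h1 : √|zoom z l w 0| = l⁻¹ * √|w 0 - z 0| := by
    rw [zoom, if_pos rfl, abs_mul, ← inv_pow, abs_of_nonneg (sq_nonneg _),
      Real.sqrt_mul (sq_nonneg _), Real.sqrt_sq hl']
  have h2 : ∑ i : Fin d, zoom z l w i.succ ^ 2 =
      l⁻¹ ^ 2 * ∑ i : Fin d, (w i.succ - z i.succ) ^ 2 := by
    rw [Finset.mul_sum]
    exact Finset.sum_congr rfl fun i _ => by
      rw [zoom, if_neg (Fin.succ_ne_zero i), mul_pow]
  rw [pnorm, pnorm, h1, h2, Real.sqrt_mul (sq_nonneg _), Real.sqrt_sq hl', mul_add]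
  rfl

/-- Uniform bound on `Π_z` near the base point. -/
lemma piLin_bound (hα : α < 0) (hcrit : e.threshold < α) (hK : CompactKernel K)
    (hξ : ContDiff ℝ ∞ ξ) {Q : Set (Pt d)} (hQ : IsCompact Q) (L : ℝ) :
    ∃ C, 0 ≤ C ∧ ∀ z ∈ Q, ∀ β, ∀ x : modelSpace d α e γ, x ∈ compSub d α e γ β →
      ∀ l, 0 < l → l ≤ L → ∀ w, pnorm (w - z) ≤ l →
        |piLin α K ξ z x w| ≤ C * l ^ β * homNorm α β (x : Lin d) := by
  have hfin := finite_basisSet (d := d) hα hcrit γ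
  have h1 := fun τ : basisSet d α e γ => piFun_bound hα hcrit hK hξ hQ L τ.2.1
  choose C hC0 hC using h1
  have := hfin.fintype
  refine ⟨∑ τ, C τ, Finset.sum_nonneg fun τ _ => hC0 τ, fun z hz β x hx l hl hlL w hw => ?_⟩
  have h2 : piLin α K ξ z x w = ∑ τ ∈ (x : Lin d).coeff.support,
      (x : Lin d).coeff τ * piFun α K ξ z τ w := by
    conv_lhs => rw [eq_sum_basis (x : Lin d)]
    simp [piLin_basis]
  rw [h2, homNorm_eq_sum (α := α) (β := β) (x : Lin d).coeff.support
    (fun τ hτ => mem_compSub.1 hx τ (Finsupp.mem_support_iff.1 hτ))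
    fun τ _ h => Finsupp.mem_support_iff.2 h, Finset.mul_sum]
  refine (Finset.abs_sum_le_sum_abs _ _).trans (Finset.sum_le_sum fun τ hτ => ?_)
  have hτ' := Finsupp.mem_support_iff.1 hτ
  have hτb := mem_modelSpace.1 x.2 τ hτ'
  rw [abs_mul, mul_comm]
  refine mul_le_mul_of_nonneg_right ?_ (abs_nonneg _)
  refine (hC ⟨τ, hτb⟩ z hz l hl hlL w hw).trans ?_
  rw [mem_compSub.1 hx τ hτ']
  exact mul_le_mul_of_nonneg_right
    (Finset.single_le_sum (f := C) (fun τ _ => hC0 τ) (Finset.mem_univ _))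
    (Real.rpow_nonneg hl.le _)

/-- The rescaled test function has height at most l^{-(d+2)} and lives in a ball of volume at most
2^{d+1} l^{d+2}, so these powers cancel and the pointwise bound l^β on that ball survives. -/
lemma modelPi_bound (hα : α < 0) (hcrit : e.threshold < α) (hK : CompactKernel K)
    (hξ : ContDiff ℝ ∞ ξ) {Q : Set (Pt d)} (hQ : IsCompact Q) (r : ℝ) :
    ∃ C, ∀ z ∈ Q, ∀ β, ∀ x : modelSpace d α e γ, x ∈ compSub d α e γ β →
      ∀ φ ∈ testBall d r, ∀ (l : ℝ) (hl : 0 < l), l ≤ 1 →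
        |modelPi e γ hK hξ z x (rescale φ z l hl)| ≤ C * l ^ β * homNorm α β (x : Lin d) := by
  obtain ⟨C, hC0, hC⟩ := piLin_bound (e := e) (γ := γ) hα hcrit hK hξ hQ 1
  refine ⟨C * 2 ^ (d + 1), fun z hz β x hx φ hφ l hl hl1 => ?_⟩
  rw [modelPi_apply]
  set M := C * l ^ β * homNorm α β (x : Lin d)
  have hM : 0 ≤ M := mul_nonneg (mul_nonneg hC0 (Real.rpow_nonneg hl.le _)) (homNorm_nonneg _ _)
  have hlp : 0 < (l ^ (d + 2))⁻¹ := by positivity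
  have hsupp : ∀ w, l < pnorm (w - z) → rescale φ z l hl w = 0 := by
    intro w hw
    have h1 : φ (zoom z l w) = 0 := hφ.1 _ (by
      rw [pnorm_zoom z hl, inv_mul_eq_div, one_lt_div hl]; exact hw)
    exact mul_eq_zero_of_right _ h1
  have hle : ∀ w, |rescale φ z l hl w| ≤ (l ^ (d + 2))⁻¹ := by
    intro w
    have h1 := hφ.2 0 (by rw [sdeg_zero, Nat.cast_zero]; positivity) (zoom z l w)
    rw [Dk_zero] at h1
    change |(l ^ (d + 2))⁻¹ * φ (zoom z l w)| ≤ _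
    rw [abs_mul, abs_of_pos hlp]
    exact mul_le_of_le_one_right hlp.le h1
  have h1 := lintegral_enorm_le_of_pnorm
    (f := fun w => piLin α K ξ z x w * rescale φ z l hl w)
    (M := M * (l ^ (d + 2))⁻¹) z (by positivity) hl.le (fun w => ?_)
    fun w hw => by rw [hsupp w hw, mul_zero]
  · rw [← Real.norm_eq_abs]
    refine (norm_integral_le_lintegral_norm _).trans ?_
    simp only [ofReal_norm]
    refine (ENNReal.toReal_mono ENNReal.ofReal_ne_top h1).trans ?_
    rw [ENNReal.toReal_ofReal (by positivity)]
    refine le_of_eq ?_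
    simp only [M]
    field_simp
  · rw [abs_mul]
    by_cases hw : pnorm (w - z) ≤ l
    · exact mul_le_mul (hC z hz β x hx l hl hl1 w hw) (hle w) (abs_nonneg _) hM
    · rw [hsupp w (not_le.1 hw), abs_zero, mul_zero]
      positivity

/-- The weighted bound is applied with l = |z - z'|, which is at most a bound L for the distances
within Q. -/
lemma gammaLin_homNorm_bound (hα : α < 0) (hcrit : e.threshold < α) (h : Admissible γ K ξ)
    {Q : Set (Pt d)} (hQ : IsCompact Q) :
    ∃ C, ∀ z ∈ Q, ∀ z' ∈ Q, ∀ β β', β' < β →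
      ∀ x : modelSpace d α e γ, x ∈ compSub d α e γ β →
        homNorm α β' (gammaLin α K ξ e z z' (x : Lin d)) ≤
          C * pnorm (z - z') ^ (β - β') * homNorm α β (x : Lin d) := by
  have hfin := finite_basisSet (d := d) hα hcrit γ
  obtain ⟨L, hL⟩ := (hQ.prod hQ).bddAbove_image
    (f := fun p : Pt d × Pt d => pnorm (p.1 - p.2))
    (continuous_pnorm.comp (continuous_fst.sub continuous_snd)).continuousOn
  have h1 := fun τ : basisSet d α e γ => gammaLin_bound hα hcrit h hQ L τ.2
  choose C hC0 hC using h1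
  have := hfin.fintype
  have hS : 0 ≤ ∑ τ, C τ := Finset.sum_nonneg fun τ _ => hC0 τ
  refine ⟨∑ τ, C τ, fun z hz z' hz' β β' hβ x hx => ?_⟩
  -- The weights require l > 0. On the diagonal Γ is the identity and x has no component below β.
  rcases eq_or_ne z z' with rfl | hne
  · rw [gammaLin_self hα hcrit z (modelSpace_le x.2), homNorm_eq_zero fun τ hτ => ?_]
    · exact mul_nonneg (mul_nonneg hS (Real.rpow_nonneg (pnorm_nonneg _) _)) (homNorm_nonneg _ _)
    · by_contra h'
      exact hβ.ne (hτ.symm.trans (mem_compSub.1 hx τ h'))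
  · set l := pnorm (z - z') with hldef
    have hl : 0 < l := pnorm_pos (sub_ne_zero.2 hne)
    have hlL : l ≤ L := hL ⟨(z, z'), ⟨hz, hz'⟩, rfl⟩
    have h2 := wNorm_map_le (α := α) hl (T := gammaLin α K ξ e z z') (S := basisSet d α e γ)
      (C := ∑ τ, C τ) (s := 0) (fun τ hτ => ?_) x.2
    · refine (homNorm_le_wNorm hl β' _).trans ((mul_le_mul_of_nonneg_left h2
        (Real.rpow_nonneg hl.le _)).trans (le_of_eq ?_))
      rw [wNorm_eq_of_hom (mem_compSub.1 hx), sub_eq_add_neg, Real.rpow_add hl, Real.rpow_zero]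
      ring
    · rw [add_zero]
      refine (hC ⟨τ, hτ⟩ z hz z' l hl hlL (pnorm_sub_comm z' z).le).trans ?_
      exact mul_le_mul_of_nonneg_right (Finset.single_le_sum (f := C) (fun τ _ => hC0 τ)
        (Finset.mem_univ _)) (Real.rpow_nonneg hl.le _)

theorem isModel (hα : α < 0) (hcrit : e.threshold < α) (hγ : 0 < γ) (h : Admissible γ K ξ) :
    IsModel (regData d α e hγ) (modelPi e γ h.kernel h.noise)
      (fun z z' => gammaRes γ (gammaChar α K ξ e z z')) := by
  refine
    { continuous := fun z β _ φ => modelPi_continuous hα hcrit h.kernel h.noise z β φ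
      mem_group := fun z z' => ⟨gammaChar α K ξ e z z', fun _ => rfl⟩
      alg_Pi := fun z z' => ?_
      alg_Gamma := fun z z' z'' => ?_
      bound_Pi := fun Q hQ => ?_
      bound_Gamma := fun Q hQ => ?_ }
  · exact LinearMap.ext fun x =>
      congr_arg toDistr (piLin_gammaLin hα hcrit h z z'
        (Subtype.prop (p := (· ∈ modelSpace d α e γ)) x))
  · exact LinearMap.ext fun x => Subtype.ext
      (gammaLin_gammaLin hα hcrit z z' z''
        (modelSpace_le (Subtype.prop (p := (· ∈ modelSpace d α e γ)) x)))
  · obtain ⟨C, hC⟩ := modelPi_bound (e := e) (γ := γ) hα hcrit h.kernel h.noise hQ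
      (sInf (regData d α e hγ).A)
    exact ⟨C, fun z hz β _ x hx φ hφ l hl hl1 => hC z hz β x hx φ hφ l hl hl1⟩
  · obtain ⟨C, hC⟩ := gammaLin_homNorm_bound (e := e) hα hcrit h hQ
    exact ⟨C, fun z hz z' hz' β _ β' _ hβ x hx => hC z hz z' hz' β β' hβ x hx⟩

end CanonicalModel

end RS

end

-- The main theorem

theorem mainTheorem7 (d : ℕ) (e : RS.Equation) (α γ : ℝ)
    (hα : α < 0) (hcrit : e.threshold < α) (hγ : 0 < γ)
    (hzero : ∀ τ ∈ RS.basisSet d α e γ, τ.hom α = 0 → τ = 1)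
    (K : RS.Pt d → ℝ) (hK : RS.IsKernel 2 K)
    (hKpoly : ∀ k : RS.MI d, (RS.sdeg k : ℝ) < γ → ∫ z, K z * RS.mpow z k = 0)
    (ξ : RS.Pt d → ℝ) (hξ : ContDiff ℝ ∞ ξ) :
    RS.IsRegularityStructure (RS.regData d α e hγ) ∧
    (∀ f : RS.TPlus d α e →ₐ[ℝ] ℝ, ∀ x ∈ RS.modelSpace d α e γ,
      RS.gammaHat f x ∈ RS.modelSpace d α e γ) ∧
    (∀ z, ∀ x ∈ RS.modelSpace d α e γ, ContDiff ℝ ∞ (RS.piLin α K ξ z x)) ∧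
    ∃ (P : RS.Pt d → RS.modelSpace d α e γ →ₗ[ℝ] RS.Distr d)
      (Γ : RS.Pt d → RS.Pt d → RS.modelSpace d α e γ →ₗ[ℝ] RS.modelSpace d α e γ),
      (∀ z x (φ : RS.Test d), P z x φ = ∫ w, RS.piLin α K ξ z x w * φ w) ∧
      (∀ z z' x, (Γ z z' x : RS.Lin d) = RS.gammaLin α K ξ e z z' x) ∧
      RS.IsModel (RS.regData d α e hγ) P Γ := by
  have hK' := hK.compactKernel
  refine ⟨RS.isRegularityStructure hα hcrit hγ hzero, fun f x hx => RS.gammaHat_modelSpace γ hx,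
    fun z x _ => RS.contDiff_piLin hK' hξ z x, RS.modelPi e γ hK' hξ,
    fun z z' => RS.gammaRes γ (RS.gammaChar α K ξ e z z'), ?_, fun _ _ _ => rfl,
    RS.isModel hα hcrit hγ ⟨hK', hξ, hKpoly⟩⟩
  exact fun z x φ => RS.modelPi_apply hK' hξ z x φ
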